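/- Let $d\ge 1$, $\alpha\in(0,2)$, $m>0$, $\gamma>0$. Let $(\Omega,\mathcal F,\mathbf P)$ be a probability space with an ergodic dynamical system $(T_y)_{y\in\mathbb R^d}$, i.e. $T_0=\mathrm{Id}$, $T_{y_1+y_2}=T_{y_1}T_{y_2}$, each $T_y$ preserves $\mathbf P$, the map $(y,\omega)\mapsto T_y\omega$ is jointly measurable, and every $A\in\mathcal F$ with $T_yA=A$ for all $y$ has probability $0$ or $1$. $H^{\alpha/2}(\mathbb R^d)$ is the space of all $u\in L^2(\mathbb R^d)$ (real-valued) with $$\|u\|_{H^{\alpha/2}}^2=\int_{\mathbb R^d} u^2\,dx+\iint_{\mathbb R^d\times\mathbb R^d}\frac{(u(y)-u(x))^2}{|y-x|^{d+\alpha}}\,dx\,dy<\infty .$$ For a measurable kernel $K(x,y)$ and a measurable weight $\nu(x)$, both bounded and bounded away from $0$ by positive constants, with $K(x,y)\nu(x)$ symmetric, let $L$, formally given by $$Lu(x)=\int_{\mathbb R^d}\frac{K(x,y)\,(u(y)-u(x))}{|y-x|^{d+\alpha}}\,dy ,$$ be the self-adjoint operator in $L^2(\mathbb R^d,\nu\,dx)$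 associated with the closed quadratic form with domain $H^{\alpha/2}(\mathbb R^d)$: one has $u\in\mathcal D(L)$ and $Lu=g\in L^2(\mathbb R^d)$ if and only if $u\in H^{\alpha/2}(\mathbb R^d)$ and $$\int_{\mathbb R^d} g\,v\,\nu\,dx=-\frac12\iint_{\mathbb R^d\times\mathbb R^d}\frac{K(x,y)\,\nu(x)\,(u(y)-u(x))(v(y)-v(x))}{|y-x|^{d+\alpha}}\,dx\,dy\qquad\text{for all } v\in H^{\alpha/2}(\mathbb R^d).$$ For $\varepsilon>0$ let $L^\varepsilon$ be the operator with kernel $\Lambda^\varepsilon=\Lambda^\varepsilon(\cdot,\cdot,\omega)$ and weight $\nu^\varepsilon=\nu^\varepsilon(\cdot,\omega)$, and let $L^0$ be the operator with kernel $\Lambda^{\rm eff}$ and weight $1$, in one of the following two cases. (Q1) $\widehat\lambda,\widehat\mu:\Omega\to\mathbb R$ are random variables with $\gamma^{-1}\le\widehat\lambda\le\gamma$ and $\gamma^{-1}\le\widehat\mu\le\gamma$ almost surely, and $$\Lambda^\varepsilon(x,y)=\widehat\lambda(T_{x/\varepsilon}\omega)\,\widehat\mu(T_{y/\varepsilon}\omega),\qquad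 \nu^\varepsilon(x)=\frac{\widehat\mu(T_{x/\varepsilon}\omega)}{\widehat\lambda(T_{x/\varepsilon}\omega)},\qquad \Lambda^{\rm eff}=\Big(\mathbf E\frac{\widehat\mu}{\widehat\lambda}\Big)^{-1}\big(\mathbf E\widehat\mu\big)^2 .$$ (Q2) $\Omega$ is a compact metric space, $\mathcal F$ is its Borel $\sigma$-algebra, every $T_x$ is continuous, $\Lambda:\mathbb R^d\times\mathbb R^d\times\Omega\times\Omega\to\mathbb R$ is continuous with $\Lambda(x,y,\omega_1,\omega_2)=\Lambda(y,x,\omega_2,\omega_1)$, and $$\Lambda^\varepsilon(x,y)=\Lambda(x,y,T_{x/\varepsilon}\omega,T_{y/\varepsilon}\omega),\qquad \nu^\varepsilon=1,\qquad \Lambda^{\rm eff}(x,y)=\int_\Omega\int_\Omega\Lambda(x,y,\omega_1,\omega_2)\,d\mathbf P(\omega_1)\,d\mathbf P(\omega_2),$$ where almost surely $\gamma^{-1}\le\Lambda^\varepsilon(x,y)\le\gamma$ for all $\varepsilon>0$ and $x,y\in\mathbb R^d$. Then, in either case, almost surely the following holds for every $f\in L^2(\mathbb R^d)$: the equations $$(L^\varepsilon-m)u^\varepsilon=f\quad(\varepsilon>0),\qquad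 (L^0-m)u^0=f$$ have unique solutions $u^\varepsilon$ and $u^0$, and, as $\varepsilon\to0^+$, $u^\varepsilon$ converges to $u^0$ strongly in $L^2(\mathbb R^d)$ and weakly in $H^{\alpha/2}(\mathbb R^d)$. -/

import Mathlib

open MeasureTheory Filter Topology

/-- `ℝ^d` with the Euclidean norm and Lebesgue measure. -/
abbrev RSpace (d : ℕ) : Type := EuclideanSpace ℝ (Fin d)

/-- The real Hilbert space `L²(ℝ^d)`. -/
abbrev LTwo (d : ℕ) : Type := Lp ℝ 2 (volume : Measure (RSpace d))

/-- The Gagliardo difference quotient `(u(y) - u(x)) / |y - x|^{d/2 + s}`; its square is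
`(u(y) - u(x))² / |y - x|^{d + 2s}`. -/
noncomputable def diffQuot {d : ℕ} (s : ℝ) (u : RSpace d → ℝ) (p : RSpace d × RSpace d) : ℝ :=
  (u p.2 - u p.1) / ‖p.2 - p.1‖ ^ ((d : ℝ) / 2 + s)

/-- The quotient depends only on the a.e. class of `u`. -/
theorem diffQuot_congr {d : ℕ} (s : ℝ) {u v : RSpace d → ℝ} (h : u =ᵐ[volume] v) :
    diffQuot s u =ᵐ[volume] diffQuot s v := by
  have h1 : ∀ᵐ p ∂(volume : Measure (RSpace d × RSpace d)), u p.1 = v p.1 :=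
    Measure.quasiMeasurePreserving_fst.ae h
  have h2 : ∀ᵐ p ∂(volume : Measure (RSpace d × RSpace d)), u p.2 = v p.2 :=
    Measure.quasiMeasurePreserving_snd.ae h
  filter_upwards [h1, h2] with p hp1 hp2
  simp only [diffQuot, hp1, hp2]

/-- The fractional Sobolev space `H^s(ℝ^d)` (used for `0 < s < 1`): the `u ∈ L²(ℝ^d)` with
`∬ (u(y) - u(x))² / |y - x|^{d + 2s} dx dy < ∞`. -/
noncomputable def sobolev (d : ℕ) (s : ℝ) : Submodule ℝ (LTwo d) where
  carrier := {u | MemLp (diffQuot s u) 2 volume}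
  zero_mem' := by
    have h : diffQuot s ((0 : LTwo d) : RSpace d → ℝ) =ᵐ[volume] 0 := by
      refine (diffQuot_congr s (Lp.coeFn_zero ℝ 2 volume)).trans (ae_of_all _ fun p => ?_)
      simp [diffQuot]
    exact (memLp_congr_ae h).2 MemLp.zero
  add_mem' := by
    intro u v hu hv
    have h : diffQuot s ((u + v : LTwo d) : RSpace d → ℝ) =ᵐ[volume]
        diffQuot s u + diffQuot s v := by
      refine (diffQuot_congr s (Lp.coeFn_add u v)).trans (ae_of_all _ fun p => ?_)
      simp only [diffQuot, Pi.add_apply]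
      ring
    exact (memLp_congr_ae h).2 (MemLp.add hu hv)
  smul_mem' := by
    intro c u hu
    have h : diffQuot s ((c • u : LTwo d) : RSpace d → ℝ) =ᵐ[volume] c • diffQuot s u := by
      refine (diffQuot_congr s (Lp.coeFn_smul c u)).trans (ae_of_all _ fun p => ?_)
      simp only [diffQuot, Pi.smul_apply, smul_eq_mul]
      ring
    exact (memLp_congr_ae h).2 (MemLp.const_smul hu c)

/-- The norm of `H^s(ℝ^d)`: the square root of
`∫ u² dx + ∬ (u(y) - u(x))² / |y - x|^{d + 2s} dx dy`. -/
noncomputable def sobolevNorm {d : ℕ} {s : ℝ} (u : sobolev d s) : ℝ :=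
  Real.sqrt ((∫ x, ((u : LTwo d) x) ^ 2) + ∫ p, (diffQuot s (u : LTwo d) p) ^ 2)

/-- Weak convergence in `H^s(ℝ^d)`: convergence of the values of every linear functional that is
bounded for the norm of `H^s(ℝ^d)` (and not merely for the `L²` norm that the submodule
inherits). -/
def TendstoWeaklySobolev {d : ℕ} {s : ℝ} {ι : Type*} (u : ι → sobolev d s) (l : Filter ι)
    (u₀ : sobolev d s) : Prop :=
  ∀ φ : sobolev d s →ₗ[ℝ] ℝ, (∃ C : ℝ, ∀ v, |φ v| ≤ C * sobolevNorm v) →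
    Tendsto (fun i => φ (u i)) l (𝓝 (φ u₀))

/-- The quadratic form of `-L` in `L²(ν dx)` for
`L u(x) = ∫ K(x,y) (u(y) - u(x)) / |y - x|^{d + α} dy`, where `K(x,y) ν(x)` is symmetric:
`½ ∬ K(x,y) ν(x) (u(y) - u(x)) (v(y) - v(x)) / |y - x|^{d + α} dx dy`. -/
noncomputable def levyForm {d : ℕ} (α : ℝ) (K : RSpace d → RSpace d → ℝ) (ν : RSpace d → ℝ)
    (u v : RSpace d → ℝ) : ℝ :=
  (1 / 2) * ∫ p : RSpace d × RSpace d,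
    K p.1 p.2 * ν p.1 * (u p.2 - u p.1) * (v p.2 - v p.1) / ‖p.2 - p.1‖ ^ ((d : ℝ) + α)

/-- The graph of the operator `L` in `L²(ν dx)` associated with the form `levyForm α K ν` with
form domain `H^{α/2}(ℝ^d)`: `u` lies in the domain of `L` and `L u = g`, that is
`(g, v)_{L²(ν dx)} = - levyForm α K ν u v` for all `v` in the form domain. -/
def IsLevyImage {d : ℕ} (α : ℝ) (K : RSpace d → RSpace d → ℝ) (ν : RSpace d → ℝ)
    (u : sobolev d (α / 2)) (g : LTwo d) : Prop :=
  ∀ v : sobolev d (α / 2),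
    ∫ x, g x * (v : LTwo d) x * ν x = - levyForm α K ν (u : LTwo d) (v : LTwo d)

/-- `u` solves `(L - m) u = f`, that is `L u = m u + f`. -/
def IsResolventSolution {d : ℕ} (α m : ℝ) (K : RSpace d → RSpace d → ℝ) (ν : RSpace d → ℝ)
    (f : LTwo d) (u : sobolev d (α / 2)) : Prop :=
  IsLevyImage α K ν u (m • (u : LTwo d) + f)

/-- Homogenization of the operators with kernels `K ε` (symmetrized by the weights `ν ε`) to the
operator with the symmetric kernel `K₀`: for every `f ∈ L²(ℝ^d)` the equations
`(L^ε - m) u^ε = f`, `ε > 0`, and `(L⁰ - m) u⁰ = f` are uniquely solvable, and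
`u^ε → u⁰` as `ε → 0+`, strongly in `L²(ℝ^d)` and weakly in `H^{α/2}(ℝ^d)`. -/
def Homogenizes {d : ℕ} (α m : ℝ) (K : ℝ → RSpace d → RSpace d → ℝ) (ν : ℝ → RSpace d → ℝ)
    (K₀ : RSpace d → RSpace d → ℝ) : Prop :=
  ∀ f : LTwo d,
    (∀ ε : ℝ, 0 < ε → ∃! u, IsResolventSolution α m (K ε) (ν ε) f u) ∧
    (∃! u, IsResolventSolution α m K₀ (fun _ => 1) f u) ∧
    ∀ (u : ℝ → sobolev d (α / 2)) (u₀ : sobolev d (α / 2)),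
      (∀ ε : ℝ, 0 < ε → IsResolventSolution α m (K ε) (ν ε) f (u ε)) →
      IsResolventSolution α m K₀ (fun _ => 1) f u₀ →
      Tendsto (fun ε => (u ε : LTwo d)) (𝓝[>] 0) (𝓝 (u₀ : LTwo d)) ∧
      TendstoWeaklySobolev u (𝓝[>] 0) u₀

/-- A `d`-dimensional ergodic dynamical system on a probability space. -/
structure IsErgodicSystem {d : ℕ} {Ω : Type*} [MeasurableSpace Ω] (P : Measure Ω)
    (T : RSpace d → Ω → Ω) : Prop where
  map_zero : ∀ ω, T 0 ω = ω
  map_add : ∀ y₁ y₂ ω, T (y₁ + y₂) ω = T y₁ (T y₂ ω)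
  measurable : Measurable fun p : RSpace d × Ω => T p.1 p.2
  measurePreserving : ∀ y, MeasurePreserving (T y) P P
  ergodic : ∀ A : Set Ω, MeasurableSet A → (∀ y, T y '' A = A) → P A = 0 ∨ P A = 1

/-! Put `s = α/2`, write `D u` for the Gagliardo quotient and `k^ε(x,y) = K^ε(x,y) ν^ε(x)` for the
symmetrized kernel. No corrector is needed: bounded kernels and weights that converge weak-* already
force convergence of the resolvents (`homogenizes_of_weakStar`). Testing both equations with `w =
u^ε - u⁰` and subtracting bounds the coercive form at `(w, w)` by three functionals of `w`: two of
the shape `∫ (ν^ε - c) g w` with `g` fixed in `L²`, and `∬ (k^ε - k⁰) D u⁰ D w`. It suffices that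
these are at most `η ‖w‖` for small `ε`, uniformly in `w ∈ H^s`; then `u^ε → u⁰` even in the norm of
`H^s`.

The uniformity comes from nonlocality. Near the diagonal and at infinity `D u⁰` has little `L²`
mass. On the remaining pairs the denominator of `D w` is harmless, and `D w` becomes values of `w`
rather than a derivative. An oscillating density paired with `w` is small because `w` is close in
`L²` to its averages over small balls, at a rate controlled by `D w`, while the ball averages of the
density tend to zero (`eventually_abs_integral_mul_le`).

The weak-* limits come from a multiparameter ergodic theorem, `IsErgodicSystem.ae_hasOrbitMean`.
Constants and coboundaries span a dense subspace of `L²(P)` and average correctly along orbits; a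
maximal inequality, transferred from the Vitali covering argument on `ℝ^d`, passes to the closure.
For product kernels `λ` cancels in `k^ε`, leaving `μ(x) μ(y)`, so only the means of `μ` and `μ/λ`
enter. For continuous kernels, Stone–Weierstrass reduces functions of two orbit points to tensor
products, and the slow variables are treated by approximating in `L¹` with values in `C(Ω × Ω)`. The
exceptional null set is fixed before `f` is chosen. -/

/-! ### Cauchy–Schwarz and products with bounded weights. -/

theorem abs_integral_mul_le_sqrt {X : Type*} [MeasurableSpace X] {μ : Measure X} {f g : X → ℝ}
    (hf : MemLp f 2 μ) (hg : MemLp g 2 μ) :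
    |∫ x, f x * g x ∂μ| ≤ Real.sqrt (∫ x, f x ^ 2 ∂μ) * Real.sqrt (∫ x, g x ^ 2 ∂μ) := by
  have h := integral_mul_norm_le_Lp_mul_Lq (μ := μ) (f := f) (g := g) Real.HolderConjugate.two_two
    (by simpa using hf) (by simpa using hg)
  calc |∫ x, f x * g x ∂μ| ≤ ∫ x, ‖f x * g x‖ ∂μ :=
        norm_integral_le_integral_norm (fun x => f x * g x)
    _ = ∫ x, ‖f x‖ * ‖g x‖ ∂μ := by simp only [norm_mul]
    _ ≤ _ := h
    _ = _ := by simp [Real.sqrt_eq_rpow]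

theorem integrable_mul_of_memLp_two {X : Type*} [MeasurableSpace X] {μ : Measure X} {f g : X → ℝ}
    (hf : MemLp f 2 μ) (hg : MemLp g 2 μ) : Integrable (fun x => f x * g x) μ :=
  hf.integrable_mul hg

theorem integrable_mul_mul_of_bound {X : Type*} [MeasurableSpace X] {μ : Measure X}
    {h f g : X → ℝ} {C : ℝ} (hm : AEStronglyMeasurable h μ) (hb : ∀ᵐ x ∂μ, |h x| ≤ C)
    (hf : MemLp f 2 μ) (hg : MemLp g 2 μ) : Integrable (fun x => h x * f x * g x) μ := by
  have := (hf.integrable_mul hg).bdd_mul hm hb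
  simpa [mul_assoc] using this

theorem memLp_two_of_abs_le {X : Type*} [MeasurableSpace X] {μ : Measure X}
    {h f : X → ℝ} {C : ℝ} (hm : AEStronglyMeasurable h μ) (hb : ∀ᵐ x ∂μ, |h x| ≤ C)
    (hf : MemLp f 2 μ) : MemLp (fun x => h x * f x) 2 μ := by
  refine MemLp.of_le_mul (c := C) hf (hm.mul hf.1) ?_
  filter_upwards [hb] with x hx
  rw [norm_mul]
  exact mul_le_mul_of_nonneg_right hx (norm_nonneg _)

/-! ### Averaging over small balls and oscillating densities on `H^s`. -/

section Mollification

variable {d : ℕ}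

theorem volume_real_ball_pos (x : RSpace d) {δ : ℝ} (hδ : 0 < δ) :
    0 < volume.real (Metric.ball x δ) :=
  ENNReal.toReal_pos (Metric.measure_ball_pos _ _ hδ).ne' measure_ball_lt_top.ne

theorem volume_real_ball_center (x : RSpace d) (δ : ℝ) :
    volume.real (Metric.ball x δ) = volume.real (Metric.ball (0 : RSpace d) δ) := by
  simp only [Measure.real, Measure.addHaar_ball_center volume x δ]

theorem volume_real_ball_eq {δ : ℝ} (hδ : 0 < δ) :
    volume.real (Metric.ball (0 : RSpace d) δ) =
      δ ^ (d : ℝ) * volume.real (Metric.ball (0 : RSpace d) 1) := by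
  simp only [Measure.real, Measure.addHaar_ball_of_pos volume (0 : RSpace d) hδ, ENNReal.toReal_mul,
    finrank_euclideanSpace, Fintype.card_fin, Real.rpow_natCast]
  rw [ENNReal.toReal_ofReal (by positivity)]

/-- The pairs of points at distance less than `δ`. -/
def nearDiagonal (d : ℕ) (δ : ℝ) : Set (RSpace d × RSpace d) := {p | dist p.1 p.2 < δ}

theorem measurableSet_nearDiagonal (δ : ℝ) : MeasurableSet (nearDiagonal d δ) :=
  measurableSet_lt (measurable_fst.dist measurable_snd) measurable_const

theorem nearDiagonal_indicator_eq (δ : ℝ) (F : RSpace d × RSpace d → ℝ) (x z : RSpace d) :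
    (nearDiagonal d δ).indicator F (x, z) = (Metric.ball x δ).indicator (fun z => F (x, z)) z := by
  simp only [Set.indicator, nearDiagonal, Set.mem_ofPred_eq, Metric.mem_ball, dist_comm x z]

theorem nearDiagonal_indicator_eq' (δ : ℝ) (F : RSpace d × RSpace d → ℝ) (x z : RSpace d) :
    (nearDiagonal d δ).indicator F (x, z) = (Metric.ball z δ).indicator (fun x => F (x, z)) x := by
  simp only [Set.indicator, nearDiagonal, Set.mem_ofPred_eq, Metric.mem_ball]
  congr

theorem integrable_nearDiagonal_fst (δ : ℝ) {f : RSpace d → ℝ} (hf : Integrable f) :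
    Integrable ((nearDiagonal d δ).indicator fun p => f p.1) := by
  have hm : AEStronglyMeasurable ((nearDiagonal d δ).indicator fun p => f p.1)
      (volume.prod volume) :=
    (hf.1.comp_quasiMeasurePreserving Measure.quasiMeasurePreserving_fst).indicator
      (measurableSet_nearDiagonal δ)
  change Integrable _ (volume.prod volume)
  rw [integrable_prod_iff hm]
  constructor
  · refine ae_of_all _ fun x => ?_
    simp only [nearDiagonal_indicator_eq]
    rw [integrable_indicator_iff measurableSet_ball]
    exact integrableOn_const measure_ball_lt_top.ne
  · have : ∀ x, ∫ z, ‖(nearDiagonal d δ).indicator (fun p => f p.1) (x, z)‖ =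
        volume.real (Metric.ball (0 : RSpace d) δ) * ‖f x‖ := by
      intro x
      simp only [nearDiagonal_indicator_eq, norm_indicator_eq_indicator_norm]
      rw [integral_indicator measurableSet_ball, setIntegral_const, volume_real_ball_center,
        smul_eq_mul]
    simp only [this]
    exact hf.norm.const_mul _

theorem integral_nearDiagonal_fst (δ : ℝ) {f : RSpace d → ℝ} (hf : Integrable f) :
    ∫ p, (nearDiagonal d δ).indicator (fun p => f p.1) p =
      volume.real (Metric.ball (0 : RSpace d) δ) * ∫ x, f x := by
  have h := integral_prod (μ := volume) (ν := volume) _ (integrable_nearDiagonal_fst δ hf)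
  refine h.trans ?_
  rw [← integral_const_mul]
  refine integral_congr_ae (ae_of_all _ fun x => ?_)
  simp only [nearDiagonal_indicator_eq]
  rw [integral_indicator measurableSet_ball, setIntegral_const, volume_real_ball_center,
    smul_eq_mul]

theorem memLp_nearDiagonal_fst (δ : ℝ) {f : RSpace d → ℝ} (hf : MemLp f 2) :
    MemLp ((nearDiagonal d δ).indicator fun p => f p.1) 2 := by
  have hm : AEStronglyMeasurable ((nearDiagonal d δ).indicator fun p => f p.1)
      (volume : Measure (RSpace d × RSpace d)) :=
    (hf.1.comp_quasiMeasurePreserving Measure.quasiMeasurePreserving_fst).indicator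
      (measurableSet_nearDiagonal δ)
  rw [memLp_two_iff_integrable_sq hm]
  refine (integrable_nearDiagonal_fst δ hf.integrable_sq).congr (ae_of_all _ fun p => ?_)
  by_cases hp : p ∈ nearDiagonal d δ <;> simp [hp]

theorem nearDiagonal_indicator_swap (δ : ℝ) (f : RSpace d → ℝ) :
    ((nearDiagonal d δ).indicator fun p => f p.2) =
      ((nearDiagonal d δ).indicator fun p => f p.1) ∘ Prod.swap := by
  ext p
  simp only [Set.indicator, nearDiagonal, Set.mem_ofPred_eq, Function.comp, Prod.fst_swap,
    Prod.snd_swap, dist_comm p.1 p.2]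
  congr

theorem memLp_nearDiagonal_snd (δ : ℝ) {f : RSpace d → ℝ} (hf : MemLp f 2) :
    MemLp ((nearDiagonal d δ).indicator fun p => f p.2) 2 := by
  rw [nearDiagonal_indicator_swap]
  exact (memLp_nearDiagonal_fst δ hf).comp_measurePreserving
    (Measure.measurePreserving_swap (μ := volume) (ν := volume))

theorem integrable_nearDiagonal_snd (δ : ℝ) {f : RSpace d → ℝ} (hf : Integrable f) :
    Integrable ((nearDiagonal d δ).indicator fun p => f p.2) := by
  rw [nearDiagonal_indicator_swap]
  exact (Measure.measurePreserving_swap (μ := volume) (ν := volume)).integrable_comp_of_integrable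
    (integrable_nearDiagonal_fst δ hf)

/-- A Poincaré-type inequality: near the diagonal, differences are controlled by the
Gagliardo quotient. -/
theorem integral_nearDiagonal_sq_sub_le {s : ℝ} (hs : 0 ≤ s) {δ : ℝ}
    {w : RSpace d → ℝ} (hD : MemLp (diffQuot s w) 2) :
    ∫ p, ((nearDiagonal d δ).indicator (fun p => w p.1 - w p.2) p) ^ 2 ≤
      (δ ^ ((d : ℝ) / 2 + s)) ^ 2 * ∫ p, diffQuot s w p ^ 2 := by
  rw [← integral_const_mul]
  refine integral_mono_of_nonneg (ae_of_all _ fun p => sq_nonneg _)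
    (hD.integrable_sq.const_mul _) (ae_of_all _ fun p => ?_)
  by_cases hp : p ∈ nearDiagonal d δ
  · simp only [Set.indicator_of_mem hp, diffQuot]
    rcases eq_or_ne p.1 p.2 with h | h
    · rw [h]; simp
    · have hr : 0 < ‖p.2 - p.1‖ := norm_pos_iff.2 (sub_ne_zero.2 h.symm)
      have hr' : ‖p.2 - p.1‖ < δ := by
        rw [← dist_eq_norm, dist_comm]; exact hp
      have h1 : ‖p.2 - p.1‖ ^ ((d : ℝ) / 2 + s) ≤ δ ^ ((d : ℝ) / 2 + s) :=
        Real.rpow_le_rpow hr.le hr'.le (by positivity)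
      have h2 : 0 < ‖p.2 - p.1‖ ^ ((d : ℝ) / 2 + s) := Real.rpow_pos_of_pos hr _
      rw [div_pow, mul_div_assoc', le_div_iff₀ (by positivity)]
      have h3 : (‖p.2 - p.1‖ ^ ((d : ℝ) / 2 + s)) ^ 2 ≤ (δ ^ ((d : ℝ) / 2 + s)) ^ 2 := by
        gcongr
      nlinarith [sq_nonneg (w p.2 - w p.1)]
  · simp only [Set.indicator_of_notMem hp, zero_pow two_ne_zero]
    exact mul_nonneg (sq_nonneg _) (sq_nonneg _)

/-- Replacing `w` by its averages over balls of radius `δ` in `∫ θ w`. -/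
theorem abs_integral_mul_le_of_mollify {s : ℝ} (hs : 0 ≤ s) {δ : ℝ} (hδ : 0 < δ)
    {θ w : RSpace d → ℝ} (hθ : MemLp θ 2) (hw : MemLp w 2) (hD : MemLp (diffQuot s w) 2)
    (hF : MemLp (fun z => ∫ x in Metric.ball z δ, θ x) 2) :
    volume.real (Metric.ball (0 : RSpace d) δ) * |∫ x, θ x * w x| ≤
      Real.sqrt (volume.real (Metric.ball (0 : RSpace d) δ)) * δ ^ ((d : ℝ) / 2 + s) *
        Real.sqrt (∫ x, θ x ^ 2) * Real.sqrt (∫ p, diffQuot s w p ^ 2) +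
      Real.sqrt (∫ z, (∫ x in Metric.ball z δ, θ x) ^ 2) * Real.sqrt (∫ x, w x ^ 2) := by
  set b := volume.real (Metric.ball (0 : RSpace d) δ)
  have hθ1 := memLp_nearDiagonal_fst δ hθ
  have hw1 := memLp_nearDiagonal_fst δ hw
  have hw2 := memLp_nearDiagonal_snd δ hw
  have hsub : ((nearDiagonal d δ).indicator fun p => w p.1 - w p.2) =
      ((nearDiagonal d δ).indicator fun p => w p.1) -
        (nearDiagonal d δ).indicator fun p => w p.2 := by
    ext p
    by_cases hp : p ∈ nearDiagonal d δ <;> simp [hp]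
  have hw12 : MemLp ((nearDiagonal d δ).indicator fun p => w p.1 - w p.2) 2 := by
    rw [hsub]; exact hw1.sub hw2
  have e1 : ∫ p, (nearDiagonal d δ).indicator (fun p => θ p.1) p *
      (nearDiagonal d δ).indicator (fun p => w p.1) p = b * ∫ x, θ x * w x := by
    rw [← integral_nearDiagonal_fst δ (integrable_mul_of_memLp_two hθ hw)]
    refine integral_congr_ae (ae_of_all _ fun p => ?_)
    by_cases hp : p ∈ nearDiagonal d δ <;> simp [hp]
  have e2 : ∫ p, (nearDiagonal d δ).indicator (fun p => θ p.1) p *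
      (nearDiagonal d δ).indicator (fun p => w p.2) p =
      ∫ z, (∫ x in Metric.ball z δ, θ x) * w z := by
    refine (integral_prod_symm (μ := volume) (ν := volume) _
      (integrable_mul_of_memLp_two hθ1 hw2)).trans ?_
    refine integral_congr_ae (ae_of_all _ fun z => ?_)
    dsimp only
    rw [← integral_indicator measurableSet_ball, ← integral_mul_const]
    refine integral_congr_ae (ae_of_all _ fun x => ?_)
    dsimp only
    rw [nearDiagonal_indicator_eq', nearDiagonal_indicator_eq']
    by_cases hp : x ∈ Metric.ball z δ <;> simp [hp]
  -- Inside the double integral over near-diagonal pairs, `w(x) = (w(x) - w(z)) + w(z)`. The first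
  -- piece is a Gagliardo difference; the second sees `θ` only through its ball integrals.
  have e3 : b * ∫ x, θ x * w x =
      (∫ p, (nearDiagonal d δ).indicator (fun p => θ p.1) p *
        (nearDiagonal d δ).indicator (fun p => w p.1 - w p.2) p) +
      ∫ z, (∫ x in Metric.ball z δ, θ x) * w z := by
    rw [← e1, ← e2, ← integral_add (integrable_mul_of_memLp_two hθ1 hw12)
      (integrable_mul_of_memLp_two hθ1 hw2)]
    refine integral_congr_ae (ae_of_all _ fun p => ?_)
    simp only [hsub, Pi.sub_apply]
    ring
  have hb : 0 ≤ b := measureReal_nonneg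
  have e4 : ∫ p, ((nearDiagonal d δ).indicator (fun p => θ p.1) p) ^ 2 = b * ∫ x, θ x ^ 2 := by
    rw [← integral_nearDiagonal_fst δ hθ.integrable_sq]
    refine integral_congr_ae (ae_of_all _ fun p => ?_)
    by_cases hp : p ∈ nearDiagonal d δ <;> simp [hp]
  have i1 := abs_integral_mul_le_sqrt hθ1 hw12
  have i2 := abs_integral_mul_le_sqrt hF hw
  have i3 := Real.sqrt_le_sqrt (integral_nearDiagonal_sq_sub_le hs (δ := δ) hD)
  rw [Real.sqrt_mul (sq_nonneg _), Real.sqrt_sq (by positivity)] at i3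
  rw [e4, Real.sqrt_mul hb] at i1
  have i4 := mul_le_mul_of_nonneg_left i3
    (mul_nonneg (Real.sqrt_nonneg b) (Real.sqrt_nonneg (∫ x, θ x ^ 2)))
  calc b * |∫ x, θ x * w x| = |b * ∫ x, θ x * w x| := by rw [abs_mul, abs_of_nonneg hb]
    _ ≤ _ := by rw [e3]; exact abs_add_le _ _
    _ ≤ _ := add_le_add (i1.trans (i4.trans_eq (by ring))) i2

theorem sqrt_integral_sq_le_sobolevNorm {s : ℝ} (w : sobolev d s) :
    Real.sqrt (∫ x, (w : LTwo d) x ^ 2) ≤ sobolevNorm w :=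
  Real.sqrt_le_sqrt (le_add_of_nonneg_right (integral_nonneg fun _ => sq_nonneg _))

theorem sqrt_integral_diffQuot_le_sobolevNorm {s : ℝ} (w : sobolev d s) :
    Real.sqrt (∫ p, diffQuot s (w : LTwo d) p ^ 2) ≤ sobolevNorm w :=
  Real.sqrt_le_sqrt (le_add_of_nonneg_left (integral_nonneg fun _ => sq_nonneg _))

theorem sobolevNorm_nonneg {s : ℝ} (w : sobolev d s) : 0 ≤ sobolevNorm w := Real.sqrt_nonneg _

/-- The local averages of an `L²` function form an `L²` function. -/
theorem sq_setIntegral_ball_le {δ : ℝ} {θ ρ : RSpace d → ℝ}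
    (hθ : AEStronglyMeasurable θ) (hρ : MemLp ρ 2) (hle : ∀ᵐ x, |θ x| ≤ ρ x) (z : RSpace d) :
    (∫ x in Metric.ball z δ, θ x) ^ 2 ≤
      volume.real (Metric.ball (0 : RSpace d) δ) * ∫ x in Metric.ball z δ, ρ x ^ 2 := by
  have hθ2 : MemLp θ 2 := MemLp.mono hρ hθ (by
    filter_upwards [hle] with x hx using hx.trans (le_abs_self _))
  have : IsFiniteMeasure (volume.restrict (Metric.ball z δ)) :=
    ⟨by rw [Measure.restrict_apply_univ]; exact measure_ball_lt_top⟩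
  have h1 := abs_integral_mul_le_sqrt (μ := volume.restrict (Metric.ball z δ))
    (f := fun _ => 1) (g := θ) (memLp_const 1) (hθ2.restrict _)
  simp only [one_mul, one_pow, integral_const, smul_eq_mul, mul_one, measureReal_restrict_apply_univ,
    volume_real_ball_center] at h1
  have h2 : ∫ x in Metric.ball z δ, θ x ^ 2 ≤ ∫ x in Metric.ball z δ, ρ x ^ 2 := by
    refine integral_mono_ae (hθ2.restrict _).integrable_sq (hρ.restrict _).integrable_sq ?_
    filter_upwards [ae_restrict_of_ae hle] with x hx
    exact sq_le_sq' (by linarith [abs_le.1 hx]) (abs_le.1 hx).2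
  have h3 : 0 ≤ ∫ x in Metric.ball z δ, θ x ^ 2 := integral_nonneg fun _ => sq_nonneg _
  have h4 := mul_self_le_mul_self (abs_nonneg _) h1
  rw [abs_mul_abs_self, mul_mul_mul_comm, Real.mul_self_sqrt measureReal_nonneg,
    Real.mul_self_sqrt h3] at h4
  rw [sq]
  exact h4.trans (mul_le_mul_of_nonneg_left h2 measureReal_nonneg)

theorem aestronglyMeasurable_setIntegral_ball (δ : ℝ) {θ : RSpace d → ℝ}
    (hθ : AEStronglyMeasurable θ) :
    AEStronglyMeasurable fun z => ∫ x in Metric.ball z δ, θ x := by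
  have hm : AEStronglyMeasurable ((nearDiagonal d δ).indicator fun p => θ p.2)
      (volume.prod volume) :=
    (hθ.comp_quasiMeasurePreserving Measure.quasiMeasurePreserving_snd).indicator
      (measurableSet_nearDiagonal δ)
  refine hm.integral_prod_right'.congr (ae_of_all _ fun z => ?_)
  simp only [nearDiagonal_indicator_eq]
  rw [integral_indicator measurableSet_ball]

theorem integrable_setIntegral_ball (δ : ℝ) {f : RSpace d → ℝ} (hf : Integrable f) :
    Integrable fun z => ∫ x in Metric.ball z δ, f x := by
  have := (integrable_nearDiagonal_snd δ hf).integral_prod_left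
  refine this.congr (ae_of_all _ fun z => ?_)
  simp only [nearDiagonal_indicator_eq]
  rw [integral_indicator measurableSet_ball]

/-- Functions dominated in `L²` whose integrals over balls tend to zero are small as functionals
on `H^s`, uniformly on bounded sets. -/
theorem eventually_abs_integral_mul_le {ι : Type*} {l : Filter ι} [l.IsCountablyGenerated]
    {s : ℝ} (hs : 0 < s) {θ : ι → RSpace d → ℝ} {ρ : RSpace d → ℝ} (hρ : MemLp ρ 2)
    (hθ : ∀ᶠ i in l, AEStronglyMeasurable (θ i)) (hle : ∀ᶠ i in l, ∀ᵐ x, |θ i x| ≤ ρ x)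
    (hlim : ∀ (z : RSpace d) (δ : ℝ), Tendsto (fun i => ∫ x in Metric.ball z δ, θ i x) l (𝓝 0))
    {η : ℝ} (hη : 0 < η) :
    ∀ᶠ i in l, ∀ w : sobolev d s, |∫ x, θ i x * (w : LTwo d) x| ≤ η * sobolevNorm w := by
  set b₁ := volume.real (Metric.ball (0 : RSpace d) 1) with hb₁
  have hb₁0 : 0 < b₁ := volume_real_ball_pos _ one_pos
  set M := Real.sqrt (∫ x, ρ x ^ 2)
  -- Since `b = δ^d b₁`, the Poincaré error `√b δ^(d/2+s) M` equals `b δ^s M / √b₁`; this choice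
  -- makes it at most `b η/2`. The scale `δ` is fixed before the index `i`.
  obtain ⟨δ, hδ, hδs⟩ : ∃ δ : ℝ, 0 < δ ∧ δ ^ s * M ≤ Real.sqrt b₁ * (η / 2) := by
    have h : Tendsto (fun δ : ℝ => δ ^ s * M) (𝓝[>] 0) (𝓝 (0 ^ s * M)) :=
      (((Real.continuousAt_rpow_const 0 s (Or.inr hs.le)).tendsto).mul_const M).mono_left
        nhdsWithin_le_nhds
    rw [Real.zero_rpow hs.ne', zero_mul] at h
    have h2 := h.eventually (eventually_le_nhds (show 0 < Real.sqrt b₁ * (η / 2) by positivity))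
    obtain ⟨δ, h3, h4⟩ := (h2.and self_mem_nhdsWithin).exists
    exact ⟨δ, h4, h3⟩
  set b := volume.real (Metric.ball (0 : RSpace d) δ) with hb
  have hb0 : 0 < b := volume_real_ball_pos _ hδ
  -- With `δ` fixed, ball integrals tend to zero pointwise. The local integrals of `ρ²` form an
  -- integrable majorant, which takes the place of compactness of the embedding into `L²`.
  have hL2 : Tendsto (fun i => ∫ z, (∫ x in Metric.ball z δ, θ i x) ^ 2) l (𝓝 0) := by
    rw [show (0 : ℝ) = ∫ z : RSpace d, (0 : ℝ) by simp]
    refine tendsto_integral_filter_of_dominated_convergence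
      (fun z => b * ∫ x in Metric.ball z δ, ρ x ^ 2) ?_ ?_ ?_ ?_
    · filter_upwards [hθ] with i hi using (aestronglyMeasurable_setIntegral_ball δ hi).pow 2
    · filter_upwards [hθ, hle] with i hi hi'
      refine ae_of_all _ fun z => ?_
      rw [Real.norm_of_nonneg (sq_nonneg _)]
      exact sq_setIntegral_ball_le hi hρ hi' z
    · exact (integrable_setIntegral_ball δ hρ.integrable_sq).const_mul b
    · refine ae_of_all _ fun z => ?_
      simpa using (hlim z δ).pow 2
  have hev : ∀ᶠ i in l, Real.sqrt (∫ z, (∫ x in Metric.ball z δ, θ i x) ^ 2) ≤ b * (η / 2) := by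
    have := hL2.sqrt
    rw [Real.sqrt_zero] at this
    exact this.eventually (eventually_le_nhds (by positivity))
  filter_upwards [hev, hθ, hle] with i hi hm hi' w
  have hθ2 : MemLp (θ i) 2 := MemLp.mono hρ hm (by
    filter_upwards [hi'] with x hx using hx.trans (le_abs_self _))
  have hF : MemLp (fun z => ∫ x in Metric.ball z δ, θ i x) 2 := by
    have hFm := aestronglyMeasurable_setIntegral_ball δ hm
    rw [memLp_two_iff_integrable_sq hFm]
    refine Integrable.mono' ((integrable_setIntegral_ball δ hρ.integrable_sq).const_mul b)
      (hFm.pow 2) (ae_of_all _ fun z => ?_)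
    rw [Real.norm_of_nonneg (sq_nonneg _)]
    exact sq_setIntegral_ball_le hm hρ hi' z
  have key := abs_integral_mul_le_of_mollify hs.le hδ hθ2 (Lp.memLp (w : LTwo d)) w.2 hF
  have hθρ : Real.sqrt (∫ x, θ i x ^ 2) ≤ M := by
    refine Real.sqrt_le_sqrt (integral_mono_ae hθ2.integrable_sq hρ.integrable_sq ?_)
    filter_upwards [hi'] with x hx
    exact sq_le_sq' (by linarith [abs_le.1 hx]) (abs_le.1 hx).2
  have hδb : Real.sqrt b * δ ^ ((d : ℝ) / 2 + s) * M ≤ b * (η / 2) := by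
    have h1 : Real.sqrt b = δ ^ ((d : ℝ) / 2) * Real.sqrt b₁ := by
      rw [hb, volume_real_ball_eq hδ, Real.sqrt_mul (by positivity), ← hb₁,
        Real.sqrt_eq_rpow (δ ^ (d : ℝ)), ← Real.rpow_mul hδ.le]
      congr 2
      ring
    have h2 : b = Real.sqrt b * (δ ^ ((d : ℝ) / 2) * Real.sqrt b₁) := by
      rw [← h1, Real.mul_self_sqrt hb0.le]
    calc Real.sqrt b * δ ^ ((d : ℝ) / 2 + s) * M
        = Real.sqrt b * δ ^ ((d : ℝ) / 2) * (δ ^ s * M) := by rw [Real.rpow_add hδ]; ring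
      _ ≤ Real.sqrt b * δ ^ ((d : ℝ) / 2) * (Real.sqrt b₁ * (η / 2)) := by gcongr
      _ = (Real.sqrt b * (δ ^ ((d : ℝ) / 2) * Real.sqrt b₁)) * (η / 2) := by ring
      _ = b * (η / 2) := by rw [← h2]
  refine le_of_mul_le_mul_left (key.trans ?_) hb0
  have hN := sobolevNorm_nonneg w
  calc _ ≤ Real.sqrt b * δ ^ ((d : ℝ) / 2 + s) * M * sobolevNorm w +
        b * (η / 2) * sobolevNorm w := by
        gcongr
        · exact sqrt_integral_diffQuot_le_sobolevNorm w
        · exact sqrt_integral_sq_le_sobolevNorm w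
    _ ≤ b * (η / 2) * sobolevNorm w + b * (η / 2) * sobolevNorm w := by gcongr
    _ = _ := by ring

end Mollification

/-! ### Weak-* null weights and kernels as functionals on `H^s`. -/

section WeakStar

variable {d : ℕ} {ι : Type*} {l : Filter ι} {s : ℝ}

/-- The density `h i * g` is dominated by `C |g|`, and its integral over a ball is `h i` tested
against `g` cut off to that ball, which is integrable. -/
theorem eventually_abs_integral_weight_mul_le [l.IsCountablyGenerated] (hs : 0 < s)
    {h : ι → RSpace d → ℝ} {C : ℝ} (hm : ∀ᶠ i in l, AEStronglyMeasurable (h i))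
    (hb : ∀ᶠ i in l, ∀ᵐ x, |h i x| ≤ C)
    (hlim : ∀ φ : RSpace d → ℝ, Integrable φ → Tendsto (fun i => ∫ x, h i x * φ x) l (𝓝 0))
    {g : RSpace d → ℝ} (hg : MemLp g 2) {η : ℝ} (hη : 0 < η) :
    ∀ᶠ i in l, ∀ w : sobolev d s,
      |∫ x, h i x * g x * (w : LTwo d) x| ≤ η * sobolevNorm w := by
  refine eventually_abs_integral_mul_le (ρ := fun x => C * |g x|) hs (hg.abs.const_mul C)
    ?_ ?_ ?_ hη
  · filter_upwards [hm] with i hi using hi.mul hg.1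
  · filter_upwards [hb] with i hi
    filter_upwards [hi] with x hx
    rw [abs_mul]
    exact mul_le_mul_of_nonneg_right hx (abs_nonneg _)
  · intro z δ
    have : IsFiniteMeasure (volume.restrict (Metric.ball z δ)) :=
      ⟨by rw [Measure.restrict_apply_univ]; exact measure_ball_lt_top⟩
    have hφ : Integrable ((Metric.ball z δ).indicator g) := by
      rw [integrable_indicator_iff measurableSet_ball]
      exact (hg.restrict _).integrable one_le_two
    refine (hlim _ hφ).congr fun i => ?_
    rw [← integral_indicator measurableSet_ball]
    refine integral_congr_ae (ae_of_all _ fun x => ?_)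
    by_cases hx : x ∈ Metric.ball z δ <;> simp [hx]

theorem memLp_mul_indicator_ball {w : RSpace d → ℝ} (hw : MemLp w 2) (R : ℝ) :
    MemLp (fun p : RSpace d × RSpace d =>
      w p.1 * (Metric.ball (0 : RSpace d) R).indicator 1 p.2) 2 := by
  have hm : AEStronglyMeasurable (fun p : RSpace d × RSpace d =>
      w p.1 * (Metric.ball (0 : RSpace d) R).indicator 1 p.2) (volume.prod volume) :=
    (hw.1.comp_quasiMeasurePreserving Measure.quasiMeasurePreserving_fst).mul
      ((measurable_one.indicator measurableSet_ball).comp measurable_snd).aestronglyMeasurable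
  refine (memLp_two_iff_integrable_sq hm).2 ?_
  have h1 : Integrable ((Metric.ball (0 : RSpace d) R).indicator (1 : RSpace d → ℝ)) :=
    (integrable_indicator_iff measurableSet_ball).2 (integrableOn_const measure_ball_lt_top.ne)
  refine (hw.integrable_sq.mul_prod h1).congr (ae_of_all _ fun p => ?_)
  by_cases hp : p.2 ∈ Metric.ball (0 : RSpace d) R <;> simp [hp]

theorem integrable_mul_fst_of_support {R : ℝ} {G : RSpace d × RSpace d → ℝ} (hG : MemLp G 2)
    (hsupp : ∀ p, p.2 ∉ Metric.ball (0 : RSpace d) R → G p = 0)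
    {w : RSpace d → ℝ} (hw : MemLp w 2) : Integrable fun p => G p * w p.1 := by
  refine (integrable_mul_of_memLp_two hG (memLp_mul_indicator_ball hw R)).congr
    (ae_of_all _ fun p => ?_)
  by_cases hp : p.2 ∈ Metric.ball (0 : RSpace d) R
  · simp [hp]
  · simp [hsupp p hp]

/-- Cauchy–Schwarz in `y` over the ball of radius `R`: the square of the marginal is at most the
volume of that ball times `∫ G(x,y)² dy`. -/
theorem memLp_integral_abs_of_support {R : ℝ} {G : RSpace d × RSpace d → ℝ} (hG : MemLp G 2)
    (hsupp : ∀ p, p.2 ∉ Metric.ball (0 : RSpace d) R → G p = 0) :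
    MemLp (fun x => ∫ y, |G (x, y)|) 2 := by
  have hGm : AEStronglyMeasurable G (volume.prod volume) := hG.1
  have hm : AEStronglyMeasurable fun x => ∫ y, |G (x, y)| := hGm.norm.integral_prod_right'
  have hsq : Integrable (fun p => G p ^ 2) (volume.prod volume) := hG.integrable_sq
  refine (memLp_two_iff_integrable_sq hm).2 ?_
  refine Integrable.mono' (hsq.integral_prod_left.const_mul
    (volume.real (Metric.ball (0 : RSpace d) R))) (hm.pow 2) ?_
  filter_upwards [hsq.prod_right_ae, hGm.prodMk_left] with x hx hxm
  rw [Real.norm_of_nonneg (sq_nonneg _)]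
  have hGx : MemLp (fun y => G (x, y)) 2 := (memLp_two_iff_integrable_sq hxm).2 hx
  have h1 : MemLp ((Metric.ball (0 : RSpace d) R).indicator (1 : RSpace d → ℝ)) 2 :=
    memLp_indicator_const 2 measurableSet_ball 1 (Or.inr measure_ball_lt_top.ne)
  have h2 := abs_integral_mul_le_sqrt h1 hGx.abs
  have e1 : ∫ y, (Metric.ball (0 : RSpace d) R).indicator (1 : RSpace d → ℝ) y * |G (x, y)| =
      ∫ y, |G (x, y)| := by
    refine integral_congr_ae (ae_of_all _ fun y => ?_)
    by_cases hy : y ∈ Metric.ball (0 : RSpace d) R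
    · simp [hy]
    · simp [hsupp (x, y) hy]
  have e2 : ∫ y, (Metric.ball (0 : RSpace d) R).indicator (1 : RSpace d → ℝ) y ^ 2 =
      volume.real (Metric.ball (0 : RSpace d) R) := by
    rw [← integral_indicator_one measurableSet_ball]
    refine integral_congr_ae (ae_of_all _ fun y => ?_)
    by_cases hy : y ∈ Metric.ball (0 : RSpace d) R <;> simp [hy]
  simp only [Pi.abs_apply, e1, e2, sq_abs] at h2
  have h3 : 0 ≤ ∫ y, G (x, y) ^ 2 := integral_nonneg fun _ => sq_nonneg _
  have h4 := mul_self_le_mul_self (abs_nonneg _) h2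
  rw [abs_mul_abs_self, mul_mul_mul_comm, Real.mul_self_sqrt measureReal_nonneg,
    Real.mul_self_sqrt h3] at h4
  rw [sq]
  exact h4

theorem integral_marginal_mul {R C : ℝ} {h G : RSpace d × RSpace d → ℝ}
    (hm : AEStronglyMeasurable h) (hb : ∀ᵐ p, |h p| ≤ C) (hG : MemLp G 2)
    (hsupp : ∀ p, p.2 ∉ Metric.ball (0 : RSpace d) R → G p = 0)
    {w : RSpace d → ℝ} (hw : MemLp w 2) :
    ∫ x, (∫ y, h (x, y) * G (x, y)) * w x = ∫ p, h p * (G p * w p.1) := by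
  have hi : Integrable (fun p => h p * (G p * w p.1)) (volume.prod volume) :=
    (integrable_mul_fst_of_support hG hsupp hw).bdd_mul hm hb
  refine Eq.trans ?_ (integral_prod _ hi).symm
  refine integral_congr_ae (ae_of_all _ fun x => ?_)
  simp only [← mul_assoc, integral_mul_const]

/-- Integrating out `y` leaves a density in `x` alone, dominated by `C ∫ |G(x,y)| dy`. Its ball
integrals are tests of `h i` against `G` restricted to `x` in a ball; the bounded support of `G` in
`y` makes that test function integrable, so the mollification criterion applies. -/
theorem eventually_abs_integral_kernel_mul_fst_le [l.IsCountablyGenerated] (hs : 0 < s)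
    {h : ι → RSpace d × RSpace d → ℝ} {C : ℝ} (hm : ∀ᶠ i in l, AEStronglyMeasurable (h i))
    (hb : ∀ᶠ i in l, ∀ᵐ p, |h i p| ≤ C)
    (hlim : ∀ φ : RSpace d × RSpace d → ℝ, Integrable φ →
      Tendsto (fun i => ∫ p, h i p * φ p) l (𝓝 0))
    {R : ℝ} {G : RSpace d × RSpace d → ℝ} (hG : MemLp G 2)
    (hsupp : ∀ p, p.2 ∉ Metric.ball (0 : RSpace d) R → G p = 0) {η : ℝ} (hη : 0 < η) :
    ∀ᶠ i in l, ∀ w : sobolev d s,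
      |∫ p, h i p * (G p * (w : LTwo d) p.1)| ≤ η * sobolevNorm w := by
  have key := eventually_abs_integral_mul_le (l := l) (θ := fun i x => ∫ y, h i (x, y) * G (x, y))
    (ρ := fun x => C * ∫ y, |G (x, y)|) hs ((memLp_integral_abs_of_support hG hsupp).const_mul C)
    ?_ ?_ ?_ hη
  · filter_upwards [key, hm, hb] with i hi hmi hbi w
    rw [← integral_marginal_mul hmi hbi hG hsupp (Lp.memLp (w : LTwo d))]
    exact hi w
  · filter_upwards [hm] with i hi
    have : AEStronglyMeasurable (fun p => h i p * G p) (volume.prod volume) := hi.mul hG.1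
    exact this.integral_prod_right'
  · filter_upwards [hm, hb] with i hi hbi
    have hbi' : ∀ᵐ p ∂(volume.prod volume), |h i p| ≤ C := hbi
    have hsq : Integrable (fun p => G p ^ 2) (volume.prod volume) := hG.integrable_sq
    have hGm : AEStronglyMeasurable G (volume.prod volume) := hG.1
    filter_upwards [Measure.ae_ae_of_ae_prod hbi', hsq.prod_right_ae, hGm.prodMk_left]
      with x hx hx2 hxm
    have hGx : MemLp (fun y => G (x, y)) 2 := (memLp_two_iff_integrable_sq hxm).2 hx2
    have h1 : MemLp ((Metric.ball (0 : RSpace d) R).indicator (1 : RSpace d → ℝ)) 2 :=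
      memLp_indicator_const 2 measurableSet_ball 1 (Or.inr measure_ball_lt_top.ne)
    have hGi : Integrable fun y => |G (x, y)| := by
      refine (integrable_mul_of_memLp_two h1 hGx.abs).congr (ae_of_all _ fun y => ?_)
      by_cases hy : y ∈ Metric.ball (0 : RSpace d) R
      · simp [hy]
      · simp [hsupp (x, y) hy]
    rw [← integral_const_mul]
    refine norm_integral_le_of_norm_le (f := fun y => h i (x, y) * G (x, y)) (hGi.const_mul C) ?_
    filter_upwards [hx] with y hy
    rw [norm_mul]
    exact mul_le_mul_of_nonneg_right hy (norm_nonneg _)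
  · intro z δ
    have h1 : MemLp ((Metric.ball z δ).indicator (1 : RSpace d → ℝ)) 2 :=
      memLp_indicator_const 2 measurableSet_ball 1 (Or.inr measure_ball_lt_top.ne)
    refine (hlim _ (integrable_mul_fst_of_support hG hsupp h1)).congr' ?_
    filter_upwards [hm, hb] with i hmi hbi
    rw [← integral_marginal_mul hmi hbi hG hsupp h1, ← integral_indicator measurableSet_ball]
    refine integral_congr_ae (ae_of_all _ fun x => ?_)
    by_cases hx : x ∈ Metric.ball z δ <;> simp [hx]

/-- Pairs of points in the ball of radius `n` that coincide or are at distance at least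
`1 / (n + 1)`. -/
def farPairs (d n : ℕ) : Set (RSpace d × RSpace d) :=
  {p | p.1 ∈ Metric.ball (0 : RSpace d) n ∧ p.2 ∈ Metric.ball (0 : RSpace d) n ∧
    (p.2 - p.1 = 0 ∨ (1 : ℝ) / (n + 1) ≤ ‖p.2 - p.1‖)}

theorem measurableSet_farPairs (n : ℕ) : MeasurableSet (farPairs d n) := by
  refine (measurable_fst measurableSet_ball).inter
    ((measurable_snd measurableSet_ball).inter (MeasurableSet.union ?_ ?_))
  · exact measurableSet_eq_fun (measurable_snd.sub measurable_fst) measurable_const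
  · exact measurableSet_le measurable_const (measurable_snd.sub measurable_fst).norm

/-- Diagonal points are deliberately kept in `farPairs`, so the exhaustion holds at every point and
no nullity of the diagonal is invoked. They do no harm: the weight used on `farPairs` is a quotient
by zero there, hence zero. -/
theorem eventually_mem_farPairs (p : RSpace d × RSpace d) :
    ∀ᶠ n : ℕ in atTop, p ∈ farPairs d n := by
  have h1 : ∀ x : RSpace d, ∀ᶠ n : ℕ in atTop, x ∈ Metric.ball (0 : RSpace d) n := fun x => by
    filter_upwards [tendsto_natCast_atTop_atTop.eventually_gt_atTop ‖x‖] with n hn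
    simpa using hn
  have h3 : ∀ᶠ n : ℕ in atTop, p.2 - p.1 = 0 ∨ (1 : ℝ) / (n + 1) ≤ ‖p.2 - p.1‖ := by
    by_cases h : p.2 - p.1 = 0
    · exact Eventually.of_forall fun _ => Or.inl h
    · filter_upwards [tendsto_one_div_add_atTop_nhds_zero_nat.eventually
        (eventually_le_nhds (norm_pos_iff.2 h))] with n hn using Or.inr hn
  filter_upwards [h1 p.1, h1 p.2, h3] with n a b c using ⟨a, b, c⟩

theorem tendsto_integral_sq_compl_farPairs {U : RSpace d × RSpace d → ℝ} (hU : MemLp U 2) :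
    Tendsto (fun n : ℕ => ∫ p, ((farPairs d n)ᶜ.indicator U p) ^ 2) atTop (𝓝 0) := by
  rw [show (0 : ℝ) = ∫ p : RSpace d × RSpace d, (0 : ℝ) by simp]
  refine tendsto_integral_of_dominated_convergence (fun p => U p ^ 2) ?_ hU.integrable_sq ?_ ?_
  · exact fun n => (hU.1.indicator (measurableSet_farPairs n).compl).pow 2
  · refine fun n => ae_of_all _ fun p => ?_
    by_cases hp : p ∈ farPairs d n
    · simp [hp, sq_nonneg]
    · simp [hp]
  · refine ae_of_all _ fun p => tendsto_const_nhds.congr' ?_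
    filter_upwards [eventually_mem_farPairs p] with n hn
    simp [hn]

theorem memLp_farPairs_weight (s : ℝ) (hs : 0 < s) {U : RSpace d × RSpace d → ℝ} (hU : MemLp U 2)
    (n : ℕ) :
    MemLp ((farPairs d n).indicator fun p => U p / ‖p.2 - p.1‖ ^ ((d : ℝ) / 2 + s)) 2 := by
  have hk : Measurable fun p : RSpace d × RSpace d => ‖p.2 - p.1‖ ^ ((d : ℝ) / 2 + s) :=
    (measurable_snd.sub measurable_fst).norm.pow_const _
  refine MemLp.of_le_mul (c := ((n : ℝ) + 1) ^ ((d : ℝ) / 2 + s)) hU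
    ((hU.1.div₀ hk.aestronglyMeasurable).indicator (measurableSet_farPairs n))
    (ae_of_all _ fun p => ?_)
  have hn : (0 : ℝ) < n + 1 := by positivity
  have he : 0 < (d : ℝ) / 2 + s := by positivity
  by_cases hp : p ∈ farPairs d n
  · rw [Set.indicator_of_mem hp]
    rcases hp.2.2 with h | h
    · rw [h, norm_zero, Real.zero_rpow he.ne', div_zero, norm_zero]
      positivity
    · rw [norm_div, Real.norm_of_nonneg (by positivity : 0 ≤ ‖p.2 - p.1‖ ^ ((d : ℝ) / 2 + s))]
      have h1 : (((n : ℝ) + 1) ^ ((d : ℝ) / 2 + s))⁻¹ ≤ ‖p.2 - p.1‖ ^ ((d : ℝ) / 2 + s) := by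
        rw [← Real.inv_rpow hn.le]
        exact Real.rpow_le_rpow (by positivity) (by rwa [one_div] at h) he.le
      rw [div_eq_inv_mul]
      gcongr
      exact inv_le_of_inv_le₀ (by positivity) h1
  · rw [Set.indicator_of_notMem hp, norm_zero]
    positivity

/-- Off `farPairs d n` the factor `U` has small `L²` norm for large `n`, and Cauchy–Schwarz controls
that part uniformly in `i` and `w`. On `farPairs d n` the denominator of the quotient is moved onto
`U`, giving `G ∈ L²` with bounded support; the numerator splits into `w(y)` and `w(x)`, and the
`w(y)` term becomes a `w(x)` term after exchanging the variables. -/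
theorem eventually_abs_integral_kernel_mul_le [l.IsCountablyGenerated] (hs : 0 < s)
    {h : ι → RSpace d × RSpace d → ℝ} {C : ℝ} (hm : ∀ᶠ i in l, AEStronglyMeasurable (h i))
    (hb : ∀ᶠ i in l, ∀ᵐ p, |h i p| ≤ C)
    (hlim : ∀ φ : RSpace d × RSpace d → ℝ, Integrable φ →
      Tendsto (fun i => ∫ p, h i p * φ p) l (𝓝 0))
    {U : RSpace d × RSpace d → ℝ} (hU : MemLp U 2) {η : ℝ} (hη : 0 < η) :
    ∀ᶠ i in l, ∀ w : sobolev d s,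
      |∫ p, h i p * U p * diffQuot s (w : LTwo d) p| ≤ η * sobolevNorm w := by
  have hη3 : 0 < η / 3 := by positivity
  obtain ⟨n, hn⟩ : ∃ n : ℕ,
      |C| * Real.sqrt (∫ p, ((farPairs d n)ᶜ.indicator U p) ^ 2) ≤ η / 3 := by
    have := (tendsto_integral_sq_compl_farPairs hU).sqrt.const_mul |C|
    rw [Real.sqrt_zero, mul_zero] at this
    exact (this.eventually (eventually_le_nhds hη3)).exists
  set G := (farPairs d n).indicator fun p => U p / ‖p.2 - p.1‖ ^ ((d : ℝ) / 2 + s) with hGdef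
  have hG : MemLp G 2 := memLp_farPairs_weight s hs hU n
  have hsw : MeasurePreserving (Prod.swap : RSpace d × RSpace d → RSpace d × RSpace d) volume
    volume := Measure.measurePreserving_swap
  have hG2 : MemLp (G ∘ Prod.swap) 2 := hG.comp_measurePreserving hsw
  have hs1 : ∀ p, p.2 ∉ Metric.ball (0 : RSpace d) n → G p = 0 := fun p hp =>
    Set.indicator_of_notMem (fun h => hp h.2.1) _
  have hs2 : ∀ p, p.2 ∉ Metric.ball (0 : RSpace d) n → (G ∘ Prod.swap) p = 0 := fun p hp => by
    rw [Function.comp_apply, hGdef]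
    exact Set.indicator_of_notMem (fun h => hp h.1) _
  have hswap : ∀ F : RSpace d × RSpace d → ℝ, ∫ p, F (Prod.swap p) = ∫ p, F p := fun F =>
    integral_prod_swap (μ := (volume : Measure (RSpace d))) (ν := (volume : Measure (RSpace d))) F
  have k1 := eventually_abs_integral_kernel_mul_fst_le hs hm hb hlim hG hs1 hη3
  have k2 := eventually_abs_integral_kernel_mul_fst_le (l := l) (h := fun i => h i ∘ Prod.swap) hs
    (by filter_upwards [hm] with i hi using hi.comp_measurePreserving hsw)
    (by filter_upwards [hb] with i hi using hsw.quasiMeasurePreserving.ae hi)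
    (fun φ hφ => by
      have h1 : Integrable (φ ∘ Prod.swap) := hsw.integrable_comp_of_integrable hφ
      refine (hlim _ h1).congr fun i => ?_
      rw [← hswap]
      simp) hG2 hs2 hη3
  filter_upwards [k1, k2, hm, hb] with i h1 h2 hmi hbi w
  have hw := Lp.memLp (w : LTwo d)
  have i1 : Integrable fun p => h i p * (G p * (w : LTwo d) p.1) :=
    (integrable_mul_fst_of_support hG hs1 hw).bdd_mul hmi hbi
  have i2 : Integrable fun p => h i p * (G p * (w : LTwo d) p.2) := by
    have := hsw.integrable_comp_of_integrable (integrable_mul_fst_of_support hG2 hs2 hw)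
    exact Integrable.bdd_mul (by simpa [Function.comp_def] using this) hmi hbi
  have hc : MemLp ((farPairs d n)ᶜ.indicator U) 2 := hU.indicator (measurableSet_farPairs n).compl
  have i3 := integrable_mul_mul_of_bound hmi hbi hc w.2
  have e : ∫ p, h i p * U p * diffQuot s (w : LTwo d) p =
      (∫ p, h i p * (G p * (w : LTwo d) p.2)) - (∫ p, h i p * (G p * (w : LTwo d) p.1)) +
      ∫ p, h i p * (farPairs d n)ᶜ.indicator U p * diffQuot s (w : LTwo d) p := by
    rw [← integral_sub i2 i1]
    refine Eq.trans ?_ (integral_add (i2.sub i1) i3)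
    refine integral_congr_ae (ae_of_all _ fun p => ?_)
    by_cases hp : p ∈ farPairs d n
    · simp only [hGdef, Set.indicator_of_mem hp,
        Set.indicator_of_notMem (Set.notMem_compl_iff.2 hp), diffQuot]
      ring
    · simp only [hGdef, Set.indicator_of_notMem hp,
        Set.indicator_of_mem (Set.mem_compl hp)]
      ring
  have h3 : |∫ p, h i p * (farPairs d n)ᶜ.indicator U p * diffQuot s (w : LTwo d) p| ≤
      η / 3 * sobolevNorm w := by
    have hhc := memLp_two_of_abs_le hmi hbi hc
    refine (abs_integral_mul_le_sqrt hhc w.2).trans ?_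
    refine mul_le_mul ?_ (sqrt_integral_diffQuot_le_sobolevNorm w) (Real.sqrt_nonneg _) hη3.le
    refine le_trans ?_ hn
    rw [← Real.sqrt_sq_eq_abs C, ← Real.sqrt_mul (sq_nonneg C), ← integral_const_mul]
    refine Real.sqrt_le_sqrt (integral_mono_ae hhc.integrable_sq (hc.integrable_sq.const_mul _) ?_)
    filter_upwards [hbi] with p hp
    simp only [mul_pow]
    exact mul_le_mul_of_nonneg_right (sq_le_sq.2 (hp.trans (le_abs_self C))) (sq_nonneg _)
  have h2' : |∫ p, h i p * (G p * (w : LTwo d) p.2)| ≤ η / 3 * sobolevNorm w := by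
    rw [← hswap]
    exact h2 w
  rw [e]
  calc _ ≤ |(∫ p, h i p * (G p * (w : LTwo d) p.2)) - ∫ p, h i p * (G p * (w : LTwo d) p.1)| + _ :=
        abs_add_le _ _
    _ ≤ (|∫ p, h i p * (G p * (w : LTwo d) p.2)| + |∫ p, h i p * (G p * (w : LTwo d) p.1)|) + _ :=
        by gcongr; exact abs_sub _ _
    _ ≤ (η / 3 * sobolevNorm w + η / 3 * sobolevNorm w) + η / 3 * sobolevNorm w := by
        gcongr; exact h1 w
    _ = η * sobolevNorm w := by ring

end WeakStar

/-! ### `H^s` as a closed subspace of `L² × L²`. -/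

section SobolevHilbert

variable {d : ℕ} {s : ℝ}

theorem diffQuot_add (u v : LTwo d) :
    diffQuot s ((u + v : LTwo d) : RSpace d → ℝ) =ᵐ[volume] diffQuot s u + diffQuot s v := by
  refine (diffQuot_congr s (Lp.coeFn_add u v)).trans (ae_of_all _ fun p => ?_)
  simp only [diffQuot, Pi.add_apply]
  ring

theorem diffQuot_smul (c : ℝ) (u : LTwo d) :
    diffQuot s ((c • u : LTwo d) : RSpace d → ℝ) =ᵐ[volume] c • diffQuot s u := by
  refine (diffQuot_congr s (Lp.coeFn_smul c u)).trans (ae_of_all _ fun p => ?_)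
  simp only [diffQuot, Pi.smul_apply, smul_eq_mul]
  ring

theorem diffQuot_sub (u v : LTwo d) :
    diffQuot s ((u - v : LTwo d) : RSpace d → ℝ) =ᵐ[volume] diffQuot s u - diffQuot s v := by
  refine (diffQuot_congr s (Lp.coeFn_sub u v)).trans (ae_of_all _ fun p => ?_)
  simp only [diffQuot, Pi.sub_apply]
  ring

theorem memLp_diffQuot (u : sobolev d s) : MemLp (diffQuot s (u : LTwo d)) 2 volume := u.2

/-- The Gagliardo quotient as a linear map from `H^s` into `L²`. -/
noncomputable def sobolevGrad (d : ℕ) (s : ℝ) :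
    sobolev d s →ₗ[ℝ] Lp ℝ 2 (volume : Measure (RSpace d × RSpace d)) where
  toFun u := (memLp_diffQuot u).toLp _
  map_add' u v := by
    rw [← MemLp.toLp_add]
    exact MemLp.toLp_congr _ _ (diffQuot_add _ _)
  map_smul' c u := by
    rw [RingHom.id_apply, ← MemLp.toLp_const_smul]
    exact MemLp.toLp_congr _ _ (diffQuot_smul _ _)

theorem coeFn_sobolevGrad (u : sobolev d s) :
    sobolevGrad d s u =ᵐ[volume] diffQuot s (u : LTwo d) := MemLp.coeFn_toLp (memLp_diffQuot u)

/-- The map `u ↦ (u, D u)` from `H^s` into `L² × L²`, where `D u` is the Gagliardo quotient. -/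
noncomputable def sobolevEmbed (d : ℕ) (s : ℝ) : sobolev d s →ₗ[ℝ]
    WithLp 2 (LTwo d × Lp ℝ 2 (volume : Measure (RSpace d × RSpace d))) :=
  (WithLp.linearEquiv 2 ℝ _).symm.toLinearMap.comp ((sobolev d s).subtype.prod (sobolevGrad d s))

theorem norm_sq_eq_integral_sq {X : Type*} [MeasurableSpace X] {μ : Measure X} (f : Lp ℝ 2 μ) :
    ‖f‖ ^ 2 = ∫ x, f x ^ 2 ∂μ := by
  rw [← real_inner_self_eq_norm_sq, L2.inner_def]
  simp [sq]

theorem norm_sobolevEmbed (u : sobolev d s) : ‖sobolevEmbed d s u‖ = sobolevNorm u := by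
  rw [sobolevNorm, ← Real.sqrt_sq (norm_nonneg (sobolevEmbed d s u)),
    WithLp.prod_norm_sq_eq_of_L2, norm_sq_eq_integral_sq, norm_sq_eq_integral_sq]
  congr 2
  refine integral_congr_ae ?_
  filter_upwards [coeFn_sobolevGrad u] with p hp
  exact congrArg (· ^ 2) hp

/-- This is the completeness of `H^s`. If `u n` and its quotients converge in `L²`, a subsequence of
`u n` converges almost everywhere, hence so do its quotients at almost every pair; a further
subsequence of the quotients converges almost everywhere to their `L²` limit, which is thus the
quotient of the limit of `u n`. -/
theorem isClosed_range_sobolevEmbed :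
    IsClosed (LinearMap.range (sobolevEmbed d s) :
      Set (WithLp 2 (LTwo d × Lp ℝ 2 (volume : Measure (RSpace d × RSpace d))))) := by
  refine IsSeqClosed.isClosed fun x p hx hxp => ?_
  choose u hu using hx
  have h1 : Tendsto (fun n => (u n : LTwo d)) atTop (𝓝 p.fst) := by
    have := ((WithLp.fstL 2 ℝ (LTwo d) (Lp ℝ 2 (volume : Measure (RSpace d × RSpace d)))).continuous.tendsto
      p).comp hxp
    refine this.congr fun n => ?_
    rw [Function.comp_apply, ← hu n]
    rfl
  have h2 : Tendsto (fun n => sobolevGrad d s (u n)) atTop (𝓝 p.snd) := by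
    have := ((WithLp.sndL 2 ℝ (LTwo d) (Lp ℝ 2 (volume : Measure (RSpace d × RSpace d)))).continuous.tendsto
      p).comp hxp
    refine this.congr fun n => ?_
    rw [Function.comp_apply, ← hu n]
    rfl
  obtain ⟨n₁, hn₁, ha₁⟩ := (tendstoInMeasure_of_tendsto_Lp h1).exists_seq_tendsto_ae
  obtain ⟨n₂, hn₂, ha₂⟩ :=
    (tendstoInMeasure_of_tendsto_Lp (h2.comp hn₁.tendsto_atTop)).exists_seq_tendsto_ae
  have hD : diffQuot s p.fst =ᵐ[volume] p.snd := by
    have h3 : ∀ᵐ q : RSpace d × RSpace d, ∀ n, sobolevGrad d s (u n) q =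
        diffQuot s (u n : LTwo d) q := ae_all_iff.2 fun n => coeFn_sobolevGrad (u n)
    have h4 : ∀ᵐ q ∂(volume : Measure (RSpace d × RSpace d)), Tendsto
        (fun i => (u (n₁ i) : LTwo d) q.1) atTop (𝓝 (p.fst q.1)) :=
      Measure.quasiMeasurePreserving_fst.ae ha₁
    have h5 : ∀ᵐ q ∂(volume : Measure (RSpace d × RSpace d)), Tendsto
        (fun i => (u (n₁ i) : LTwo d) q.2) atTop (𝓝 (p.fst q.2)) :=
      Measure.quasiMeasurePreserving_snd.ae ha₁
    filter_upwards [h3, h4, h5, ha₂] with q q3 q4 q5 q2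
    have q6 : Tendsto (fun i => diffQuot s (u (n₁ (n₂ i)) : LTwo d) q) atTop
        (𝓝 (diffQuot s p.fst q)) :=
      ((q5.sub q4).div_const _).comp hn₂.tendsto_atTop
    refine tendsto_nhds_unique q6 (q2.congr fun i => ?_)
    exact q3 _
  have hmem : MemLp (diffQuot s p.fst) 2 volume := (memLp_congr_ae hD).2 (Lp.memLp p.snd)
  refine ⟨⟨p.fst, hmem⟩, ?_⟩
  have : sobolevGrad d s ⟨p.fst, hmem⟩ = p.snd := Lp.ext ((coeFn_sobolevGrad _).trans hD)
  change WithLp.toLp 2 (p.fst, sobolevGrad d s ⟨p.fst, hmem⟩) = p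
  rw [this]
  rfl

end SobolevHilbert

/-! ### The resolvent equation, and homogenization from weak-* convergence. -/

section Resolvent

variable {d : ℕ}

/-- The symmetrized kernel `K(x,y) ν(x)` and the weight `ν` are measurable and take values in
`[a, b]` almost everywhere. -/
structure IsEllipticPair (a b : ℝ) (K : RSpace d → RSpace d → ℝ) (ν : RSpace d → ℝ) : Prop where
  aestronglyMeasurable_kernel :
    AEStronglyMeasurable (fun p : RSpace d × RSpace d => K p.1 p.2 * ν p.1) volume
  kernel_mem : ∀ᵐ p : RSpace d × RSpace d, K p.1 p.2 * ν p.1 ∈ Set.Icc a b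
  aestronglyMeasurable_weight : AEStronglyMeasurable ν volume
  weight_mem : ∀ᵐ x, ν x ∈ Set.Icc a b

theorem abs_le_of_mem_Icc_of_pos {a b t : ℝ} (ha : 0 < a) (h : t ∈ Set.Icc a b) : |t| ≤ b := by
  rw [abs_of_pos (ha.trans_le h.1)]
  exact h.2

/-- The singular weight is shared equally between the two differences. The exponents are
nonnegative, so the power splits on the diagonal as well. -/
theorem levyForm_eq {α : ℝ} (hα : 0 < α) (K : RSpace d → RSpace d → ℝ) (ν : RSpace d → ℝ)
    (u v : RSpace d → ℝ) :
    levyForm α K ν u v = 1 / 2 * ∫ p : RSpace d × RSpace d,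
      (K p.1 p.2 * ν p.1) * diffQuot (α / 2) u p * diffQuot (α / 2) v p := by
  unfold levyForm
  congr 1
  refine integral_congr_ae (ae_of_all _ fun p => ?_)
  have h : ‖p.2 - p.1‖ ^ ((d : ℝ) + α) =
      ‖p.2 - p.1‖ ^ ((d : ℝ) / 2 + α / 2) * ‖p.2 - p.1‖ ^ ((d : ℝ) / 2 + α / 2) := by
    rw [← Real.rpow_add_of_nonneg (norm_nonneg _) (by positivity) (by positivity)]
    congr 1
    ring
  simp only [diffQuot, h, ← div_div]
  rw [mul_div_assoc', mul_div_assoc', div_mul_eq_mul_div]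

/-- The form of `m - L` on `H^{α/2}`. -/
noncomputable def resolventForm (α m : ℝ) (K : RSpace d → RSpace d → ℝ) (ν : RSpace d → ℝ)
    (u v : sobolev d (α / 2)) : ℝ :=
  m * (∫ x, ν x * (u : LTwo d) x * (v : LTwo d) x) +
    1 / 2 * ∫ p : RSpace d × RSpace d, (K p.1 p.2 * ν p.1) *
      diffQuot (α / 2) (u : LTwo d) p * diffQuot (α / 2) (v : LTwo d) p

variable {α m a b : ℝ} {K : RSpace d → RSpace d → ℝ} {ν : RSpace d → ℝ}

theorem IsEllipticPair.integrable_weight (h : IsEllipticPair a b K ν) (ha : 0 < a)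
    {f g : RSpace d → ℝ} (hf : MemLp f 2) (hg : MemLp g 2) :
    Integrable fun x => ν x * f x * g x :=
  integrable_mul_mul_of_bound h.aestronglyMeasurable_weight
    (h.weight_mem.mono fun _ hx => abs_le_of_mem_Icc_of_pos ha hx) hf hg

theorem IsEllipticPair.integrable_kernel (h : IsEllipticPair a b K ν) (ha : 0 < a)
    {f g : RSpace d × RSpace d → ℝ} (hf : MemLp f 2) (hg : MemLp g 2) :
    Integrable fun p => (K p.1 p.2 * ν p.1) * f p * g p :=
  integrable_mul_mul_of_bound h.aestronglyMeasurable_kernel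
    (h.kernel_mem.mono fun _ hx => abs_le_of_mem_Icc_of_pos ha hx) hf hg

theorem IsEllipticPair.isResolventSolution_iff (h : IsEllipticPair a b K ν) (ha : 0 < a)
    (hα : 0 < α) (f : LTwo d) (u : sobolev d (α / 2)) :
    IsResolventSolution α m K ν f u ↔ ∀ v : sobolev d (α / 2),
      resolventForm α m K ν u v = - ∫ x, ν x * f x * (v : LTwo d) x := by
  refine forall_congr' fun v => ?_
  have e : ∫ x, (m • (u : LTwo d) + f : LTwo d) x * (v : LTwo d) x * ν x =
      m * (∫ x, ν x * (u : LTwo d) x * (v : LTwo d) x) + ∫ x, ν x * f x * (v : LTwo d) x := by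
    rw [← integral_const_mul, ← integral_add
      ((h.integrable_weight ha (Lp.memLp _) (Lp.memLp _)).const_mul m)
      (h.integrable_weight ha (Lp.memLp _) (Lp.memLp _))]
    refine integral_congr_ae ?_
    filter_upwards [Lp.coeFn_add (m • (u : LTwo d)) f, Lp.coeFn_smul m (u : LTwo d)] with x h1 h2
    rw [h1, Pi.add_apply, h2, Pi.smul_apply, smul_eq_mul]
    ring
  rw [e, levyForm_eq hα, resolventForm]
  constructor <;> intro h <;> linarith

theorem IsEllipticPair.resolventForm_sub (h : IsEllipticPair a b K ν) (ha : 0 < a)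
    (u₁ u₂ v : sobolev d (α / 2)) :
    resolventForm α m K ν (u₁ - u₂) v =
      resolventForm α m K ν u₁ v - resolventForm α m K ν u₂ v := by
  have e1 : ∫ x, ν x * ((u₁ - u₂ : sobolev d (α / 2)) : LTwo d) x * (v : LTwo d) x =
      (∫ x, ν x * (u₁ : LTwo d) x * (v : LTwo d) x) -
        ∫ x, ν x * (u₂ : LTwo d) x * (v : LTwo d) x := by
    rw [← integral_sub (h.integrable_weight ha (Lp.memLp _) (Lp.memLp _))
      (h.integrable_weight ha (Lp.memLp _) (Lp.memLp _))]
    refine integral_congr_ae ?_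
    filter_upwards [Lp.coeFn_sub (u₁ : LTwo d) (u₂ : LTwo d)] with x h1
    rw [Submodule.coe_sub, h1, Pi.sub_apply]
    ring
  have e2 : ∫ p : RSpace d × RSpace d, (K p.1 p.2 * ν p.1) *
        diffQuot (α / 2) ((u₁ - u₂ : sobolev d (α / 2)) : LTwo d) p *
        diffQuot (α / 2) (v : LTwo d) p =
      (∫ p : RSpace d × RSpace d, (K p.1 p.2 * ν p.1) * diffQuot (α / 2) (u₁ : LTwo d) p *
        diffQuot (α / 2) (v : LTwo d) p) -
      ∫ p : RSpace d × RSpace d, (K p.1 p.2 * ν p.1) * diffQuot (α / 2) (u₂ : LTwo d) p *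
        diffQuot (α / 2) (v : LTwo d) p := by
    rw [← integral_sub (h.integrable_kernel ha u₁.2 v.2) (h.integrable_kernel ha u₂.2 v.2)]
    refine integral_congr_ae ?_
    filter_upwards [diffQuot_sub (s := α / 2) (u₁ : LTwo d) (u₂ : LTwo d)] with p h1
    rw [Submodule.coe_sub, h1, Pi.sub_apply]
    ring
  rw [resolventForm, e1, e2, resolventForm, resolventForm]
  ring

theorem sobolevNorm_sq {s : ℝ} (u : sobolev d s) :
    sobolevNorm u ^ 2 = (∫ x, (u : LTwo d) x ^ 2) + ∫ p, diffQuot s (u : LTwo d) p ^ 2 :=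
  Real.sq_sqrt (add_nonneg (integral_nonneg fun _ => sq_nonneg _)
    (integral_nonneg fun _ => sq_nonneg _))

/-- The coercivity constant involves only `m` and the lower bound `a`, so it is the same at every
scale `ε`. -/
theorem IsEllipticPair.le_resolventForm_self (h : IsEllipticPair a b K ν) (ha : 0 < a)
    (hm : 0 < m) (u : sobolev d (α / 2)) :
    a * min m (1 / 2) * sobolevNorm u ^ 2 ≤ resolventForm α m K ν u u := by
  have e1 : a * ∫ x, (u : LTwo d) x ^ 2 ≤ ∫ x, ν x * (u : LTwo d) x * (u : LTwo d) x := by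
    rw [← integral_const_mul]
    refine integral_mono_ae ((Lp.memLp (u : LTwo d)).integrable_sq.const_mul a)
      (h.integrable_weight ha (Lp.memLp _) (Lp.memLp _)) ?_
    filter_upwards [h.weight_mem] with x hx
    nlinarith [hx.1, sq_nonneg ((u : LTwo d) x)]
  have e2 : a * ∫ p, diffQuot (α / 2) (u : LTwo d) p ^ 2 ≤
      ∫ p : RSpace d × RSpace d, (K p.1 p.2 * ν p.1) * diffQuot (α / 2) (u : LTwo d) p *
        diffQuot (α / 2) (u : LTwo d) p := by
    rw [← integral_const_mul]
    refine integral_mono_ae (u.2.integrable_sq.const_mul a) (h.integrable_kernel ha u.2 u.2) ?_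
    filter_upwards [h.kernel_mem] with p hp
    nlinarith [hp.1, sq_nonneg (diffQuot (α / 2) (u : LTwo d) p)]
  have p1 : 0 ≤ a * ∫ x, (u : LTwo d) x ^ 2 :=
    mul_nonneg ha.le (integral_nonneg fun _ => sq_nonneg _)
  have p2 : 0 ≤ a * ∫ p, diffQuot (α / 2) (u : LTwo d) p ^ 2 :=
    mul_nonneg ha.le (integral_nonneg fun _ => sq_nonneg _)
  rw [sobolevNorm_sq, resolventForm]
  calc _ = min m (1 / 2) * (a * ∫ x, (u : LTwo d) x ^ 2) +
        min m (1 / 2) * (a * ∫ p, diffQuot (α / 2) (u : LTwo d) p ^ 2) := by ring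
    _ ≤ m * (a * ∫ x, (u : LTwo d) x ^ 2) +
        1 / 2 * (a * ∫ p, diffQuot (α / 2) (u : LTwo d) p ^ 2) := by
      gcongr
      · exact min_le_left _ _
      · exact min_le_right _ _
    _ ≤ _ := by gcongr

theorem norm_coe_le_sobolevNorm {s : ℝ} (u : sobolev d s) : ‖(u : LTwo d)‖ ≤ sobolevNorm u := by
  rw [← Real.sqrt_sq (norm_nonneg (u : LTwo d)), norm_sq_eq_integral_sq]
  exact sqrt_integral_sq_le_sobolevNorm u

theorem IsEllipticPair.eq_of_isResolventSolution (h : IsEllipticPair a b K ν) (ha : 0 < a)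
    (hα : 0 < α) (hm : 0 < m) {f : LTwo d} {u₁ u₂ : sobolev d (α / 2)}
    (h₁ : IsResolventSolution α m K ν f u₁) (h₂ : IsResolventSolution α m K ν f u₂) : u₁ = u₂ := by
  rw [h.isResolventSolution_iff ha hα] at h₁ h₂
  have e := h.le_resolventForm_self ha hm (u₁ - u₂)
  rw [h.resolventForm_sub ha, h₁, h₂, sub_self] at e
  have hc : 0 < a * min m (1 / 2) := mul_pos ha (lt_min hm (by norm_num))
  have h0 : sobolevNorm (u₁ - u₂) ^ 2 ≤ 0 := by
    by_contra! hlt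
    exact absurd e (not_le.2 (mul_pos hc hlt))
  have h1 : sobolevNorm (u₁ - u₂) = 0 := by
    have := sq_nonneg (sobolevNorm (u₁ - u₂))
    exact pow_eq_zero_iff two_ne_zero |>.1 (le_antisymm h0 this)
  have h2 := norm_coe_le_sobolevNorm (u₁ - u₂)
  rw [h1] at h2
  have h3 := norm_le_zero_iff.1 h2
  exact sub_eq_zero.1 (Subtype.ext h3)

/-- The bounded bilinear form `(f, g) ↦ ∫ h f g` on `L²`. -/
noncomputable def weightedPairing {X : Type*} [MeasurableSpace X] {μ : Measure X} {h : X → ℝ}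
    (hh : MemLp h ⊤ μ) : Lp ℝ 2 μ →L[ℝ] Lp ℝ 2 μ →L[ℝ] ℝ :=
  ((ContinuousLinearMap.mul ℝ ℝ).lpPairing μ 2 2).comp
    ((ContinuousLinearMap.mul ℝ ℝ).holderL μ ⊤ 2 2 (hh.toLp h))

theorem weightedPairing_apply {X : Type*} [MeasurableSpace X] {μ : Measure X} {h : X → ℝ}
    (hh : MemLp h ⊤ μ) (f g : Lp ℝ 2 μ) :
    weightedPairing hh f g = ∫ x, h x * f x * g x ∂μ := by
  rw [weightedPairing, ContinuousLinearMap.comp_apply, ContinuousLinearMap.lpPairing_eq_integral]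
  refine integral_congr_ae ?_
  filter_upwards [(ContinuousLinearMap.mul ℝ ℝ).coeFn_holder (r := 2) (hh.toLp h) f,
    hh.coeFn_toLp] with x h1 h2
  simp only [ContinuousLinearMap.holderL_apply_apply, ContinuousLinearMap.mul_apply'] at h1 ⊢
  rw [h1, h2]

/-- The Lax–Milgram theorem on a space embedded with closed range into a Hilbert space. -/
theorem exists_forall_bilin_eq {E M : Type*} [NormedAddCommGroup E] [InnerProductSpace ℝ E]
    [CompleteSpace E] [AddCommGroup M] [Module ℝ M] (J : M →ₗ[ℝ] E)
    (hJ : IsClosed (LinearMap.range J : Set E)) (B : E →L[ℝ] E →L[ℝ] ℝ) {C : ℝ} (hC : 0 < C)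
    (hB : ∀ u, C * ‖J u‖ ^ 2 ≤ B (J u) (J u)) (Φ : E →L[ℝ] ℝ) :
    ∃ u, ∀ v, B (J u) (J v) = Φ (J v) := by
  have : CompleteSpace (LinearMap.range J) := hJ.completeSpace_coe
  let V := LinearMap.range J
  let B' : V →L[ℝ] V →L[ℝ] ℝ := B.bilinearComp V.subtypeL V.subtypeL
  have hco : IsCoercive B' := by
    refine ⟨C, hC, ?_⟩
    rintro ⟨_, u, rfl⟩
    have := hB u
    rw [sq, ← mul_assoc] at this
    exact this
  let r : V := (InnerProductSpace.toDual ℝ V).symm (Φ.comp V.subtypeL)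
  have key : ∀ y : V, B' (hco.continuousLinearEquivOfBilin.symm r) y = Φ y := fun y => by
    rw [← IsCoercive.continuousLinearEquivOfBilin_apply hco,
      ContinuousLinearEquiv.apply_symm_apply, InnerProductSpace.toDual_symm_apply]
    rfl
  obtain ⟨u, hu⟩ := (hco.continuousLinearEquivOfBilin.symm r).2
  refine ⟨u, fun v => ?_⟩
  rw [hu]
  exact key ⟨J v, v, rfl⟩

/-- The form extends to all of `L² × L²`, with the weight acting on the first factor and the kernel
on the second. Boundedness then holds on the whole product, while coercivity is needed only on the
closed range of `H^{α/2}`. -/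
theorem IsEllipticPair.exists_isResolventSolution (h : IsEllipticPair a b K ν) (ha : 0 < a)
    (hα : 0 < α) (hm : 0 < m) (f : LTwo d) : ∃ u, IsResolventSolution α m K ν f u := by
  have hν : MemLp ν ⊤ volume := memLp_top_of_bound h.aestronglyMeasurable_weight b
    (h.weight_mem.mono fun _ hx => abs_le_of_mem_Icc_of_pos ha hx)
  have hk : MemLp (fun p : RSpace d × RSpace d => K p.1 p.2 * ν p.1) ⊤ volume :=
    memLp_top_of_bound h.aestronglyMeasurable_kernel b
      (h.kernel_mem.mono fun _ hx => abs_le_of_mem_Icc_of_pos ha hx)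
  let F₁ := WithLp.fstL 2 ℝ (LTwo d) (Lp ℝ 2 (volume : Measure (RSpace d × RSpace d)))
  let F₂ := WithLp.sndL 2 ℝ (LTwo d) (Lp ℝ 2 (volume : Measure (RSpace d × RSpace d)))
  let B := m • (weightedPairing hν).bilinearComp F₁ F₁ +
    (1 / 2 : ℝ) • (weightedPairing hk).bilinearComp F₂ F₂
  have hB : ∀ u v, B (sobolevEmbed d (α / 2) u) (sobolevEmbed d (α / 2) v) =
      resolventForm α m K ν u v := by
    intro u v
    have e : B (sobolevEmbed d (α / 2) u) (sobolevEmbed d (α / 2) v) =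
        m * weightedPairing hν (u : LTwo d) (v : LTwo d) +
        1 / 2 * weightedPairing hk (sobolevGrad d (α / 2) u) (sobolevGrad d (α / 2) v) := rfl
    rw [e, weightedPairing_apply, weightedPairing_apply, resolventForm]
    congr 2
    refine integral_congr_ae ?_
    filter_upwards [coeFn_sobolevGrad u, coeFn_sobolevGrad v] with p h1 h2
    rw [h1, h2]
  obtain ⟨u, hu⟩ := exists_forall_bilin_eq (sobolevEmbed d (α / 2)) isClosed_range_sobolevEmbed B
    (mul_pos ha (lt_min hm (by norm_num : (0 : ℝ) < 1 / 2)))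
    (fun u => by rw [norm_sobolevEmbed, hB]; exact h.le_resolventForm_self ha hm u)
    (-(weightedPairing hν f).comp F₁)
  refine ⟨u, (h.isResolventSolution_iff ha hα f u).2 fun v => ?_⟩
  rw [← hB, hu]
  have e : (-(weightedPairing hν f).comp F₁) (sobolevEmbed d (α / 2) v) =
      -weightedPairing hν f (v : LTwo d) := rfl
  rw [e, weightedPairing_apply]

/-- Both sides of the weak equation scale by `c`. The weights may converge weak-* to a constant
other than `1`, and this replaces that constant by the weight `1` of the limit operator. -/
theorem isResolventSolution_const_weight {c : ℝ} (hc : c ≠ 0) (f : LTwo d)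
    (u : sobolev d (α / 2)) :
    IsResolventSolution α m K (fun _ => 1) f u ↔ IsResolventSolution α m K (fun _ => c) f u := by
  refine forall_congr' fun v => ?_
  have e1 : ∫ x, (m • (u : LTwo d) + f : LTwo d) x * (v : LTwo d) x * c =
      c * ∫ x, (m • (u : LTwo d) + f : LTwo d) x * (v : LTwo d) x * 1 := by
    rw [← integral_const_mul]
    exact integral_congr_ae (ae_of_all _ fun x => by ring)
  have e2 : levyForm α K (fun _ => c) (u : LTwo d) (v : LTwo d) =
      c * levyForm α K (fun _ => 1) (u : LTwo d) (v : LTwo d) := by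
    unfold levyForm
    rw [mul_left_comm c, ← integral_const_mul c]
    congr 1
    exact integral_congr_ae (ae_of_all _ fun x => by ring)
  rw [e1, e2, ← mul_neg, mul_right_inj' hc]

/-- Homogenization follows from weak-* convergence of the symmetrized kernels and the weights. -/
theorem homogenizes_of_weakStar (hα : 0 < α) (hm : 0 < m) (ha : 0 < a)
    {K : ℝ → RSpace d → RSpace d → ℝ} {ν : ℝ → RSpace d → ℝ} {K₀ : RSpace d → RSpace d → ℝ}
    {c : ℝ} (hc : c ≠ 0) (h : ∀ ε, 0 < ε → IsEllipticPair a b (K ε) (ν ε))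
    (h₀ : IsEllipticPair a b K₀ (fun _ => c))
    (hK : ∀ φ : RSpace d × RSpace d → ℝ, Integrable φ →
      Tendsto (fun ε => ∫ p, (K ε p.1 p.2 * ν ε p.1) * φ p) (𝓝[>] 0)
        (𝓝 (∫ p, (K₀ p.1 p.2 * c) * φ p)))
    (hν : ∀ φ : RSpace d → ℝ, Integrable φ →
      Tendsto (fun ε => ∫ x, ν ε x * φ x) (𝓝[>] 0) (𝓝 (∫ x, c * φ x))) :
    Homogenizes α m K ν K₀ := by
  intro f
  refine ⟨fun ε hε => ?_, ?_, ?_⟩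
  · obtain ⟨u, hu⟩ := (h ε hε).exists_isResolventSolution ha hα hm f
    exact ⟨u, hu, fun v hv => (h ε hε).eq_of_isResolventSolution ha hα hm hv hu⟩
  · simp only [isResolventSolution_const_weight hc]
    obtain ⟨u, hu⟩ := h₀.exists_isResolventSolution ha hα hm f
    exact ⟨u, hu, fun v hv => h₀.eq_of_isResolventSolution ha hα hm hv hu⟩
  intro u u₀ hu hu₀
  rw [isResolventSolution_const_weight hc, h₀.isResolventSolution_iff ha hα] at hu₀
  have hpos : ∀ᶠ ε : ℝ in 𝓝[>] 0, 0 < ε := self_mem_nhdsWithin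
  have bw : ∀ ε, 0 < ε → ∀ᵐ x, |ν ε x - c| ≤ b + b := fun ε hε => by
    filter_upwards [(h ε hε).weight_mem, h₀.weight_mem] with x h1 h2
    exact (abs_sub _ _).trans
      (add_le_add (abs_le_of_mem_Icc_of_pos ha h1) (abs_le_of_mem_Icc_of_pos ha h2))
  have bk : ∀ ε, 0 < ε → ∀ᵐ p : RSpace d × RSpace d,
      |K ε p.1 p.2 * ν ε p.1 - K₀ p.1 p.2 * c| ≤ b + b := fun ε hε => by
    filter_upwards [(h ε hε).kernel_mem, h₀.kernel_mem] with x h1 h2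
    exact (abs_sub _ _).trans
      (add_le_add (abs_le_of_mem_Icc_of_pos ha h1) (abs_le_of_mem_Icc_of_pos ha h2))
  have mw : ∀ ε, 0 < ε → AEStronglyMeasurable (fun x => ν ε x - c) volume := fun ε hε =>
    (h ε hε).aestronglyMeasurable_weight.sub h₀.aestronglyMeasurable_weight
  have mk : ∀ ε, 0 < ε → AEStronglyMeasurable (fun p : RSpace d × RSpace d =>
      K ε p.1 p.2 * ν ε p.1 - K₀ p.1 p.2 * c) volume := fun ε hε =>
    (h ε hε).aestronglyMeasurable_kernel.sub h₀.aestronglyMeasurable_kernel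
  have lw : ∀ φ : RSpace d → ℝ, Integrable φ →
      Tendsto (fun ε => ∫ x, (ν ε x - c) * φ x) (𝓝[>] 0) (𝓝 0) := fun φ hφ => by
    have := (hν φ hφ).sub_const (∫ x, c * φ x)
    rw [sub_self] at this
    refine this.congr' ?_
    filter_upwards [hpos] with ε hε
    rw [← integral_sub (hφ.bdd_mul (h ε hε).aestronglyMeasurable_weight
      ((h ε hε).weight_mem.mono fun _ hx => abs_le_of_mem_Icc_of_pos ha hx)) (hφ.const_mul c)]
    exact integral_congr_ae (ae_of_all _ fun x => by ring)
  have lk : ∀ φ : RSpace d × RSpace d → ℝ, Integrable φ →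
      Tendsto (fun ε => ∫ p, (K ε p.1 p.2 * ν ε p.1 - K₀ p.1 p.2 * c) * φ p) (𝓝[>] 0) (𝓝 0) :=
      fun φ hφ => by
    have := (hK φ hφ).sub_const (∫ p, (K₀ p.1 p.2 * c) * φ p)
    rw [sub_self] at this
    refine this.congr' ?_
    filter_upwards [hpos] with ε hε
    rw [← integral_sub (hφ.bdd_mul (h ε hε).aestronglyMeasurable_kernel
      ((h ε hε).kernel_mem.mono fun _ hx => abs_le_of_mem_Icc_of_pos ha hx))
      (hφ.bdd_mul h₀.aestronglyMeasurable_kernel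
      (h₀.kernel_mem.mono fun _ hx => abs_le_of_mem_Icc_of_pos ha hx))]
    exact integral_congr_ae (ae_of_all _ fun x => by ring)
  -- Both equations are tested with the difference `u^ε - u⁰`. Every term on the right pairs a
  -- weak-* null factor with a fixed `L²` function; only the test function still varies with `ε`.
  have identity : ∀ ε, 0 < ε → resolventForm α m (K ε) (ν ε) (u ε - u₀) (u ε - u₀) =
      -(∫ x, (ν ε x - c) * f x * ((u ε - u₀ : sobolev d (α / 2)) : LTwo d) x) -
      m * (∫ x, (ν ε x - c) * (u₀ : LTwo d) x * ((u ε - u₀ : sobolev d (α / 2)) : LTwo d) x) -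
      1 / 2 * ∫ p : RSpace d × RSpace d, (K ε p.1 p.2 * ν ε p.1 - K₀ p.1 p.2 * c) *
        diffQuot (α / 2) (u₀ : LTwo d) p *
        diffQuot (α / 2) ((u ε - u₀ : sobolev d (α / 2)) : LTwo d) p := by
    intro ε hε
    have hs := ((h ε hε).isResolventSolution_iff ha hα f (u ε)).1 (hu ε hε) (u ε - u₀)
    have hs₀ := hu₀ (u ε - u₀)
    have hw := Lp.memLp ((u ε - u₀ : sobolev d (α / 2)) : LTwo d)
    have hDw := (u ε - u₀).2
    rw [(h ε hε).resolventForm_sub ha, hs]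
    generalize u ε - u₀ = w at *
    have e : ∀ g : LTwo d, ∫ x, (ν ε x - c) * g x * (w : LTwo d) x =
        (∫ x, ν ε x * g x * (w : LTwo d) x) - ∫ x, c * g x * (w : LTwo d) x := fun g => by
      rw [← integral_sub ((h ε hε).integrable_weight ha (Lp.memLp g) hw)
        (h₀.integrable_weight ha (Lp.memLp g) hw)]
      exact integral_congr_ae (ae_of_all _ fun x => by ring)
    have e' : ∫ p : RSpace d × RSpace d, (K ε p.1 p.2 * ν ε p.1 - K₀ p.1 p.2 * c) *
        diffQuot (α / 2) (u₀ : LTwo d) p * diffQuot (α / 2) (w : LTwo d) p =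
        (∫ p : RSpace d × RSpace d, (K ε p.1 p.2 * ν ε p.1) *
          diffQuot (α / 2) (u₀ : LTwo d) p * diffQuot (α / 2) (w : LTwo d) p) -
        ∫ p : RSpace d × RSpace d, (K₀ p.1 p.2 * c) *
          diffQuot (α / 2) (u₀ : LTwo d) p * diffQuot (α / 2) (w : LTwo d) p := by
      rw [← integral_sub ((h ε hε).integrable_kernel ha u₀.2 hDw)
        (h₀.integrable_kernel ha u₀.2 hDw)]
      exact integral_congr_ae (ae_of_all _ fun x => by ring)
    rw [e f, e (u₀ : LTwo d), e']
    unfold resolventForm at hs₀ ⊢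
    linarith
  have hcoer : 0 < a * min m (1 / 2) := mul_pos ha (lt_min hm (by norm_num))
  have hs : 0 < α / 2 := by positivity
  have strong : Tendsto (fun ε => sobolevNorm (u ε - u₀)) (𝓝[>] 0) (𝓝 0) := by
    refine tendsto_order.2 ⟨fun x hx => Eventually.of_forall fun ε =>
      hx.trans_le (sobolevNorm_nonneg _), fun τ hτ => ?_⟩
    -- The factor `1 + m + 1/2` adds up the coefficients of the three terms of the identity.
    -- Coercivity is quadratic in the norm of the difference and the bound is linear, so no a priori
    -- bound on `u^ε` is required.
    obtain ⟨η, hη, hητ⟩ : ∃ η : ℝ, 0 < η ∧ (1 + m + 1 / 2) * η < a * min m (1 / 2) * τ := by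
      refine ⟨a * min m (1 / 2) * τ / (2 * (1 + m + 1 / 2)), by positivity, ?_⟩
      have : 0 < a * min m (1 / 2) * τ := by positivity
      rw [mul_div_assoc', mul_comm (2 : ℝ), mul_div_mul_left _ _ (by positivity)]
      linarith
    have N1 := eventually_abs_integral_weight_mul_le hs
      (by filter_upwards [hpos] with ε hε using mw ε hε)
      (by filter_upwards [hpos] with ε hε using bw ε hε) lw (Lp.memLp f) hη
    have N2 := eventually_abs_integral_weight_mul_le hs
      (by filter_upwards [hpos] with ε hε using mw ε hε)
      (by filter_upwards [hpos] with ε hε using bw ε hε) lw (Lp.memLp (u₀ : LTwo d)) hη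
    have N3 := eventually_abs_integral_kernel_mul_le hs
      (by filter_upwards [hpos] with ε hε using mk ε hε)
      (by filter_upwards [hpos] with ε hε using bk ε hε) lk u₀.2 hη
    filter_upwards [N1, N2, N3, hpos] with ε n1 n2 n3 hε
    have c1 := (h ε hε).le_resolventForm_self ha hm (u ε - u₀)
    rw [identity ε hε] at c1
    have i1 := (abs_le.1 (n1 (u ε - u₀))).1
    have i2 := mul_le_mul_of_nonneg_left (abs_le.1 (n2 (u ε - u₀))).1 hm.le
    have i3 := (abs_le.1 (n3 (u ε - u₀))).1
    set N := sobolevNorm (u ε - u₀)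
    have hN : 0 ≤ N := sobolevNorm_nonneg _
    have c2 : a * min m (1 / 2) * N ^ 2 ≤ (1 + m + 1 / 2) * η * N := by linarith
    by_contra! hle
    have hN0 : 0 < N := hτ.trans_le hle
    have c3 : a * min m (1 / 2) * N ≤ (1 + m + 1 / 2) * η := by
      refine le_of_mul_le_mul_right ?_ hN0
      linarith
    have c4 := mul_le_mul_of_nonneg_left hle hcoer.le
    linarith
  refine ⟨?_, ?_⟩
  · rw [tendsto_iff_norm_sub_tendsto_zero]
    exact squeeze_zero (fun _ => norm_nonneg _) (fun ε => norm_coe_le_sobolevNorm (u ε - u₀)) strong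
  · rintro φ ⟨C, hC⟩
    rw [tendsto_iff_norm_sub_tendsto_zero]
    have hlim : Tendsto (fun ε => C * sobolevNorm (u ε - u₀)) (𝓝[>] 0) (𝓝 0) := by
      simpa using strong.const_mul C
    refine squeeze_zero (fun _ => norm_nonneg _) (fun ε => ?_) hlim
    rw [← map_sub]
    exact hC _

end Resolvent

/-! ### The maximal ergodic inequality. -/

section Maximal

open scoped ENNReal

variable {d : ℕ}

/-- The weak-type estimate for averages over balls of integer radius at most `N + 1`. -/
theorem mul_volume_le_of_average_gt (g : RSpace d → ℝ≥0∞) (N : ℕ) {c : ℝ≥0∞} {S : Set (RSpace d)}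
    (hS : S ⊆ Metric.closedBall 0 ((N : ℝ) + 1))
    (h : ∀ x ∈ S, ∃ n : ℕ, n ≤ N ∧ c * volume (Metric.closedBall (0 : RSpace d) ((n : ℝ) + 1)) ≤
      ∫⁻ y in Metric.closedBall x ((n : ℝ) + 1), g y) :
    c * volume S ≤ 5 ^ d * ∫⁻ y in Metric.closedBall (0 : RSpace d) (2 * ((N : ℝ) + 1)), g y := by
  choose! n hn hav using h
  -- Vitali selection needs bounded radii, hence the cap `N`. Fivefold enlargement of the disjoint
  -- balls costs `5 ^ d`; centres and radii bounded by `N + 1` keep the balls inside radius `2 (N +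
  -- 1)`.
  obtain ⟨u, huS, hdisj, hcov⟩ := Vitali.exists_disjoint_subfamily_covering_enlargement_closedBall
    S (fun x => x) (fun x => (n x : ℝ) + 1) ((N : ℝ) + 1)
    (fun x hx => by have := hn x hx; gcongr) 5 (by norm_num)
  have hcount : u.Countable := by
    refine hdisj.countable_of_nonempty_interior fun x _ => ?_
    refine ⟨x, Metric.ball_subset_interior_closedBall (Metric.mem_ball_self (by positivity))⟩
  have h1 : S ⊆ ⋃ x ∈ u, Metric.closedBall x (5 * ((n x : ℝ) + 1)) := fun x hx => by
    obtain ⟨b, hb, hsub⟩ := hcov x hx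
    exact Set.mem_biUnion hb (hsub (Metric.mem_closedBall_self (by positivity)))
  have h5 : ∀ x : RSpace d, volume (Metric.closedBall x (5 * ((n x : ℝ) + 1))) =
      5 ^ d * volume (Metric.closedBall (0 : RSpace d) ((n x : ℝ) + 1)) := fun x => by
    rw [Measure.addHaar_closedBall_mul volume x (by norm_num : (0 : ℝ) ≤ 5) (by positivity),
      finrank_euclideanSpace, Fintype.card_fin, ENNReal.ofReal_pow (by norm_num)]
    norm_num
  calc c * volume S ≤
      c * ∑' x : u, volume (Metric.closedBall (x : RSpace d) (5 * ((n x : ℝ) + 1))) := by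
        gcongr
        exact (measure_mono h1).trans (measure_biUnion_le _ hcount _)
    _ = 5 ^ d * ∑' x : u, c * volume (Metric.closedBall (0 : RSpace d) ((n x : ℝ) + 1)) := by
        simp only [h5, ENNReal.tsum_mul_left]
        ring
    _ ≤ 5 ^ d * ∑' x : u, ∫⁻ y in Metric.closedBall (x : RSpace d) ((n x : ℝ) + 1), g y := by
        gcongr with x
        exact hav x (huS x.2)
    _ = 5 ^ d * ∫⁻ y in ⋃ x ∈ u, Metric.closedBall x ((n x : ℝ) + 1), g y := by
        rw [lintegral_biUnion hcount (fun _ _ => Metric.isClosed_closedBall.measurableSet) hdisj]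
    _ ≤ _ := by
        gcongr
        refine Set.iUnion₂_subset fun x hx y hy => ?_
        have h2 := hS (huS hx)
        have h3 : (n x : ℝ) ≤ N := by exact_mod_cast hn x (huS hx)
        rw [mem_closedBall_zero_iff] at h2 ⊢
        rw [Metric.mem_closedBall, dist_eq_norm] at hy
        calc ‖y‖ = ‖(y - x) + x‖ := by rw [sub_add_cancel]
          _ ≤ ‖y - x‖ + ‖x‖ := norm_add_le _ _
          _ ≤ _ := by linarith

variable {Ω : Type*} [MeasurableSpace Ω] {P : Measure Ω} {T : RSpace d → Ω → Ω}

theorem IsErgodicSystem.measurable_orbit (hT : IsErgodicSystem P T) (ω : Ω) :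
    Measurable fun y => T y ω :=
  hT.measurable.comp (measurable_id.prodMk measurable_const)

/-- The points at which some average of `f` along the orbit over a ball of radius `n + 1`, `n ≤ N`,
is at least `c`. -/
def maximalSet (T : RSpace d → Ω → Ω) (f : Ω → ℝ≥0∞) (c : ℝ≥0∞) (N : ℕ) : Set Ω :=
  {ω | ∃ n : ℕ, n ≤ N ∧ c * volume (Metric.closedBall (0 : RSpace d) ((n : ℝ) + 1)) ≤
    ∫⁻ y in Metric.closedBall (0 : RSpace d) ((n : ℝ) + 1), f (T y ω)}

theorem measurableSet_maximalSet (hT : IsErgodicSystem P T) {f : Ω → ℝ≥0∞} (hf : Measurable f)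
    (c : ℝ≥0∞) (N : ℕ) : MeasurableSet (maximalSet T f c N) := by
  have : maximalSet T f c N = ⋃ n : ℕ, ⋃ _ : n ≤ N,
      {ω | c * volume (Metric.closedBall (0 : RSpace d) ((n : ℝ) + 1)) ≤
        ∫⁻ y in Metric.closedBall (0 : RSpace d) ((n : ℝ) + 1), f (T y ω)} := by
    ext ω
    simp [maximalSet]
  rw [this]
  refine MeasurableSet.iUnion fun n => MeasurableSet.iUnion fun _ => ?_
  exact measurableSet_le measurable_const (hf.comp hT.measurable).lintegral_prod_left'

/-- By the group law, moving the base point to `T x ω` amounts to recentring the ball at `x`. This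
is what makes transference work: whether `T x ω` lies in the maximal set is a statement about ball
averages, centred at `x`, of one function on `ℝ^d`. -/
theorem setLIntegral_closedBall_orbit (hT : IsErgodicSystem P T) {f : Ω → ℝ≥0∞} (x : RSpace d)
    (ω : Ω) (r : ℝ) :
    ∫⁻ y in Metric.closedBall (0 : RSpace d) r, f (T y (T x ω)) =
      ∫⁻ y in Metric.closedBall x r, f (T y ω) := by
  rw [← lintegral_indicator Metric.isClosed_closedBall.measurableSet,
    ← lintegral_indicator Metric.isClosed_closedBall.measurableSet,
    ← lintegral_add_right_eq_self ((Metric.closedBall x r).indicator _) x]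
  refine lintegral_congr fun y => ?_
  have : y + x ∈ Metric.closedBall x r ↔ y ∈ Metric.closedBall (0 : RSpace d) r := by
    simp [Metric.mem_closedBall, dist_eq_norm]
  by_cases hy : y ∈ Metric.closedBall (0 : RSpace d) r
  · rw [Set.indicator_of_mem hy, Set.indicator_of_mem (this.2 hy), hT.map_add]
  · rw [Set.indicator_of_notMem hy, Set.indicator_of_notMem (fun h => hy (this.1 h))]

theorem lintegral_orbit [SFinite P] (hT : IsErgodicSystem P T) {f : Ω → ℝ≥0∞} (hf : Measurable f)
    (s : Set (RSpace d)) :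
    ∫⁻ ω, (∫⁻ y in s, f (T y ω)) ∂P = volume s * ∫⁻ ω, f ω ∂P := by
  rw [lintegral_lintegral_swap (f := fun ω y => f (T y ω))
    ((hf.comp (hT.measurable.comp measurable_swap)).aemeasurable)]
  have : ∀ y, ∫⁻ ω, f (T y ω) ∂P = ∫⁻ ω, f ω ∂P := fun y =>
    (hT.measurePreserving y).lintegral_comp hf
  simp only [this, lintegral_const, Measure.restrict_apply_univ]
  rw [mul_comm]

/-- The maximal ergodic inequality, by transference from `ℝ^d`. -/
theorem mul_measure_maximalSet_le [SFinite P] (hT : IsErgodicSystem P T) {f : Ω → ℝ≥0∞}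
    (hf : Measurable f) (c : ℝ≥0∞) (N : ℕ) :
    c * P (maximalSet T f c N) ≤ 10 ^ d * ∫⁻ ω, f ω ∂P := by
  set E := maximalSet T f c N
  have hE : MeasurableSet E := measurableSet_maximalSet hT hf c N
  set V := volume (Metric.closedBall (0 : RSpace d) ((N : ℝ) + 1))
  have hV0 : V ≠ 0 := (Metric.measure_closedBall_pos _ _ (by positivity)).ne'
  have hVt : V ≠ ⊤ := measure_closedBall_lt_top.ne
  have hV2 : volume (Metric.closedBall (0 : RSpace d) (2 * ((N : ℝ) + 1))) = 2 ^ d * V := by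
    rw [Measure.addHaar_closedBall_mul volume _ (by norm_num : (0 : ℝ) ≤ 2) (by positivity),
      finrank_euclideanSpace, Fintype.card_fin, ENNReal.ofReal_pow (by norm_num)]
    norm_num [V]
  have hpt : ∀ ω, c * ∫⁻ x in Metric.closedBall (0 : RSpace d) ((N : ℝ) + 1),
      E.indicator 1 (T x ω) ≤
      5 ^ d * ∫⁻ y in Metric.closedBall (0 : RSpace d) (2 * ((N : ℝ) + 1)), f (T y ω) := by
    intro ω
    have hm : MeasurableSet ((fun x => T x ω) ⁻¹' E) := hT.measurable_orbit ω hE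
    have e : ∫⁻ x in Metric.closedBall (0 : RSpace d) ((N : ℝ) + 1), E.indicator 1 (T x ω) =
        volume ((fun x => T x ω) ⁻¹' E ∩ Metric.closedBall (0 : RSpace d) ((N : ℝ) + 1)) := by
      rw [← Measure.restrict_apply hm, ← lintegral_indicator_one hm]
      rfl
    rw [e]
    refine mul_volume_le_of_average_gt _ N Set.inter_subset_right fun x hx => ?_
    obtain ⟨n, hn, hav⟩ := hx.1
    exact ⟨n, hn, hav.trans_eq (setLIntegral_closedBall_orbit hT x ω _)⟩
  -- Integrating the estimate along each orbit over `ω`, invariance of `P` replaces both sides by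
  -- volumes times quantities on `Ω`. The volume `V` cancels, and `5 ^ d` and `2 ^ d` combine to `10
  -- ^ d`.
  have hint := lintegral_mono (μ := P) hpt
  have hmeas : Measurable fun ω => ∫⁻ x in Metric.closedBall (0 : RSpace d) ((N : ℝ) + 1),
      E.indicator (1 : Ω → ℝ≥0∞) (T x ω) :=
    ((measurable_one.indicator hE).comp hT.measurable).lintegral_prod_left'
  have hmeas2 : Measurable fun ω =>
      ∫⁻ y in Metric.closedBall (0 : RSpace d) (2 * ((N : ℝ) + 1)), f (T y ω) :=
    (hf.comp hT.measurable).lintegral_prod_left'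
  rw [lintegral_const_mul _ hmeas, lintegral_const_mul _ hmeas2,
    lintegral_orbit hT (measurable_one.indicator hE), lintegral_orbit hT hf,
    lintegral_indicator_one hE, hV2] at hint
  have h2 : V * (c * P E) ≤ V * (10 ^ d * ∫⁻ ω, f ω ∂P) := by
    calc V * (c * P E) = c * (V * P E) := by ring
      _ ≤ _ := hint
      _ = V * ((5 ^ d * 2 ^ d) * ∫⁻ ω, f ω ∂P) := by ring
      _ = _ := by rw [← mul_pow]; norm_num
  exact (ENNReal.mul_le_mul_iff_right hV0 hVt).1 h2

/-- The bound does not involve `N` and the sets increase with `N`, so the cap on the radii is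
removed by continuity from below. -/
theorem mul_measure_iUnion_maximalSet_le [SFinite P] (hT : IsErgodicSystem P T) {f : Ω → ℝ≥0∞}
    (hf : Measurable f) (c : ℝ≥0∞) :
    c * P (⋃ N, maximalSet T f c N) ≤ 10 ^ d * ∫⁻ ω, f ω ∂P := by
  have hmono : Monotone (maximalSet T f c) := fun N N' hN ω ⟨n, hn, h⟩ => ⟨n, hn.trans hN, h⟩
  rw [hmono.measure_iUnion, ENNReal.mul_iSup]
  exact iSup_le fun N => mul_measure_maximalSet_le hT hf c N

end Maximal

/-- Dilations preserve Lebesgue-null sets. A property valid at almost every point of an orbit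
therefore holds at every scale, with a set of good `ω` independent of `ε`. -/
theorem ae_orbit_smul {d : ℕ} {Ω : Type*} {T : RSpace d → Ω → Ω} {p : Ω → Prop}
    {ω : Ω} (h : ∀ᵐ y : RSpace d, p (T y ω)) {ε : ℝ}
    (hε : 0 < ε) : ∀ᵐ x : RSpace d, p (T (ε⁻¹ • x) ω) := by
  have hq : Measure.QuasiMeasurePreserving (fun x : RSpace d => ε⁻¹ • x) volume volume := by
    refine ⟨measurable_const_smul _, ?_⟩
    rw [Measure.map_addHaar_smul volume (inv_pos.2 hε).ne']
    exact Measure.smul_absolutelyContinuous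
  exact hq.ae h

/-! ### Invariant functions, and density of the coboundaries. -/

section Invariant

variable {d : ℕ} {Ω : Type*} [MeasurableSpace Ω] {P : Measure Ω} {T : RSpace d → Ω → Ω}

/-- Fubini and invariance of `P`: almost every orbit spends zero Lebesgue time in a null set. As `p`
may be non-measurable, a measurable null hull is used. -/
theorem IsErgodicSystem.ae_orbit [SFinite P] (hT : IsErgodicSystem P T) {p : Ω → Prop}
    (hp : ∀ᵐ ω ∂P, p ω) : ∀ᵐ ω ∂P, ∀ᵐ y : RSpace d, p (T y ω) := by
  obtain ⟨N, hN, hNm, hN0⟩ := exists_measurable_superset_of_null (ae_iff.1 hp)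
  have h1 : ∀ᵐ y : RSpace d, ∀ᵐ ω ∂P, T y ω ∉ N := ae_of_all _ fun y =>
    (hT.measurePreserving y).quasiMeasurePreserving.ae (measure_eq_zero_iff_ae_notMem.1 hN0)
  have h2 := (Measure.ae_ae_comm (p := fun y ω => T y ω ∉ N) (hT.measurable hNm.compl)).1 h1
  filter_upwards [h2] with ω hω
  filter_upwards [hω] with y hy
  by_contra h
  exact hy (hN h)

theorem IsErgodicSystem.image_eq_preimage (hT : IsErgodicSystem P T) (y : RSpace d) (A : Set Ω) :
    T y '' A = T (-y) ⁻¹' A := by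
  refine Set.image_eq_preimage_of_inverse ?_ ?_ |> congrFun <| A
  · intro ω
    rw [← hT.map_add, neg_add_cancel, hT.map_zero]
  · intro ω
    rw [← hT.map_add, add_neg_cancel, hT.map_zero]

/-- A function invariant modulo null sets under each translation is almost surely constant. -/
theorem IsErgodicSystem.exists_ae_eq_const [IsProbabilityMeasure P] (hT : IsErgodicSystem P T)
    {g : Ω → ℝ} (hg : Measurable g) (hinv : ∀ y, g ∘ T y =ᵐ[P] g) :
    ∃ c : ℝ, g =ᵐ[P] fun _ => c := by
  refine exists_eventuallyEq_const_of_forall_separating MeasurableSet fun U hU => ?_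
  -- The null set in `g ∘ T y = g` depends on `y`, whereas ergodicity is stated for exactly
  -- invariant sets. Asking that almost every time of the orbit satisfy `g ∈ U` gives an exactly
  -- invariant set, by translation invariance of Lebesgue measure, and it agrees with `g ⁻¹' U` up
  -- to a null set.
  set B : Set Ω := {ω | ∀ᵐ y : RSpace d, g (T y ω) ∈ U} with hB
  have hjoint : MeasurableSet {q : Ω × RSpace d | g (T q.2 q.1) ∉ U} :=
    (hg.comp (hT.measurable.comp measurable_swap)) hU.compl
  have hBm : MeasurableSet B :=
    measurable_measure_prodMk_left (ν := (volume : Measure (RSpace d))) hjoint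
      (measurableSet_singleton 0)
  have hBinv : ∀ y, T y '' B = B := by
    intro y
    rw [hT.image_eq_preimage]
    ext ω
    simp only [hB, Set.mem_preimage, Set.mem_ofPred_eq, ← hT.map_add]
    have hq : ∀ z : RSpace d, Measure.QuasiMeasurePreserving (fun y : RSpace d => y + z) volume
        volume := fun z => (measurePreserving_add_right volume z).quasiMeasurePreserving
    constructor
    · intro h
      have := (hq y).ae h
      simpa using this
    · intro h
      exact (hq (-y)).ae h
  have hae : ∀ᵐ ω ∂P, (ω ∈ B ↔ g ω ∈ U) := by
    have h1 : ∀ᵐ y : RSpace d, ∀ᵐ ω ∂P, g (T y ω) = g ω := ae_of_all _ fun y => hinv y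
    have h2 := (Measure.ae_ae_comm (p := fun (y : RSpace d) ω => g (T y ω) = g ω)
      (measurableSet_eq_fun (hg.comp hT.measurable) (hg.comp measurable_snd))).1 h1
    filter_upwards [h2] with ω hω
    constructor
    · intro h
      obtain ⟨y, hy1, hy2⟩ := (Filter.Eventually.and (Set.mem_ofPred_eq ▸ h) hω).exists
      rwa [← hy2]
    · intro h
      filter_upwards [hω] with y hy
      rwa [hy]
  rcases hT.ergodic B hBm hBinv with h | h
  · right
    filter_upwards [hae, measure_eq_zero_iff_ae_notMem.1 h] with ω h1 h2 h3
    exact h2 (h1.2 h3)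
  · left
    have h' : ∀ᵐ ω ∂P, ω ∈ B := (prob_compl_eq_zero_iff hBm).2 h
    filter_upwards [hae, h'] with ω h1 h2 using h1.1 h2

/-- The span of the constant `1` and of the coboundaries of indicator functions in `L²(P)`. -/
noncomputable def coboundarySpan (P : Measure Ω) [IsFiniteMeasure P] (T : RSpace d → Ω → Ω) :
    Submodule ℝ (Lp ℝ 2 P) :=
  Submodule.span ℝ (insert (indicatorConstLp 2 MeasurableSet.univ (measure_ne_top P _) (1 : ℝ))
    {g | ∃ (A : Set Ω) (y : RSpace d) (hA : MeasurableSet A) (hA' : MeasurableSet (T y ⁻¹' A)),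
      g = indicatorConstLp 2 hA (measure_ne_top P _) (1 : ℝ) -
        indicatorConstLp 2 hA' (measure_ne_top P _) (1 : ℝ)})

/-- The orthogonal complement is trivial. Orthogonality to coboundaries of indicators says that `∫
g` over `A` and over `T y ⁻¹' A` agree, so `g` is invariant under each `T y` and hence constant;
orthogonality to `1` makes the constant zero. -/
theorem IsErgodicSystem.topologicalClosure_coboundarySpan [IsProbabilityMeasure P]
    (hT : IsErgodicSystem P T) : (coboundarySpan P T).topologicalClosure = ⊤ := by
  rw [Submodule.topologicalClosure_eq_top_iff, Submodule.eq_bot_iff]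
  intro g hg
  rw [Submodule.mem_orthogonal] at hg
  obtain ⟨g', hg'm, hg'⟩ := (Lp.memLp g).1
  have hg'meas : Measurable g' := hg'm.measurable
  have hgi : Integrable g P := (Lp.memLp g).integrable one_le_two
  have hg'i : Integrable g' P := hgi.congr hg'
  have hset : ∀ (A : Set Ω) (y : RSpace d), MeasurableSet A →
      ∫ ω in A, g' ω ∂P = ∫ ω in T y ⁻¹' A, g' ω ∂P := by
    intro A y hA
    have hA' := (hT.measurePreserving y).measurable hA
    have := hg _ (Submodule.subset_span (Set.mem_insert_of_mem _ ⟨A, y, hA, hA', rfl⟩))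
    rw [inner_sub_left, L2.inner_indicatorConstLp_one, L2.inner_indicatorConstLp_one,
      sub_eq_zero] at this
    rw [← setIntegral_congr_ae hA (hg'.mono fun _ h _ => h),
      ← setIntegral_congr_ae hA' (hg'.mono fun _ h _ => h)]
    exact this
  have hinv : ∀ y, g' ∘ T y =ᵐ[P] g' := by
    intro y
    have hcomp : Integrable (g' ∘ T y) P :=
      (hT.measurePreserving y).integrable_comp_of_integrable hg'i
    refine Integrable.ae_eq_of_forall_setIntegral_eq _ _ hcomp hg'i fun A hA _ => ?_
    have hA1 : MeasurableSet (T (-y) ⁻¹' A) := (hT.measurePreserving (-y)).measurable hA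
    have hA2 : T y ⁻¹' (T (-y) ⁻¹' A) = A := by
      ext ω
      simp only [Set.mem_preimage, ← hT.map_add, neg_add_cancel, hT.map_zero]
    rw [hset A (-y) hA]
    have hT' := hT.measurePreserving y
    conv_rhs => rw [← hT'.map_eq]
    rw [setIntegral_map hA1 hg'm.aestronglyMeasurable hT'.measurable.aemeasurable, hA2]
    rfl
  obtain ⟨c, hc⟩ := hT.exists_ae_eq_const hg'meas hinv
  have h0 := hg _ (Submodule.subset_span (Set.mem_insert _ _))
  rw [L2.inner_indicatorConstLp_one, setIntegral_univ, integral_congr_ae (hg'.trans hc)] at h0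
  simp only [integral_const, probReal_univ, one_smul] at h0
  refine Lp.ext ((hg'.trans hc).trans ?_)
  rw [h0]
  exact (Lp.coeFn_zero ℝ 2 P).symm

end Invariant

/-! ### The ergodic theorem in weak-* form. -/

section OrbitMean

open scoped ENNReal

variable {d : ℕ} {Ω : Type*}

/-- The rescaled observable `x ↦ g (T_{x/ε} ω)` converges to the constant `c` as `ε → 0+`,
tested against continuous functions with compact support. -/
def HasOrbitMean (T : RSpace d → Ω → Ω) (g : Ω → ℝ) (c : ℝ) (ω : Ω) : Prop :=
  ∀ φ : RSpace d → ℝ, Continuous φ → HasCompactSupport φ →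
    Tendsto (fun ε : ℝ => ∫ x, g (T (ε⁻¹ • x) ω) * φ x) (𝓝[>] 0) (𝓝 (c * ∫ x, φ x))

/-- Elements of `L²(P)` are classes modulo null sets; agreement at almost every time of one orbit is
enough to change representative. -/
theorem HasOrbitMean.congr {T : RSpace d → Ω → Ω} {g g' : Ω → ℝ} {c : ℝ} {ω : Ω}
    (h : HasOrbitMean T g c ω) (hgg' : ∀ᵐ y : RSpace d, g (T y ω) = g' (T y ω)) :
    HasOrbitMean T g' c ω := fun φ hφ hφc => by
  refine (h φ hφ hφc).congr' ?_
  filter_upwards [self_mem_nhdsWithin] with ε hε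
  refine integral_congr_ae ?_
  filter_upwards [ae_orbit_smul (p := fun ω => g ω = g' ω) hgg' hε] with x hx
  rw [hx]

theorem HasOrbitMean.const_smul {T : RSpace d → Ω → Ω} {g : Ω → ℝ} {c : ℝ} {ω : Ω} (a : ℝ)
    (h : HasOrbitMean T g c ω) : HasOrbitMean T (a • g) (a * c) ω := fun φ hφ hφc => by
  rw [mul_assoc]
  refine ((h φ hφ hφc).const_mul a).congr fun ε => ?_
  rw [← integral_const_mul]
  exact integral_congr_ae (ae_of_all _ fun x => by simp only [Pi.smul_apply, smul_eq_mul]; ring)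

theorem hasOrbitMean_one (T : RSpace d → Ω → Ω) (ω : Ω) : HasOrbitMean T (fun _ => 1) 1 ω :=
  fun φ _ _ => by simp

variable [MeasurableSpace Ω] {P : Measure Ω} {T : RSpace d → Ω → Ω}

theorem IsErgodicSystem.integrable_orbit_mul (hT : IsErgodicSystem P T) {g : Ω → ℝ}
    (hg : Measurable g) {C : ℝ} {ω : Ω} (hb : ∀ᵐ y : RSpace d, |g (T y ω)| ≤ C) {ε : ℝ}
    (hε : 0 < ε) {φ : RSpace d → ℝ} (hφ : Integrable φ) :
    Integrable fun x => g (T (ε⁻¹ • x) ω) * φ x :=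
  hφ.bdd_mul (c := C)
    (hg.comp ((hT.measurable_orbit ω).comp (measurable_const_smul ε⁻¹))).aestronglyMeasurable
    (ae_orbit_smul (p := fun ω => |g ω| ≤ C) hb hε)

theorem HasOrbitMean.add (hT : IsErgodicSystem P T) {g₁ g₂ : Ω → ℝ} {c₁ c₂ C₁ C₂ : ℝ} {ω : Ω}
    (hg₁ : Measurable g₁) (hg₂ : Measurable g₂) (hb₁ : ∀ᵐ y : RSpace d, |g₁ (T y ω)| ≤ C₁)
    (hb₂ : ∀ᵐ y : RSpace d, |g₂ (T y ω)| ≤ C₂) (h₁ : HasOrbitMean T g₁ c₁ ω)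
    (h₂ : HasOrbitMean T g₂ c₂ ω) : HasOrbitMean T (g₁ + g₂) (c₁ + c₂) ω := fun φ hφ hφc => by
  rw [add_mul]
  refine ((h₁ φ hφ hφc).add (h₂ φ hφ hφc)).congr' ?_
  filter_upwards [self_mem_nhdsWithin] with ε hε
  have hi := hφ.integrable_of_hasCompactSupport (μ := volume) hφc
  rw [← integral_add (hT.integrable_orbit_mul hg₁ hb₁ hε hi)
    (hT.integrable_orbit_mul hg₂ hb₂ hε hi)]
  exact integral_congr_ae (ae_of_all _ fun x => by simp only [Pi.add_apply]; ring)

/-- For `ε < 1` all these differences vanish outside one ball of radius `R + ‖y‖`, so dominated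
convergence applies. -/
theorem tendsto_integral_abs_sub_translate {φ : RSpace d → ℝ} (hφ : Continuous φ)
    (hφc : HasCompactSupport φ) (y : RSpace d) :
    Tendsto (fun ε : ℝ => ∫ x, |φ x - φ (x - ε • y)|) (𝓝[>] 0) (𝓝 0) := by
  obtain ⟨M, hM⟩ := hφc.exists_bound_of_continuous hφ
  obtain ⟨R, hR⟩ := hφc.isCompact.isBounded.subset_closedBall (0 : RSpace d)
  have hzero : ∀ x, R < ‖x‖ → φ x = 0 := fun x hx => by
    by_contra h
    have := hR (subset_tsupport φ h)
    rw [mem_closedBall_zero_iff] at this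
    linarith
  have key : Tendsto (fun ε : ℝ => ∫ x, |φ x - φ (x - ε • y)|) (𝓝[>] 0)
      (𝓝 (∫ x : RSpace d, (0 : ℝ))) := ?_
  · simpa using key
  refine tendsto_integral_filter_of_dominated_convergence
    ((Metric.closedBall (0 : RSpace d) (R + ‖y‖)).indicator fun _ => 2 * M) ?_ ?_ ?_ ?_
  · refine Eventually.of_forall fun ε => Continuous.aestronglyMeasurable ?_
    fun_prop
  · have h1 : ∀ᶠ ε : ℝ in 𝓝[>] 0, ε < 1 :=
      (eventually_lt_nhds one_pos).filter_mono nhdsWithin_le_nhds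
    filter_upwards [h1, self_mem_nhdsWithin] with ε hε1 hε0
    have hε0' : 0 < ε := hε0
    refine ae_of_all _ fun x => ?_
    rw [Real.norm_of_nonneg (abs_nonneg _)]
    by_cases hx : x ∈ Metric.closedBall (0 : RSpace d) (R + ‖y‖)
    · rw [Set.indicator_of_mem hx]
      have a1 := hM x
      have a2 := hM (x - ε • y)
      rw [Real.norm_eq_abs] at a1 a2
      exact (abs_sub _ _).trans (by linarith)
    · rw [Set.indicator_of_notMem hx]
      rw [mem_closedBall_zero_iff, not_le] at hx
      have hε : ‖ε • y‖ ≤ ‖y‖ := by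
        rw [norm_smul, Real.norm_of_nonneg hε0'.le]
        exact mul_le_of_le_one_left (norm_nonneg _) hε1.le
      have h2 : ‖x‖ - ‖ε • y‖ ≤ ‖x - ε • y‖ := norm_sub_norm_le _ _
      rw [hzero x (by linarith [norm_nonneg y]), hzero (x - ε • y) (by linarith)]
      simp
  · rw [integrable_indicator_iff Metric.isClosed_closedBall.measurableSet]
    exact integrableOn_const measure_closedBall_lt_top.ne
  · refine ae_of_all _ fun x => ?_
    have hc : Continuous fun ε : ℝ => |φ x - φ (x - ε • y)| := by fun_prop
    have := hc.tendsto 0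
    simp only [zero_smul, sub_zero, sub_self, abs_zero] at this
    exact this.mono_left nhdsWithin_le_nhds

/-- Coboundaries average to zero along every orbit. -/
theorem IsErgodicSystem.hasOrbitMean_coboundary (hT : IsErgodicSystem P T) {h : Ω → ℝ}
    (hm : Measurable h) {C : ℝ} (hb : ∀ ω, |h ω| ≤ C) (y : RSpace d) (ω : Ω) :
    HasOrbitMean T (fun ω => h ω - h (T y ω)) 0 ω := fun φ hφ hφc => by
  rw [zero_mul]
  have hlim := (tendsto_integral_abs_sub_translate hφ hφc y).const_mul C
  rw [mul_zero] at hlim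
  refine squeeze_zero_norm' ?_ hlim
  filter_upwards [self_mem_nhdsWithin] with ε hε
  have hε0 : (ε : ℝ) ≠ 0 := (Set.mem_Ioi.1 hε).ne'
  have hi := hφ.integrable_of_hasCompactSupport (μ := volume) hφc
  have hi' : Integrable fun x => φ (x - ε • y) := hi.comp_sub_right (ε • y)
  have hbo : ∀ᵐ z : RSpace d, |h (T z ω)| ≤ C := ae_of_all _ fun z => hb _
  -- Following `T (x/ε)` by `T y` is a shift of `x` by `ε y`. The change of variables transfers the
  -- shift to `φ`, where it disappears in the limit.
  have e1 : ∫ x, h (T y (T (ε⁻¹ • x) ω)) * φ x = ∫ x, h (T (ε⁻¹ • x) ω) * φ (x - ε • y) := by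
    rw [← integral_sub_right_eq_self _ (ε • y)]
    refine integral_congr_ae (ae_of_all _ fun x => ?_)
    simp only [← hT.map_add, smul_sub, smul_smul, inv_mul_cancel₀ hε0, one_smul,
      add_sub_cancel]
  have hi2 : Integrable fun x => h (T y (T (ε⁻¹ • x) ω)) * φ x :=
    hT.integrable_orbit_mul (g := fun ω => h (T y ω))
      (hm.comp (hT.measurePreserving y).measurable) (ae_of_all _ fun z => hb _) hε hi
  have e2 : ∫ x, (h (T (ε⁻¹ • x) ω) - h (T y (T (ε⁻¹ • x) ω))) * φ x =
      ∫ x, h (T (ε⁻¹ • x) ω) * (φ x - φ (x - ε • y)) := by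
    simp only [sub_mul, mul_sub]
    rw [integral_sub (hT.integrable_orbit_mul hm hbo hε hi) hi2, e1,
      integral_sub (hT.integrable_orbit_mul hm hbo hε hi) (hT.integrable_orbit_mul hm hbo hε hi')]
  rw [e2, ← integral_const_mul]
  refine norm_integral_le_of_norm_le ((hi.sub hi').norm.const_mul C) (ae_of_all _ fun x => ?_)
  rw [norm_mul]
  exact mul_le_mul_of_nonneg_right (hb _) (norm_nonneg _)

/-- Essential boundedness is carried through the induction because additivity of the orbit integrals
needs integrability along the orbit. -/
theorem IsErgodicSystem.hasOrbitMean_of_mem_coboundarySpan [IsProbabilityMeasure P]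
    (hT : IsErgodicSystem P T) {g : Lp ℝ 2 P} (hg : g ∈ coboundarySpan P T) :
    (∃ C : ℝ, ∀ᵐ ω ∂P, |g ω| ≤ C) ∧ ∀ᵐ ω ∂P, HasOrbitMean T g (∫ ω', g ω' ∂P) ω := by
  induction hg using Submodule.span_induction with
  | mem g hg =>
    rcases hg with rfl | ⟨A, y, hA, hA', rfl⟩
    · have h1 : (indicatorConstLp 2 MeasurableSet.univ (measure_ne_top P _) (1 : ℝ) : Ω → ℝ) =ᵐ[P]
          fun _ => 1 := by
        refine indicatorConstLp_coeFn.trans (ae_of_all _ fun ω => ?_)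
        simp
      refine ⟨⟨1, h1.mono fun ω h => by rw [h, abs_one]⟩, ?_⟩
      rw [integral_congr_ae h1]
      filter_upwards [hT.ae_orbit h1] with ω hω
      simpa using (hasOrbitMean_one T ω).congr (hω.mono fun _ h => h.symm)
    · set h : Ω → ℝ := A.indicator fun _ => 1 with hdef
      have hm : Measurable h := measurable_const.indicator hA
      have hb : ∀ ω, |h ω| ≤ 1 := fun ω => by
        by_cases hω : ω ∈ A <;> simp [hdef, hω]
      have h1 : ((indicatorConstLp 2 hA (measure_ne_top P _) (1 : ℝ) -
          indicatorConstLp 2 hA' (measure_ne_top P _) (1 : ℝ) : Lp ℝ 2 P) : Ω → ℝ) =ᵐ[P]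
          fun ω => h ω - h (T y ω) := by
        filter_upwards [Lp.coeFn_sub (indicatorConstLp 2 hA (measure_ne_top P _) (1 : ℝ))
          (indicatorConstLp 2 hA' (measure_ne_top P _) (1 : ℝ)),
          indicatorConstLp_coeFn (p := 2) (hs := hA) (hμs := measure_ne_top P _) (c := (1 : ℝ)),
          indicatorConstLp_coeFn (p := 2) (hs := hA') (hμs := measure_ne_top P _) (c := (1 : ℝ))]
          with ω a1 a2 a3
        rw [a1, Pi.sub_apply, a2, a3]
        rfl
      have hi : Integrable h P := Integrable.of_bound hm.aestronglyMeasurable 1 (ae_of_all _ hb)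
      have h0 : ∫ ω, h ω - h (T y ω) ∂P = 0 := by
        have hmp := hT.measurePreserving y
        have e : ∫ ω, h (T y ω) ∂P = ∫ ω, h ω ∂P := by
          conv_rhs => rw [← hmp.map_eq]
          rw [integral_map hmp.measurable.aemeasurable hm.aestronglyMeasurable]
        have hi' : Integrable (fun ω => h (T y ω)) P := hmp.integrable_comp_of_integrable hi
        rw [integral_sub hi hi', e, sub_self]
      refine ⟨⟨2, h1.mono fun ω e => ?_⟩, ?_⟩
      · rw [e]
        exact (abs_sub _ _).trans (by linarith [hb ω, hb (T y ω)])
      · rw [integral_congr_ae h1, h0]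
        filter_upwards [hT.ae_orbit h1] with ω hω
        exact (hT.hasOrbitMean_coboundary hm hb y ω).congr (hω.mono fun _ h => h.symm)
  | zero =>
    have h1 := Lp.coeFn_zero ℝ 2 P
    refine ⟨⟨0, h1.mono fun ω e => by rw [e, Pi.zero_apply, abs_zero]⟩, ?_⟩
    rw [integral_congr_ae h1]
    filter_upwards [hT.ae_orbit h1] with ω hω
    refine HasOrbitMean.congr (g := 0) (fun φ _ _ => ?_) (hω.mono fun _ h => h.symm)
    simp
  | add g₁ g₂ _ _ h₁ h₂ =>
    obtain ⟨⟨C₁, hC₁⟩, h₁⟩ := h₁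
    obtain ⟨⟨C₂, hC₂⟩, h₂⟩ := h₂
    have hadd := Lp.coeFn_add g₁ g₂
    refine ⟨⟨C₁ + C₂, ?_⟩, ?_⟩
    · filter_upwards [hadd, hC₁, hC₂] with ω e a b
      rw [e]
      exact (abs_add_le _ _).trans (add_le_add a b)
    · have e : ∫ ω, (g₁ + g₂ : Lp ℝ 2 P) ω ∂P = (∫ ω, g₁ ω ∂P) + ∫ ω, g₂ ω ∂P := by
        rw [integral_congr_ae hadd]
        exact integral_add ((Lp.memLp g₁).integrable one_le_two)
          ((Lp.memLp g₂).integrable one_le_two)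
      rw [e]
      filter_upwards [h₁, h₂, hT.ae_orbit hC₁, hT.ae_orbit hC₂, hT.ae_orbit hadd]
        with ω a₁ a₂ b₁ b₂ a
      exact (HasOrbitMean.add hT (Lp.stronglyMeasurable g₁).measurable
        (Lp.stronglyMeasurable g₂).measurable b₁ b₂ a₁ a₂).congr (a.mono fun _ h => h.symm)
  | smul c g _ h =>
    obtain ⟨⟨C, hC⟩, h⟩ := h
    have hsm := Lp.coeFn_smul c g
    refine ⟨⟨|c| * C, ?_⟩, ?_⟩
    · filter_upwards [hsm, hC] with ω e a
      rw [e, Pi.smul_apply, smul_eq_mul, abs_mul]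
      gcongr
    · have e : ∫ ω, (c • g : Lp ℝ 2 P) ω ∂P = c * ∫ ω, g ω ∂P := by
        rw [integral_congr_ae hsm, ← integral_const_mul]
        rfl
      rw [e]
      filter_upwards [h, hT.ae_orbit hsm] with ω a b
      exact (a.const_smul c).congr (b.mono fun _ h => h.symm)

theorem lintegral_comp_inv_smul {F : RSpace d → ℝ≥0∞} (hF : Measurable F) {ε : ℝ} (hε : 0 < ε) :
    ∫⁻ x, F (ε⁻¹ • x) = ENNReal.ofReal (ε ^ d) * ∫⁻ x, F x := by
  rw [← lintegral_map hF (measurable_const_smul _),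
    Measure.map_addHaar_smul volume (inv_pos.2 hε).ne', lintegral_smul_measure,
    finrank_euclideanSpace, Fintype.card_fin, inv_pow, inv_inv, abs_of_pos (by positivity),
    smul_eq_mul]

/-- Off the maximal set, the rescaled observable is small as a functional on compactly
supported bounded functions, uniformly in the scale. -/
theorem IsErgodicSystem.abs_integral_orbit_mul_le (hT : IsErgodicSystem P T) {f : Ω → ℝ}
    (hf : Measurable f) {c : ℝ} (hc : 0 ≤ c) {ω : Ω}
    (hω : ω ∉ ⋃ N, maximalSet T (fun ω => ‖f ω‖ₑ) (ENNReal.ofReal c) N)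
    {φ : RSpace d → ℝ} {M R : ℝ} (hM : ∀ x, ‖φ x‖ ≤ M) (hR : ∀ x, R < ‖x‖ → φ x = 0)
    {ε : ℝ} (hε : 0 < ε) (hεR : ε ≤ R) :
    |∫ x, f (T (ε⁻¹ • x) ω) * φ x| ≤
      M * (2 * R) ^ d * volume.real (Metric.closedBall (0 : RSpace d) 1) * c := by
  have hM0 : 0 ≤ M := (norm_nonneg _).trans (hM 0)
  have hR0 : 0 < R := hε.trans_le hεR
  -- The ball of radius `n + 1` contains the rescaled ball of radius `R / ε`. The condition `ε ≤ R`
  -- gives `n + 1 ≤ 2 R / ε`, so rescaling its volume costs at most `(2 R) ^ d`.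
  set n := ⌊R / ε⌋₊
  have hn1 : R / ε ≤ n + 1 := (Nat.lt_floor_add_one _).le
  have hn2 : (n : ℝ) + 1 ≤ 2 * R / ε := by
    have h1 : (n : ℝ) ≤ R / ε := Nat.floor_le (by positivity)
    have h2 : 1 ≤ R / ε := (one_le_div hε).2 hεR
    rw [mul_div_assoc]
    linarith
  have hav : ∫⁻ y in Metric.closedBall (0 : RSpace d) ((n : ℝ) + 1), ‖f (T y ω)‖ₑ ≤
      ENNReal.ofReal c * volume (Metric.closedBall (0 : RSpace d) ((n : ℝ) + 1)) := by
    by_contra! h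
    exact hω (Set.mem_iUnion.2 ⟨n, n, le_rfl, h.le⟩)
  set F : RSpace d → ℝ≥0∞ := (Metric.closedBall (0 : RSpace d) ((n : ℝ) + 1)).indicator
    fun y => ‖f (T y ω)‖ₑ with hF
  have hFm : Measurable F :=
    (hf.enorm.comp (hT.measurable_orbit ω)).indicator Metric.isClosed_closedBall.measurableSet
  have hpt : ∀ x, ‖f (T (ε⁻¹ • x) ω) * φ x‖ₑ ≤ ENNReal.ofReal M * F (ε⁻¹ • x) := by
    intro x
    rcases lt_or_ge R ‖x‖ with hx | hx
    · simp [hR x hx]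
    · have hmem : ε⁻¹ • x ∈ Metric.closedBall (0 : RSpace d) ((n : ℝ) + 1) := by
        rw [mem_closedBall_zero_iff, norm_smul, norm_inv, Real.norm_of_nonneg hε.le,
          ← div_eq_inv_mul]
        exact (div_le_div_of_nonneg_right hx hε.le).trans hn1
      rw [hF, Set.indicator_of_mem hmem, enorm_mul, mul_comm]
      gcongr
      rw [← ofReal_norm]
      exact ENNReal.ofReal_le_ofReal (hM x)
  have hvol : volume (Metric.closedBall (0 : RSpace d) ((n : ℝ) + 1)) =
      ENNReal.ofReal (((n : ℝ) + 1) ^ d) * volume (Metric.closedBall (0 : RSpace d) 1) := by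
    rw [Measure.addHaar_closedBall' volume _ (by positivity), finrank_euclideanSpace,
      Fintype.card_fin]
  have hV : volume (Metric.closedBall (0 : RSpace d) 1) =
      ENNReal.ofReal (volume.real (Metric.closedBall (0 : RSpace d) 1)) :=
    (ENNReal.ofReal_toReal measure_closedBall_lt_top.ne).symm
  have hlint : ∫⁻ x, ‖f (T (ε⁻¹ • x) ω) * φ x‖ₑ ≤ ENNReal.ofReal
      (M * (ε ^ d * (c * (((n : ℝ) + 1) ^ d *
        volume.real (Metric.closedBall (0 : RSpace d) 1))))) := by
    calc ∫⁻ x, ‖f (T (ε⁻¹ • x) ω) * φ x‖ₑ ≤ ∫⁻ x, ENNReal.ofReal M * F (ε⁻¹ • x) :=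
          lintegral_mono hpt
      _ = ENNReal.ofReal M * (ENNReal.ofReal (ε ^ d) * ∫⁻ x, F x) := by
          have hFm' : Measurable fun x => F (ε⁻¹ • x) := hFm.comp (measurable_const_smul _)
          rw [lintegral_const_mul _ hFm', lintegral_comp_inv_smul hFm hε]
      _ ≤ ENNReal.ofReal M * (ENNReal.ofReal (ε ^ d) * (ENNReal.ofReal c *
          (ENNReal.ofReal (((n : ℝ) + 1) ^ d) *
            ENNReal.ofReal (volume.real (Metric.closedBall (0 : RSpace d) 1))))) := by
          rw [← hV, ← hvol, hF, lintegral_indicator Metric.isClosed_closedBall.measurableSet]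
          gcongr
      _ = _ := by
          rw [← ENNReal.ofReal_mul (by positivity), ← ENNReal.ofReal_mul hc,
            ← ENNReal.ofReal_mul (by positivity), ← ENNReal.ofReal_mul hM0]
  have h1 : |∫ x, f (T (ε⁻¹ • x) ω) * φ x| ≤
      (∫⁻ x, ‖f (T (ε⁻¹ • x) ω) * φ x‖ₑ).toReal := by
    have := norm_integral_le_lintegral_norm (μ := volume) fun x => f (T (ε⁻¹ • x) ω) * φ x
    simp only [ofReal_norm] at this
    exact this
  refine (h1.trans (ENNReal.toReal_le_of_le_ofReal (by positivity) hlint)).trans ?_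
  have h2 : ε ^ d * ((n : ℝ) + 1) ^ d ≤ (2 * R) ^ d := by
    rw [← mul_pow]
    refine pow_le_pow_left₀ (by positivity) ?_ d
    calc ε * ((n : ℝ) + 1) ≤ ε * (2 * R / ε) := by gcongr
      _ = 2 * R := mul_div_cancel₀ _ hε.ne'
  calc _ = M * (ε ^ d * ((n : ℝ) + 1) ^ d) *
        volume.real (Metric.closedBall (0 : RSpace d) 1) * c := by ring
    _ ≤ _ := by gcongr

/-- The ergodic theorem for bounded observables. -/
theorem IsErgodicSystem.ae_hasOrbitMean [IsProbabilityMeasure P] (hT : IsErgodicSystem P T)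
    {g : Ω → ℝ} (hg : Measurable g) {C : ℝ} (hb : ∀ᵐ ω ∂P, |g ω| ≤ C) :
    ∀ᵐ ω ∂P, HasOrbitMean T g (∫ ω', g ω' ∂P) ω := by
  have hg2 : MemLp g 2 P := MemLp.of_bound hg.aestronglyMeasurable C hb
  -- One factor `(1/2) ^ k` becomes the threshold of the maximal set and the other its probability
  -- bound; `10 ^ d` cancels the constant of the maximal inequality.
  have hdense : ∀ k : ℕ, ∃ G ∈ coboundarySpan P T,
      ‖G - hg2.toLp g‖ ≤ (1 / 2) ^ k * (1 / 2) ^ k / 10 ^ d := by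
    intro k
    have h1 : hg2.toLp g ∈ (coboundarySpan P T).topologicalClosure := by
      rw [hT.topologicalClosure_coboundarySpan]
      trivial
    obtain ⟨G, hG, hG'⟩ := Metric.mem_closure_iff.1 h1 ((1 / 2) ^ k * (1 / 2) ^ k / 10 ^ d)
      (by positivity)
    refine ⟨G, hG, ?_⟩
    rw [dist_comm, dist_eq_norm] at hG'
    exact hG'.le
  choose G hGmem hGn using hdense
  have hGm : ∀ k, Measurable (G k) := fun k => (Lp.stronglyMeasurable (G k)).measurable
  have hfm : ∀ k, Measurable fun ω => g ω - G k ω := fun k => hg.sub (hGm k)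
  have hL1 : ∀ k, ∫⁻ ω, ‖g ω - G k ω‖ₑ ∂P ≤
      ENNReal.ofReal ((1 / 2) ^ k * (1 / 2) ^ k / 10 ^ d) := by
    intro k
    calc ∫⁻ ω, ‖g ω - G k ω‖ₑ ∂P = eLpNorm (fun ω => g ω - G k ω) 1 P := by
          rw [eLpNorm_one_eq_lintegral_enorm]
      _ ≤ eLpNorm (fun ω => g ω - G k ω) 2 P :=
          eLpNorm_le_eLpNorm_of_exponent_le one_le_two (hfm k).aestronglyMeasurable
      _ = eLpNorm (G k - hg2.toLp g : Lp ℝ 2 P) 2 P := by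
          rw [← eLpNorm_neg]
          refine eLpNorm_congr_ae ?_
          filter_upwards [Lp.coeFn_sub (G k) (hg2.toLp g), hg2.coeFn_toLp] with ω a b
          rw [a, Pi.sub_apply, b, Pi.neg_apply, neg_sub]
      _ = ENNReal.ofReal ‖G k - hg2.toLp g‖ := by
          rw [Lp.norm_def, ENNReal.ofReal_toReal (Lp.eLpNorm_ne_top _)]
      _ ≤ _ := ENNReal.ofReal_le_ofReal (hGn k)
  have hprob : ∀ k, P (⋃ N, maximalSet T (fun ω => ‖g ω - G k ω‖ₑ)
      (ENNReal.ofReal ((1 / 2) ^ k)) N) ≤ ENNReal.ofReal ((1 / 2) ^ k) := by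
    intro k
    have h1 := mul_measure_iUnion_maximalSet_le hT (hfm k).enorm (ENNReal.ofReal ((1 / 2) ^ k))
    have h2 : (10 : ℝ≥0∞) ^ d * ∫⁻ ω, ‖g ω - G k ω‖ₑ ∂P ≤
        ENNReal.ofReal ((1 / 2) ^ k) * ENNReal.ofReal ((1 / 2) ^ k) := by
      calc (10 : ℝ≥0∞) ^ d * ∫⁻ ω, ‖g ω - G k ω‖ₑ ∂P
          ≤ ENNReal.ofReal (10 ^ d) * ENNReal.ofReal ((1 / 2) ^ k * (1 / 2) ^ k / 10 ^ d) := by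
            rw [ENNReal.ofReal_pow (by norm_num)]
            gcongr
            · norm_num
            · exact hL1 k
        _ = _ := by
            rw [← ENNReal.ofReal_mul (by positivity), ← ENNReal.ofReal_mul (by positivity)]
            congr 1
            field_simp
    exact (ENNReal.mul_le_mul_iff_right (ENNReal.ofReal_pos.2 (by positivity)).ne'
      ENNReal.ofReal_ne_top).1 (h1.trans h2)
  -- Input for Borel–Cantelli: almost every `ω` lies in only finitely many of the exceptional
  -- maximal sets.
  have hsum : ∑' k, P (⋃ N, maximalSet T (fun ω => ‖g ω - G k ω‖ₑ)
      (ENNReal.ofReal ((1 / 2) ^ k)) N) ≠ ⊤ := by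
    refine ne_top_of_le_ne_top ?_ (ENNReal.tsum_le_tsum hprob)
    rw [← ENNReal.ofReal_tsum_of_nonneg (fun k => by positivity) summable_geometric_two]
    exact ENNReal.ofReal_ne_top
  have hmean : Tendsto (fun k => ∫ ω, G k ω ∂P) atTop (𝓝 (∫ ω, g ω ∂P)) := by
    rw [tendsto_iff_norm_sub_tendsto_zero]
    have hp : Tendsto (fun k : ℕ => ((1 : ℝ) / 2) ^ k * (1 / 2) ^ k / 10 ^ d) atTop (𝓝 0) := by
      have := tendsto_pow_atTop_nhds_zero_of_lt_one (by norm_num : (0 : ℝ) ≤ 1 / 2) (by norm_num)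
      simpa using (this.mul this).div_const (10 ^ d)
    refine squeeze_zero (fun _ => norm_nonneg _) (fun k => ?_) hp
    rw [norm_sub_rev, ← integral_sub (hg2.integrable one_le_two)
      ((Lp.memLp (G k)).integrable one_le_two)]
    refine (norm_integral_le_lintegral_norm _).trans
      (ENNReal.toReal_le_of_le_ofReal (by positivity) ?_)
    simpa only [ofReal_norm] using hL1 k
  have hG := fun k => hT.hasOrbitMean_of_mem_coboundarySpan (hGmem k)
  choose D hD using fun k => (hG k).1
  filter_upwards [ae_eventually_notMem hsum, ae_all_iff.2 fun k => (hG k).2,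
    ae_all_iff.2 fun k => hT.ae_orbit (hD k), hT.ae_orbit hb] with ω h1 h2 h3 h4
  intro φ hφ hφc
  obtain ⟨M, hM⟩ := hφc.exists_bound_of_continuous hφ
  obtain ⟨R', hR'⟩ := hφc.isCompact.isBounded.subset_closedBall (0 : RSpace d)
  set R := max R' 1
  have hR1 : 0 < R := one_pos.trans_le (le_max_right _ _)
  have hR : ∀ x, R < ‖x‖ → φ x = 0 := fun x hx => by
    by_contra h
    have := hR' (subset_tsupport φ h)
    rw [mem_closedBall_zero_iff] at this
    exact absurd (this.trans (le_max_left R' 1)) (not_le.2 hx)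
  have hi := hφ.integrable_of_hasCompactSupport (μ := volume) hφc
  set Q := M * (2 * R) ^ d * volume.real (Metric.closedBall (0 : RSpace d) 1)
  have hpow := tendsto_pow_atTop_nhds_zero_of_lt_one (by norm_num : (0 : ℝ) ≤ 1 / 2) (by norm_num)
  rw [Metric.tendsto_nhds]
  intro η hη
  have k1 : ∀ᶠ k : ℕ in atTop, Q * (1 / 2) ^ k < η / 3 := by
    have := hpow.const_mul Q
    rw [mul_zero] at this
    exact this.eventually (eventually_lt_nhds (by positivity))
  have k2 : ∀ᶠ k : ℕ in atTop,
      |(∫ ω', G k ω' ∂P) * (∫ x, φ x) - (∫ ω', g ω' ∂P) * ∫ x, φ x| < η / 3 := by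
    have := Metric.tendsto_nhds.1 (hmean.mul_const (∫ x, φ x)) (η / 3) (by positivity)
    simpa only [Real.dist_eq] using this
  -- The index `k` depends on `ω`, `φ` and `η` but not on `ε`, since the maximal estimate is uniform
  -- over `ε ≤ R`.
  obtain ⟨k, hk1, hk2, hk3⟩ := (k1.and (k2.and h1)).exists
  have hk4 := Metric.tendsto_nhds.1 (h2 k φ hφ hφc) (η / 3) (by positivity)
  have hεR : ∀ᶠ ε : ℝ in 𝓝[>] 0, ε ≤ R :=
    (eventually_le_nhds hR1).filter_mono nhdsWithin_le_nhds
  filter_upwards [hk4, hεR, self_mem_nhdsWithin] with ε a1 a2 a3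
  have a4 := hT.abs_integral_orbit_mul_le (hfm k) (by positivity) hk3 hM hR a3 a2
  have e : ∫ x, (g (T (ε⁻¹ • x) ω) - G k (T (ε⁻¹ • x) ω)) * φ x =
      (∫ x, g (T (ε⁻¹ • x) ω) * φ x) - ∫ x, G k (T (ε⁻¹ • x) ω) * φ x := by
    rw [← integral_sub (hT.integrable_orbit_mul hg h4 a3 hi)
      (hT.integrable_orbit_mul (hGm k) (h3 k) a3 hi)]
    exact integral_congr_ae (ae_of_all _ fun x => by ring)
  rw [e] at a4
  rw [Real.dist_eq] at a1 ⊢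
  have b4 := abs_le.1 a4
  have b1 := abs_lt.1 a1
  have b2 := abs_lt.1 hk2
  rw [abs_lt]
  constructor <;> linarith

/-- Weak-* convergence of bounded functions can be tested on continuous functions with compact
support. -/
theorem tendsto_integral_mul_of_hasCompactSupport {X ι : Type*} [TopologicalSpace X]
    [MeasurableSpace X] [BorelSpace X] [NormalSpace X] [R1Space X] [WeaklyLocallyCompactSpace X]
    {μ : Measure X}
    [μ.Regular] {l : Filter ι} {h : ι → X → ℝ} {h₀ : X → ℝ} {C C₀ : ℝ}
    (hm : ∀ᶠ i in l, AEStronglyMeasurable (h i) μ) (hb : ∀ᶠ i in l, ∀ᵐ x ∂μ, |h i x| ≤ C)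
    (hm₀ : AEStronglyMeasurable h₀ μ) (hb₀ : ∀ᵐ x ∂μ, |h₀ x| ≤ C₀)
    (hlim : ∀ φ : X → ℝ, Continuous φ → HasCompactSupport φ →
      Tendsto (fun i => ∫ x, h i x * φ x ∂μ) l (𝓝 (∫ x, h₀ x * φ x ∂μ)))
    {φ : X → ℝ} (hφ : Integrable φ μ) :
    Tendsto (fun i => ∫ x, h i x * φ x ∂μ) l (𝓝 (∫ x, h₀ x * φ x ∂μ)) := by
  have approx : ∀ {k : X → ℝ} {B : ℝ} {ψ : X → ℝ}, AEStronglyMeasurable k μ →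
      (∀ᵐ x ∂μ, |k x| ≤ B) → Integrable ψ μ →
      |(∫ x, k x * φ x ∂μ) - ∫ x, k x * ψ x ∂μ| ≤ |B| * ∫ x, ‖φ x - ψ x‖ ∂μ := by
    intro k B ψ hk hkb hψ
    rw [← integral_sub (hφ.bdd_mul hk hkb) (hψ.bdd_mul hk hkb), ← integral_const_mul]
    refine norm_integral_le_of_norm_le (f := fun x => k x * φ x - k x * ψ x)
      ((hφ.sub hψ).norm.const_mul _) ?_
    filter_upwards [hkb] with x hx
    rw [← mul_sub, norm_mul]
    exact mul_le_mul_of_nonneg_right (hx.trans (le_abs_self B)) (norm_nonneg _)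
  rw [Metric.tendsto_nhds]
  intro η hη
  have hη' : 0 < η / (2 * (|C| + |C₀| + 1)) := by positivity
  obtain ⟨ψ, hψc, hψ, hψcont, hψi⟩ := hφ.exists_hasCompactSupport_integral_sub_le hη'
  have h1 := Metric.tendsto_nhds.1 (hlim ψ hψcont hψc) (η / 2) (by positivity)
  filter_upwards [h1, hm, hb] with i a1 hmi hbi
  have e1 := approx hmi hbi hψi
  have e2 := approx hm₀ hb₀ hψi
  set I := ∫ x, ‖φ x - ψ x‖ ∂μ
  have hI : 0 ≤ I := integral_nonneg fun _ => norm_nonneg _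
  have e3 : (|C| + |C₀|) * I < η / 2 := by
    calc (|C| + |C₀|) * I ≤ (|C| + |C₀|) * (η / (2 * (|C| + |C₀| + 1))) := by gcongr
      _ < (|C| + |C₀| + 1) * (η / (2 * (|C| + |C₀| + 1))) :=
        mul_lt_mul_of_pos_right (by linarith) hη'
      _ = η / 2 := by field_simp
  rw [Real.dist_eq] at a1 ⊢
  have b1 := abs_lt.1 a1
  have b2 := abs_le.1 e1
  have b3 := abs_le.1 e2
  rw [abs_lt]
  constructor <;> linarith

/-- For bounded observables, the test functions may be arbitrary integrable functions. -/
theorem HasOrbitMean.tendsto_integral (hT : IsErgodicSystem P T) {g : Ω → ℝ} (hg : Measurable g)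
    {c C : ℝ} {ω : Ω} (hb : ∀ᵐ y : RSpace d, |g (T y ω)| ≤ C) (h : HasOrbitMean T g c ω)
    {φ : RSpace d → ℝ} (hφ : Integrable φ) :
    Tendsto (fun ε : ℝ => ∫ x, g (T (ε⁻¹ • x) ω) * φ x) (𝓝[>] 0) (𝓝 (∫ x, c * φ x)) := by
  refine tendsto_integral_mul_of_hasCompactSupport (h := fun (ε : ℝ) x => g (T (ε⁻¹ • x) ω))
    (h₀ := fun _ => c) (C := C) (Eventually.of_forall fun ε => ?_) ?_
    aestronglyMeasurable_const (ae_of_all _ fun _ => le_rfl) (fun ψ hψ hψc => ?_) hφ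
  · exact (hg.comp ((hT.measurable_orbit ω).comp
      (measurable_const_smul ε⁻¹))).aestronglyMeasurable
  · filter_upwards [self_mem_nhdsWithin] with ε hε
    exact ae_orbit_smul (p := fun ω => |g ω| ≤ C) hb hε
  · simpa only [integral_const_mul] using h ψ hψ hψc

end OrbitMean

/-! ### Tensor products: weak-* limits and Stone–Weierstrass. -/

section Product

variable {d : ℕ}

/-- Tensor products of weak-* convergent bounded families converge weak-*. -/
theorem tendsto_integral_mul_mul {ι : Type*} {l : Filter ι} [l.IsCountablyGenerated]
    {a b : ι → RSpace d → ℝ} {A B c₁ c₂ : ℝ}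
    (ham : ∀ᶠ i in l, AEStronglyMeasurable (a i)) (hbm : ∀ᶠ i in l, AEStronglyMeasurable (b i))
    (hab : ∀ᶠ i in l, ∀ᵐ x, |a i x| ≤ A) (hbb : ∀ᶠ i in l, ∀ᵐ x, |b i x| ≤ B)
    (ha : ∀ φ : RSpace d → ℝ, Integrable φ →
      Tendsto (fun i => ∫ x, a i x * φ x) l (𝓝 (∫ x, c₁ * φ x)))
    (hb : ∀ φ : RSpace d → ℝ, Integrable φ →
      Tendsto (fun i => ∫ x, b i x * φ x) l (𝓝 (∫ x, c₂ * φ x)))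
    {Φ : RSpace d × RSpace d → ℝ} (hΦ : Integrable Φ) :
    Tendsto (fun i => ∫ p, a i p.1 * b i p.2 * Φ p) l (𝓝 (∫ p, c₁ * c₂ * Φ p)) := by
  have hΦ' : Integrable Φ (volume.prod volume) := hΦ
  set J : RSpace d → ℝ := fun x => ∫ y, c₂ * Φ (x, y) with hJ
  have hJi : Integrable J := (hΦ'.const_mul c₂).integral_prod_left
  set K : ι → RSpace d → ℝ := fun i x => ∫ y, b i y * Φ (x, y) with hK
  have hbΦ : ∀ᶠ i in l, Integrable (fun p => b i p.2 * Φ p) (volume.prod volume) := by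
    filter_upwards [hbm, hbb] with i hm hbd
    exact hΦ'.bdd_mul (hm.comp_quasiMeasurePreserving Measure.quasiMeasurePreserving_snd)
      (Measure.quasiMeasurePreserving_snd.ae hbd)
  have hKi : ∀ᶠ i in l, Integrable (K i) := hbΦ.mono fun i hi => hi.integral_prod_left
  -- For almost every `x` the inner integral against `b i` converges, and domination upgrades this
  -- to convergence in `L¹`. A bounded weak-* convergent family can then be paired with a strongly
  -- convergent one.
  have hdiff : Tendsto (fun i => ∫ x, |K i x - J x|) l (𝓝 0) := by
    have key : Tendsto (fun i => ∫ x, |K i x - J x|) l (𝓝 (∫ x : RSpace d, (0 : ℝ))) := by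
      refine tendsto_integral_filter_of_dominated_convergence
        (fun x => (B + |c₂|) * ∫ y, ‖Φ (x, y)‖) ?_ ?_
        (hΦ'.norm.integral_prod_left.const_mul _) ?_
      · filter_upwards [hKi] with i hi using (hi.sub hJi).abs.aestronglyMeasurable
      · filter_upwards [hbb] with i hbd
        filter_upwards [hΦ'.prod_right_ae] with x hx
        rw [Real.norm_of_nonneg (abs_nonneg _), add_mul]
        refine (abs_sub _ _).trans (add_le_add ?_ ?_)
        · rw [← integral_const_mul]
          refine norm_integral_le_of_norm_le (f := fun y => b i y * Φ (x, y))
            (hx.norm.const_mul B) ?_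
          filter_upwards [hbd] with y hy
          rw [norm_mul]
          exact mul_le_mul_of_nonneg_right hy (norm_nonneg _)
        · rw [← integral_const_mul]
          refine norm_integral_le_of_norm_le (f := fun y => c₂ * Φ (x, y))
            (hx.norm.const_mul |c₂|) (ae_of_all _ fun y => ?_)
          rw [norm_mul, Real.norm_eq_abs c₂]
      · filter_upwards [hΦ'.prod_right_ae] with x hx
        have := ((hb _ hx).sub_const (J x)).abs
        rwa [sub_self, abs_zero] at this
    simpa using key
  have hsplit : ∀ᶠ i in l, |(∫ p, a i p.1 * b i p.2 * Φ p) - ∫ x, a i x * J x| ≤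
      |A| * ∫ x, |K i x - J x| := by
    filter_upwards [ham, hab, hbΦ, hKi] with i hm hbd hbi hki
    have e1 : ∫ p, a i p.1 * b i p.2 * Φ p = ∫ x, a i x * K i x := by
      have hi : Integrable (fun p : RSpace d × RSpace d => a i p.1 * (b i p.2 * Φ p))
          (volume.prod volume) :=
        hbi.bdd_mul (hm.comp_quasiMeasurePreserving Measure.quasiMeasurePreserving_fst)
          (Measure.quasiMeasurePreserving_fst.ae hbd)
      have h2 := integral_prod _ hi
      simp only [integral_const_mul] at h2
      simp only [mul_assoc]
      exact h2
    rw [e1, ← integral_sub (hki.bdd_mul hm hbd) (hJi.bdd_mul hm hbd), ← integral_const_mul]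
    refine norm_integral_le_of_norm_le (f := fun x => a i x * K i x - a i x * J x)
      ((hki.sub hJi).abs.const_mul _) ?_
    filter_upwards [hbd] with x hx
    rw [← mul_sub, norm_mul]
    exact mul_le_mul_of_nonneg_right (hx.trans (le_abs_self A)) (norm_nonneg _)
  have hlim : Tendsto (fun i => (∫ p, a i p.1 * b i p.2 * Φ p) - ∫ x, a i x * J x) l (𝓝 0) := by
    refine squeeze_zero_norm' hsplit ?_
    simpa using hdiff.const_mul |A|
  have e2 : ∫ x, c₁ * J x = ∫ p, c₁ * c₂ * Φ p := by
    have h2 := integral_prod _ (hΦ'.const_mul (c₁ * c₂))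
    refine Eq.trans ?_ h2.symm
    simp only [hJ, integral_const_mul, mul_assoc]
  have := hlim.add (ha J hJi)
  rw [zero_add, e2] at this
  exact this.congr fun i => by ring

end Product

/-- The span of the products `c(x) e(y)` is dense in `C(X × X)`. -/
theorem dense_span_mul_continuousMap {X : Type*} [MetricSpace X] [CompactSpace X] :
    (Submodule.span ℝ
    {F : C(X × X, ℝ) | ∃ c e : C(X, ℝ), ∀ q, F q = c q.1 * e q.2}).topologicalClosure = ⊤ := by
  -- The product functions are closed under multiplication and contain `1`, so the algebra they
  -- generate is merely their linear span.
  set S : Submonoid C(X × X, ℝ) :=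
    { carrier := {F | ∃ c e : C(X, ℝ), ∀ q, F q = c q.1 * e q.2}
      one_mem' := ⟨1, 1, fun q => by simp⟩
      mul_mem' := by
        rintro F G ⟨c, e, h⟩ ⟨c', e', h'⟩
        refine ⟨c * c', e * e', fun q => ?_⟩
        simp only [ContinuousMap.mul_apply, h, h']
        ring } with hS
  have hsep : (Algebra.adjoin ℝ (S : Set C(X × X, ℝ))).SeparatesPoints := by
    rintro ⟨x₁, x₂⟩ ⟨y₁, y₂⟩ hne
    by_cases h : x₁ = y₁
    · have h2 : x₂ ≠ y₂ := fun h2 => hne (by rw [h, h2])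
      let F : C(X × X, ℝ) := ⟨fun q => dist q.2 y₂, by fun_prop⟩
      refine ⟨F, ⟨F, Algebra.subset_adjoin ⟨1, ⟨fun x => dist x y₂, by fun_prop⟩,
        fun q => by simp [F]⟩, rfl⟩, ?_⟩
      simpa [F] using h2
    · let F : C(X × X, ℝ) := ⟨fun q => dist q.1 y₁, by fun_prop⟩
      refine ⟨F, ⟨F, Algebra.subset_adjoin ⟨⟨fun x => dist x y₁, by fun_prop⟩, 1,
        fun q => by simp [F]⟩, rfl⟩, ?_⟩
      simpa [F] using h
  have htop := ContinuousMap.subalgebra_topologicalClosure_eq_top_of_separatesPoints _ hsep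
  have hspan : Subalgebra.toSubmodule (Algebra.adjoin ℝ (S : Set C(X × X, ℝ))) =
      Submodule.span ℝ (S : Set C(X × X, ℝ)) := by
    rw [Algebra.adjoin_eq_span, Submonoid.closure_eq]
  change (Submodule.span ℝ (S : Set C(X × X, ℝ))).topologicalClosure = ⊤
  rw [← hspan, eq_top_iff]
  intro F _
  have : F ∈ (Algebra.adjoin ℝ (S : Set C(X × X, ℝ))).topologicalClosure := by
    rw [htop]
    trivial
  exact this

/-! ### Continuous observables depending on a parameter. -/

section ContinuousObservables

variable {d : ℕ}

/-- Pointwise convergence of equi-Lipschitz functionals is a closed condition. -/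
theorem isClosed_setOf_tendsto_of_lipschitz {E ι : Type*} [SeminormedAddCommGroup E] {l : Filter ι}
    {L : ι → E → ℝ} {L₀ : E → ℝ} {C : ℝ} (h : ∀ᶠ i in l, ∀ x y, |L i x - L i y| ≤ C * ‖x - y‖)
    (h₀ : ∀ x y, |L₀ x - L₀ y| ≤ C * ‖x - y‖) :
    IsClosed {x | Tendsto (fun i => L i x) l (𝓝 (L₀ x))} := by
  refine isClosed_of_closure_subset fun x hx => ?_
  rw [Set.mem_ofPred_eq, Metric.tendsto_nhds]
  intro η hη
  obtain ⟨y, hy, hxy⟩ := Metric.mem_closure_iff.1 hx (η / (3 * (|C| + 1))) (by positivity)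
  rw [dist_eq_norm] at hxy
  have hC : C * ‖x - y‖ < η / 3 := by
    calc C * ‖x - y‖ ≤ (|C| + 1) * ‖x - y‖ := by
          gcongr
          linarith [le_abs_self C]
      _ < (|C| + 1) * (η / (3 * (|C| + 1))) := by gcongr
      _ = η / 3 := by field_simp
  have hy' := Metric.tendsto_nhds.1 hy (η / 3) (by positivity)
  filter_upwards [hy', h] with i a1 a2
  rw [Real.dist_eq] at a1 ⊢
  have b1 := abs_lt.1 a1
  have b2 := abs_le.1 (a2 x y)
  have b3 := abs_le.1 (h₀ x y)
  rw [abs_lt]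
  constructor <;> linarith

variable {X Y : Type*} [MetricSpace X] [CompactSpace X] [MeasurableSpace X] [BorelSpace X]
  [MeasurableSpace Y] {μ : Measure Y}

/-- Measurability rests on the joint continuity of evaluation on `C(X, ℝ) × X`; the sup norm
provides the majorant. -/
theorem integrable_eval_continuousMap {f : Y → C(X, ℝ)} (hf : Integrable f μ) {z : Y → X}
    (hz : Measurable z) : Integrable (fun y => f y (z y)) μ := by
  refine Integrable.mono' hf.norm ?_ (ae_of_all _ fun y => (f y).norm_coe_le_norm (z y))
  have h : AEStronglyMeasurable (fun y => (f y, z y)) μ := hf.1.prodMk hz.aestronglyMeasurable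
  exact (continuous_eval (F := C(X, ℝ))).comp_aestronglyMeasurable h

theorem abs_integral_sub_integral_le (Q : Measure X) [IsProbabilityMeasure Q] (F G : C(X, ℝ)) :
    |(∫ q, F q ∂Q) - ∫ q, G q ∂Q| ≤ ‖F - G‖ := by
  have hi : ∀ F : C(X, ℝ), Integrable F Q := fun F =>
    Integrable.of_bound F.continuous.aestronglyMeasurable ‖F‖ (ae_of_all _ F.norm_coe_le_norm)
  rw [← integral_sub (hi F) (hi G)]
  have := norm_integral_le_of_norm_le_const (μ := Q) (f := fun q => F q - G q) (C := ‖F - G‖)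
    (ae_of_all _ fun q => (F - G).norm_coe_le_norm q)
  simpa using this

theorem integrable_integral_continuousMap (Q : Measure X) [IsProbabilityMeasure Q]
    {f : Y → C(X, ℝ)} (hf : Integrable f μ) : Integrable (fun y => ∫ q, f y q ∂Q) μ := by
  have hc : Continuous fun F : C(X, ℝ) => ∫ q, F q ∂Q :=
    (LipschitzWith.of_dist_le_mul (K := 1) fun F G => by
      rw [Real.dist_eq, dist_eq_norm, NNReal.coe_one, one_mul]
      exact abs_integral_sub_integral_le Q F G).continuous
  refine Integrable.mono' hf.norm (hc.comp_aestronglyMeasurable hf.1) (ae_of_all _ fun y => ?_)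
  simpa using abs_integral_sub_integral_le Q (f y) 0

/-- If `F ∘ z i` converges weak-* to the mean of `F` for each continuous `F`, then the same holds
for continuous functions depending integrably on a parameter. -/
theorem tendsto_integral_eval_continuousMap {ι : Type*} {l : Filter ι} (Q : Measure X)
    [IsProbabilityMeasure Q] {z : ι → Y → X} (hz : ∀ i, Measurable (z i))
    (h : ∀ (F : C(X, ℝ)) (φ : Y → ℝ), Integrable φ μ →
      Tendsto (fun i => ∫ y, F (z i y) * φ y ∂μ) l (𝓝 (∫ y, (∫ q, F q ∂Q) * φ y ∂μ)))
    {f : Y → C(X, ℝ)} (hf : Integrable f μ) :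
    Tendsto (fun i => ∫ y, f y (z i y) ∂μ) l (𝓝 (∫ y, (∫ q, f y q ∂Q) ∂μ)) := by
  -- For `F` times an indicator this is the hypothesis with that indicator as test function. Both
  -- sides are `1`-Lipschitz in the `L¹` norm, so the property is closed.
  refine Integrable.induction (P := fun f : Y → C(X, ℝ) => Tendsto (fun i => ∫ y, f y (z i y) ∂μ) l
    (𝓝 (∫ y, (∫ q, f y q ∂Q) ∂μ))) ?_ ?_ ?_ ?_ hf
  · intro F s hs hμs
    have hi : Integrable (s.indicator (1 : Y → ℝ)) μ :=
      (integrable_indicator_iff hs).2 (integrableOn_const hμs.ne)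
    have key := h F _ hi
    have e1 : ∀ i y, F (z i y) * s.indicator (1 : Y → ℝ) y =
        (s.indicator (fun _ => F) y) (z i y) := by
      intro i y
      by_cases hy : y ∈ s <;> simp [hy]
    have e2 : ∀ y, (∫ q, F q ∂Q) * s.indicator (1 : Y → ℝ) y =
        ∫ q, (s.indicator (fun _ => F) y) q ∂Q := by
      intro y
      by_cases hy : y ∈ s <;> simp [hy]
    simpa only [e1, e2] using key
  · intro f g _ hfi hgi hf hg
    have e1 : ∀ i, ∫ y, (f + g) y (z i y) ∂μ = (∫ y, f y (z i y) ∂μ) + ∫ y, g y (z i y) ∂μ :=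
      fun i => integral_add (integrable_eval_continuousMap hfi (hz i))
        (integrable_eval_continuousMap hgi (hz i))
    have hQ : ∀ F : C(X, ℝ), Integrable F Q := fun F =>
      Integrable.of_bound F.continuous.aestronglyMeasurable ‖F‖ (ae_of_all _ F.norm_coe_le_norm)
    have e2 : ∫ y, (∫ q, (f + g) y q ∂Q) ∂μ =
        (∫ y, (∫ q, f y q ∂Q) ∂μ) + ∫ y, (∫ q, g y q ∂Q) ∂μ := by
      rw [← integral_add (integrable_integral_continuousMap Q hfi)
        (integrable_integral_continuousMap Q hgi)]
      exact integral_congr_ae (ae_of_all _ fun y => integral_add (hQ (f y)) (hQ (g y)))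
    simp only [e1, e2]
    exact hf.add hg
  · have hnorm : ∀ f g : Y →₁[μ] C(X, ℝ), ∫ y, ‖f y - g y‖ ∂μ = ‖f - g‖ := fun f g => by
      rw [L1.norm_eq_integral_norm]
      refine integral_congr_ae ?_
      filter_upwards [Lp.coeFn_sub f g] with y hy
      rw [hy, Pi.sub_apply]
    refine isClosed_setOf_tendsto_of_lipschitz (C := 1)
      (L := fun i (f : Y →₁[μ] C(X, ℝ)) => ∫ y, f y (z i y) ∂μ)
      (L₀ := fun f => ∫ y, (∫ q, f y q ∂Q) ∂μ) (Eventually.of_forall fun i f g => ?_) fun f g => ?_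
    · rw [one_mul, ← hnorm, ← integral_sub
        (integrable_eval_continuousMap (L1.integrable_coeFn f) (hz i))
        (integrable_eval_continuousMap (L1.integrable_coeFn g) (hz i))]
      exact norm_integral_le_of_norm_le (f := fun y => f y (z i y) - g y (z i y))
        ((L1.integrable_coeFn f).sub (L1.integrable_coeFn g)).norm
        (ae_of_all _ fun y => (f y - g y).norm_coe_le_norm (z i y))
    · rw [one_mul, ← hnorm, ← integral_sub
        (integrable_integral_continuousMap Q (L1.integrable_coeFn f))
        (integrable_integral_continuousMap Q (L1.integrable_coeFn g))]
      exact norm_integral_le_of_norm_le (f := fun y => (∫ q, f y q ∂Q) - ∫ q, g y q ∂Q)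
        ((L1.integrable_coeFn f).sub (L1.integrable_coeFn g)).norm
        (ae_of_all _ fun y => abs_integral_sub_integral_le Q (f y) (g y))
  · intro f g hfg _ hf
    have e1 : ∀ i, ∫ y, f y (z i y) ∂μ = ∫ y, g y (z i y) ∂μ := fun i =>
      integral_congr_ae (hfg.mono fun y hy => by simp only [hy])
    have e2 : ∫ y, (∫ q, f y q ∂Q) ∂μ = ∫ y, (∫ q, g y q ∂Q) ∂μ :=
      integral_congr_ae (hfg.mono fun y hy => by simp only [hy])
    simpa only [e1, e2] using hf

end ContinuousObservables

/-! ### Continuous kernels over a compact metric space. -/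

section CompactSystem

variable {d : ℕ} {Ω : Type*} [MeasurableSpace Ω] [MetricSpace Ω] [CompactSpace Ω] [BorelSpace Ω]
  {P : Measure Ω} [IsProbabilityMeasure P] {T : RSpace d → Ω → Ω}

/-- On a compact metric space, almost every orbit is generic for all continuous observables. -/
theorem IsErgodicSystem.ae_forall_hasOrbitMean (hT : IsErgodicSystem P T) :
    ∀ᵐ ω ∂P, ∀ F : C(Ω, ℝ), HasOrbitMean T F (∫ ω', F ω' ∂P) ω := by
  -- Separability of `C(Ω, ℝ)` yields one null set for a countable dense family; the equi-Lipschitz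
  -- bound extends the limit to every `F` on the same event.
  obtain ⟨D, hDc, hD⟩ := TopologicalSpace.exists_countable_dense C(Ω, ℝ)
  have h1 : ∀ᵐ ω ∂P, ∀ F ∈ D, HasOrbitMean T F (∫ ω', F ω' ∂P) ω :=
    (ae_ball_iff hDc).2 fun F _ => hT.ae_hasOrbitMean F.continuous.measurable
      (ae_of_all _ F.norm_coe_le_norm)
  filter_upwards [h1] with ω hω F φ hφ hφc
  have hi := hφ.integrable_of_hasCompactSupport (μ := volume) hφc
  have hclosed : IsClosed {F : C(Ω, ℝ) | Tendsto (fun ε : ℝ => ∫ x, F (T (ε⁻¹ • x) ω) * φ x)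
      (𝓝[>] 0) (𝓝 ((∫ ω', F ω' ∂P) * ∫ x, φ x))} := by
    refine isClosed_setOf_tendsto_of_lipschitz (C := ∫ x, ‖φ x‖)
      (L := fun (ε : ℝ) (F : C(Ω, ℝ)) => ∫ x, F (T (ε⁻¹ • x) ω) * φ x)
      (L₀ := fun F => (∫ ω', F ω' ∂P) * ∫ x, φ x) ?_ fun F G => ?_
    · filter_upwards [self_mem_nhdsWithin] with ε hε F G
      have hF : ∀ F : C(Ω, ℝ), Integrable fun x => F (T (ε⁻¹ • x) ω) * φ x := fun F =>
        hT.integrable_orbit_mul F.continuous.measurable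
          (ae_of_all _ fun y => F.norm_coe_le_norm (T y ω)) hε hi
      rw [← integral_sub (hF F) (hF G), mul_comm, ← integral_const_mul]
      refine norm_integral_le_of_norm_le
        (f := fun x => F (T (ε⁻¹ • x) ω) * φ x - G (T (ε⁻¹ • x) ω) * φ x)
        (hi.norm.const_mul _) (ae_of_all _ fun x => ?_)
      rw [← sub_mul, norm_mul]
      exact mul_le_mul_of_nonneg_right ((F - G).norm_coe_le_norm _) (norm_nonneg _)
    · rw [← sub_mul, abs_mul, mul_comm]
      exact mul_le_mul (norm_integral_le_integral_norm φ) (abs_integral_sub_integral_le P F G)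
        (abs_nonneg _) (integral_nonneg fun _ => norm_nonneg _)
  exact closure_minimal (fun F hF => hω F hF φ hφ hφc) hclosed (hD F)

/-- Both arguments follow the orbit of one `ω`, yet the limit is the mean over `P.prod P`: for `c(x)
e(y)` the two factors oscillate in independent integration variables. Density of such products and a
Lipschitz bound in `F` give the general case. -/
theorem tendsto_integral_continuousMap_pair (hT : IsErgodicSystem P T) {ω : Ω}
    (hω : ∀ F : C(Ω, ℝ), HasOrbitMean T F (∫ ω', F ω' ∂P) ω) (F : C(Ω × Ω, ℝ))
    {φ : RSpace d × RSpace d → ℝ} (hφ : Integrable φ) :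
    Tendsto (fun ε : ℝ => ∫ p, F (T (ε⁻¹ • p.1) ω, T (ε⁻¹ • p.2) ω) * φ p) (𝓝[>] 0)
      (𝓝 (∫ p, (∫ q, F q ∂(P.prod P)) * φ p)) := by
  have horb : ∀ ε : ℝ, Measurable fun x : RSpace d => T (ε⁻¹ • x) ω := fun ε =>
    (hT.measurable_orbit ω).comp (measurable_const_smul ε⁻¹)
  have hpair : ∀ ε : ℝ, Measurable fun p : RSpace d × RSpace d =>
      (T (ε⁻¹ • p.1) ω, T (ε⁻¹ • p.2) ω) := fun ε =>
    ((horb ε).comp measurable_fst).prodMk ((horb ε).comp measurable_snd)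
  have hF : ∀ (F : C(Ω × Ω, ℝ)) (ε : ℝ), Integrable fun p : RSpace d × RSpace d =>
      F (T (ε⁻¹ • p.1) ω, T (ε⁻¹ • p.2) ω) * φ p := fun F ε =>
    hφ.bdd_mul (F.continuous.measurable.comp (hpair ε)).aestronglyMeasurable
      (ae_of_all _ fun p => F.norm_coe_le_norm _)
  have hFP : ∀ F : C(Ω × Ω, ℝ), Integrable F (P.prod P) := fun F =>
    Integrable.of_bound F.continuous.aestronglyMeasurable ‖F‖ (ae_of_all _ F.norm_coe_le_norm)
  simp only [integral_const_mul]
  have hclosed : IsClosed {F : C(Ω × Ω, ℝ) | Tendsto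
      (fun ε : ℝ => ∫ p, F (T (ε⁻¹ • p.1) ω, T (ε⁻¹ • p.2) ω) * φ p)
      (𝓝[>] 0) (𝓝 ((∫ q, F q ∂(P.prod P)) * ∫ p, φ p))} := by
    refine isClosed_setOf_tendsto_of_lipschitz (C := ∫ p, ‖φ p‖)
      (L := fun (ε : ℝ) (F : C(Ω × Ω, ℝ)) => ∫ p, F (T (ε⁻¹ • p.1) ω, T (ε⁻¹ • p.2) ω) * φ p)
      (L₀ := fun F => (∫ q, F q ∂(P.prod P)) * ∫ p, φ p)
      (Eventually.of_forall fun ε F G => ?_) fun F G => ?_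
    · rw [← integral_sub (hF F ε) (hF G ε), mul_comm, ← integral_const_mul]
      refine norm_integral_le_of_norm_le
        (f := fun p => F (T (ε⁻¹ • p.1) ω, T (ε⁻¹ • p.2) ω) * φ p -
          G (T (ε⁻¹ • p.1) ω, T (ε⁻¹ • p.2) ω) * φ p)
        (hφ.norm.const_mul _) (ae_of_all _ fun x => ?_)
      rw [← sub_mul, norm_mul]
      exact mul_le_mul_of_nonneg_right ((F - G).norm_coe_le_norm _) (norm_nonneg _)
    · rw [← sub_mul, abs_mul, mul_comm]
      exact mul_le_mul (norm_integral_le_integral_norm φ)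
        (abs_integral_sub_integral_le (P.prod P) F G)
        (abs_nonneg _) (integral_nonneg fun _ => norm_nonneg _)
  refine closure_minimal (fun F hFs => ?_) hclosed
    (show F ∈ _ from (dense_span_mul_continuousMap (X := Ω)).symm ▸ Submodule.mem_top :
      F ∈ (Submodule.span ℝ {F : C(Ω × Ω, ℝ) | ∃ c e : C(Ω, ℝ),
        ∀ q, F q = c q.1 * e q.2}).topologicalClosure)
  induction hFs using Submodule.span_induction with
  | mem F h =>
    obtain ⟨c, e, hce⟩ := h
    have hmean : ∀ F : C(Ω, ℝ), ∀ ψ : RSpace d → ℝ, Integrable ψ → Tendsto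
        (fun ε : ℝ => ∫ x, F (T (ε⁻¹ • x) ω) * ψ x) (𝓝[>] 0)
        (𝓝 (∫ x, (∫ ω', F ω' ∂P) * ψ x)) := fun F ψ hψ =>
      (hω F).tendsto_integral hT F.continuous.measurable
        (ae_of_all _ fun y => F.norm_coe_le_norm (T y ω)) hψ
    have hmeas : ∀ F : C(Ω, ℝ), ∀ ε : ℝ,
        AEStronglyMeasurable (fun x : RSpace d => F (T (ε⁻¹ • x) ω)) := fun F ε =>
      (F.continuous.measurable.comp (horb ε)).aestronglyMeasurable
    have := tendsto_integral_mul_mul (A := ‖c‖) (B := ‖e‖)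
      (Eventually.of_forall (hmeas c)) (Eventually.of_forall (hmeas e))
      (Eventually.of_forall fun ε => ae_of_all _ fun x => c.norm_coe_le_norm _)
      (Eventually.of_forall fun ε => ae_of_all _ fun x => e.norm_coe_le_norm _)
      (hmean c) (hmean e) hφ
    simp only [Set.mem_ofPred_eq, hce, integral_prod_mul (μ := P) (ν := P)
      (fun x => c x) fun x => e x]
    simpa only [integral_const_mul] using this
  | zero => simp
  | add F G _ _ h₁ h₂ =>
    have e1 : ∀ ε : ℝ, ∫ p, (F + G) (T (ε⁻¹ • p.1) ω, T (ε⁻¹ • p.2) ω) * φ p =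
        (∫ p, F (T (ε⁻¹ • p.1) ω, T (ε⁻¹ • p.2) ω) * φ p) +
        ∫ p, G (T (ε⁻¹ • p.1) ω, T (ε⁻¹ • p.2) ω) * φ p := fun ε => by
      rw [← integral_add (hF F ε) (hF G ε)]
      exact integral_congr_ae (ae_of_all _ fun p => by simp only [ContinuousMap.add_apply, add_mul])
    have e2 : ∫ q, (F + G) q ∂(P.prod P) = (∫ q, F q ∂(P.prod P)) + ∫ q, G q ∂(P.prod P) :=
      integral_add (hFP F) (hFP G)
    simp only [Set.mem_ofPred_eq, e1, e2, add_mul]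
    exact Tendsto.add h₁ h₂
  | smul a F _ h =>
    have e1 : ∀ ε : ℝ, ∫ p, (a • F) (T (ε⁻¹ • p.1) ω, T (ε⁻¹ • p.2) ω) * φ p =
        a * ∫ p, F (T (ε⁻¹ • p.1) ω, T (ε⁻¹ • p.2) ω) * φ p := fun ε => by
      rw [← integral_const_mul]
      exact integral_congr_ae (ae_of_all _ fun p => by
        simp only [ContinuousMap.smul_apply, smul_eq_mul, mul_assoc])
    have e2 : ∫ q, (a • F) q ∂(P.prod P) = a * ∫ q, F q ∂(P.prod P) := by
      rw [← integral_const_mul]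
      rfl
    simp only [Set.mem_ofPred_eq, e1, e2, mul_assoc]
    exact Tendsto.const_mul a h

/-- Homogenization of symmetric random kernels over a compact metric space. -/
theorem IsErgodicSystem.ae_homogenizes_of_continuous (hT : IsErgodicSystem P T)
    {α m γ : ℝ} (hα : 0 < α) (hm : 0 < m) (hγ : 0 < γ)
    {Λ : RSpace d → RSpace d → Ω → Ω → ℝ}
    (hΛ : Continuous fun q : RSpace d × RSpace d × Ω × Ω => Λ q.1 q.2.1 q.2.2.1 q.2.2.2)
    (hb : ∀ᵐ ω ∂P, ∀ ε : ℝ, 0 < ε → ∀ x y : RSpace d,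
      γ⁻¹ ≤ Λ x y (T (ε⁻¹ • x) ω) (T (ε⁻¹ • y) ω) ∧
      Λ x y (T (ε⁻¹ • x) ω) (T (ε⁻¹ • y) ω) ≤ γ) :
    ∀ᵐ ω ∂P, Homogenizes α m (fun ε x y => Λ x y (T (ε⁻¹ • x) ω) (T (ε⁻¹ • y) ω))
      (fun _ _ => 1) (fun x y => ∫ ω₁, ∫ ω₂, Λ x y ω₁ ω₂ ∂P ∂P) := by
  -- Currying separates the slow variables `(x, y)` from the fast ones: the kernel becomes a
  -- continuous `C(Ω × Ω)`-valued function, suited to Bochner integration.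
  let Λc : C(RSpace d × RSpace d, C(Ω × Ω, ℝ)) := ContinuousMap.curry
    ⟨fun q : (RSpace d × RSpace d) × (Ω × Ω) => Λ q.1.1 q.1.2 q.2.1 q.2.2,
      hΛ.comp (f := fun q : (RSpace d × RSpace d) × (Ω × Ω) => (q.1.1, q.1.2, q.2.1, q.2.2))
        (by fun_prop)⟩
  have hΛc : ∀ p q, Λc p q = Λ p.1 p.2 q.1 q.2 := fun p q => rfl
  set Λe : RSpace d × RSpace d → ℝ := fun p => ∫ ω₁, ∫ ω₂, Λ p.1 p.2 ω₁ ω₂ ∂P ∂P with hΛe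
  have hFP : ∀ F : C(Ω × Ω, ℝ), Integrable F (P.prod P) := fun F =>
    Integrable.of_bound F.continuous.aestronglyMeasurable ‖F‖ (ae_of_all _ F.norm_coe_le_norm)
  have hΛe' : ∀ p, Λe p = ∫ q, Λc p q ∂(P.prod P) := fun p => (integral_prod _ (hFP (Λc p))).symm
  have hΛecont : Continuous Λe := by
    have hc : Continuous fun F : C(Ω × Ω, ℝ) => ∫ q, F q ∂(P.prod P) :=
      (LipschitzWith.of_dist_le_mul (K := 1) fun F G => by
        rw [Real.dist_eq, dist_eq_norm, NNReal.coe_one, one_mul]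
        exact abs_integral_sub_integral_le (P.prod P) F G).continuous
    simp only [funext hΛe']
    exact hc.comp Λc.continuous
  filter_upwards [hb, hT.ae_forall_hasOrbitMean] with ω hbω hω
  have horb : ∀ ε : ℝ, Measurable fun x : RSpace d => T (ε⁻¹ • x) ω := fun ε =>
    (hT.measurable_orbit ω).comp (measurable_const_smul ε⁻¹)
  let z : ℝ → RSpace d × RSpace d → Ω × Ω := fun ε p => (T (ε⁻¹ • p.1) ω, T (ε⁻¹ • p.2) ω)
  have hz : ∀ ε, Measurable (z ε) := fun ε =>
    ((horb ε).comp measurable_fst).prodMk ((horb ε).comp measurable_snd)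
  have hΛm : ∀ ε : ℝ, Measurable fun p : RSpace d × RSpace d =>
      Λ p.1 p.2 (T (ε⁻¹ • p.1) ω) (T (ε⁻¹ • p.2) ω) := fun ε =>
    hΛ.measurable.comp (measurable_fst.prodMk (measurable_snd.prodMk (hz ε)))
  have hpos : ∀ᶠ ε : ℝ in 𝓝[>] 0, 0 < ε := self_mem_nhdsWithin
  -- The sup norm of `Λ(x, y, ·, ·)` is controlled only for `(x, y)` in compact sets; the global
  -- bound `γ` is assumed only along orbits. Hence the test functions are localized here.
  have hlocal : ∀ (R : ℝ) (φ : RSpace d × RSpace d → ℝ), Integrable φ →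
      (∀ p, p ∉ Metric.closedBall (0 : RSpace d × RSpace d) R → φ p = 0) →
      Tendsto (fun ε : ℝ => ∫ p, Λ p.1 p.2 (T (ε⁻¹ • p.1) ω) (T (ε⁻¹ • p.2) ω) * φ p) (𝓝[>] 0)
        (𝓝 (∫ p, Λe p * φ p)) := by
    intro R φ hφ hsupp
    obtain ⟨M, hM⟩ := (isCompact_closedBall (0 : RSpace d × RSpace d)
      R).exists_bound_of_continuousOn
      Λc.continuous.continuousOn
    have hf : Integrable fun p => φ p • Λc p := by
      refine Integrable.mono' (hφ.norm.mul_const M)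
        (hφ.1.smul Λc.continuous.aestronglyMeasurable) (ae_of_all _ fun p => ?_)
      rw [norm_smul]
      by_cases hp : p ∈ Metric.closedBall (0 : RSpace d × RSpace d) R
      · exact mul_le_mul_of_nonneg_left (hM p hp) (norm_nonneg _)
      · simp [hsupp p hp]
    have key := tendsto_integral_eval_continuousMap (P.prod P) hz
      (fun F ψ hψ => tendsto_integral_continuousMap_pair hT hω F hψ) hf
    simp only [ContinuousMap.smul_apply, smul_eq_mul, integral_const_mul, ← hΛe'] at key
    simp only [mul_comm _ (φ _)]
    exact key
  have hset : ∀ (R : ℝ) (s : Set (RSpace d × RSpace d)), MeasurableSet s →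
      Tendsto (fun ε : ℝ => ∫ p in s ∩ Metric.closedBall 0 R,
        Λ p.1 p.2 (T (ε⁻¹ • p.1) ω) (T (ε⁻¹ • p.2) ω)) (𝓝[>] 0)
        (𝓝 (∫ p in s ∩ Metric.closedBall 0 R, Λe p)) := by
    intro R s hs
    have hsm := hs.inter (Metric.isClosed_closedBall (x := (0 : RSpace d × RSpace d))
      (ε := R)).measurableSet
    have hfin : volume (s ∩ Metric.closedBall (0 : RSpace d × RSpace d) R) ≠ ⊤ :=
      measure_ne_top_of_subset Set.inter_subset_right measure_closedBall_lt_top.ne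
    have h1 : Integrable ((s ∩ Metric.closedBall (0 : RSpace d × RSpace d) R).indicator
        (1 : RSpace d × RSpace d → ℝ)) :=
      (integrable_indicator_iff hsm).2 (integrableOn_const hfin)
    have key := hlocal R _ h1 fun p hp => Set.indicator_of_notMem (fun h => hp h.2) _
    have e : ∀ f : RSpace d × RSpace d → ℝ,
        ∫ p, f p * (s ∩ Metric.closedBall (0 : RSpace d × RSpace d) R).indicator
          (1 : RSpace d × RSpace d → ℝ) p = ∫ p in s ∩ Metric.closedBall 0 R, f p := fun f => by
      rw [← integral_indicator hsm]
      refine integral_congr_ae (ae_of_all _ fun p => ?_)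
      by_cases hp : p ∈ s ∩ Metric.closedBall (0 : RSpace d × RSpace d) R
      · simp only [Set.indicator_of_mem hp, Pi.one_apply, mul_one]
      · simp only [Set.indicator_of_notMem hp, mul_zero]
    simpa only [e] using key
  -- Ellipticity is known only along orbits. It passes to the effective kernel by integrating over
  -- sets of finite measure and taking the limit.
  have hΛeb : ∀ᵐ p, Λe p ∈ Set.Icc γ⁻¹ γ := by
    have hn : ∀ n : ℕ, ∀ᵐ p ∂(volume.restrict (Metric.closedBall (0 : RSpace d × RSpace d) n)),
        Λe p ∈ Set.Icc γ⁻¹ γ := by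
      intro n
      have : IsFiniteMeasure (volume.restrict (Metric.closedBall (0 : RSpace d × RSpace d) n)) :=
        ⟨by rw [Measure.restrict_apply_univ]; exact measure_closedBall_lt_top⟩
      have hint : Integrable Λe (volume.restrict (Metric.closedBall (0 : RSpace d × RSpace d) n)) :=
        hΛecont.continuousOn.integrableOn_compact (isCompact_closedBall _ _)
      have hio : ∀ (s : Set (RSpace d × RSpace d)) (ε : ℝ), 0 < ε → IntegrableOn
          (fun p : RSpace d × RSpace d => Λ p.1 p.2 (T (ε⁻¹ • p.1) ω) (T (ε⁻¹ • p.2) ω))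
          (s ∩ Metric.closedBall 0 n) := fun s ε hε =>
        IntegrableOn.of_bound ((measure_mono Set.inter_subset_right).trans_lt
          measure_closedBall_lt_top) (hΛm ε).aestronglyMeasurable γ
          (ae_of_all _ fun p => abs_le_of_mem_Icc_of_pos (inv_pos.2 hγ) (hbω ε hε p.1 p.2))
      have hic : ∀ (s : Set (RSpace d × RSpace d)) (c : ℝ), IntegrableOn
          (fun _ : RSpace d × RSpace d => c) (s ∩ Metric.closedBall 0 n) := fun s c =>
        integrableOn_const (measure_ne_top_of_subset Set.inter_subset_right
          measure_closedBall_lt_top.ne)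
      have lo := ae_le_of_forall_setIntegral_le (f := fun _ => γ⁻¹) (integrable_const γ⁻¹) hint
        fun s hs _ => by
          rw [Measure.restrict_restrict hs]
          refine ge_of_tendsto (hset n s hs) ?_
          filter_upwards [hpos] with ε hε
          exact setIntegral_mono (hic s _) (hio s ε hε) fun p => (hbω ε hε p.1 p.2).1
      have hi := ae_le_of_forall_setIntegral_le (g := fun _ => γ) hint (integrable_const γ)
        fun s hs _ => by
          rw [Measure.restrict_restrict hs]
          refine le_of_tendsto (hset n s hs) ?_
          filter_upwards [hpos] with ε hε
          exact setIntegral_mono (hio s ε hε) (hic s _) fun p => (hbω ε hε p.1 p.2).2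
      filter_upwards [lo, hi] with p h1 h2 using ⟨h1, h2⟩
    have hn' : ∀ᵐ p : RSpace d × RSpace d, ∀ n : ℕ,
        p ∈ Metric.closedBall (0 : RSpace d × RSpace d) n → Λe p ∈ Set.Icc γ⁻¹ γ :=
      ae_all_iff.2 fun n => (ae_restrict_iff' Metric.isClosed_closedBall.measurableSet).1 (hn n)
    filter_upwards [hn'] with p hp
    obtain ⟨n, hn⟩ := exists_nat_ge ‖p‖
    exact hp n (by rwa [mem_closedBall_zero_iff])
  -- A single value in the interval forces `γ ≥ 1`, so the weight `1` satisfies the same ellipticity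
  -- bounds.
  obtain ⟨p₀, hp₀⟩ := hΛeb.exists
  have hγ1 : γ⁻¹ ≤ γ := hp₀.1.trans hp₀.2
  have hγ1' : (1 : ℝ) ≤ γ := by
    by_contra! h
    exact absurd hγ1 (not_le.2 (h.trans ((one_lt_inv₀ hγ).2 h)))
  have hone : (1 : ℝ) ∈ Set.Icc γ⁻¹ γ := ⟨inv_le_one_of_one_le₀ hγ1', hγ1'⟩
  refine homogenizes_of_weakStar (a := γ⁻¹) (b := γ) (c := 1) hα hm (inv_pos.2 hγ) one_ne_zero
    (fun ε hε => ?_) ?_ (fun φ hφ => ?_) fun φ hφ => ?_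
  · refine ⟨?_, ae_of_all _ fun p => ?_, aestronglyMeasurable_const, ae_of_all _ fun _ => hone⟩
    · simpa only [mul_one] using (hΛm ε).aestronglyMeasurable
    · rw [mul_one]
      exact hbω ε hε p.1 p.2
  · refine ⟨?_, ?_, aestronglyMeasurable_const, ae_of_all _ fun _ => hone⟩
    · simpa only [mul_one] using hΛecont.aestronglyMeasurable
    · simpa only [mul_one] using hΛeb
  · simp only [mul_one]
    refine tendsto_integral_mul_of_hasCompactSupport (C := γ) (C₀ := γ) (h₀ := Λe)
      (h := fun (ε : ℝ) (p : RSpace d × RSpace d) => Λ p.1 p.2 (T (ε⁻¹ • p.1) ω) (T (ε⁻¹ • p.2) ω))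
      (Eventually.of_forall fun ε => (hΛm ε).aestronglyMeasurable) ?_
      hΛecont.aestronglyMeasurable
      (hΛeb.mono fun p hp => abs_le_of_mem_Icc_of_pos (inv_pos.2 hγ) hp) (fun ψ hψ hψc => ?_) hφ
    · filter_upwards [hpos] with ε hε
      exact ae_of_all _ fun p => abs_le_of_mem_Icc_of_pos (inv_pos.2 hγ) (hbω ε hε p.1 p.2)
    · obtain ⟨R, hR⟩ := hψc.isCompact.isBounded.subset_closedBall (0 : RSpace d × RSpace d)
      refine hlocal R ψ (hψ.integrable_of_hasCompactSupport hψc) fun p hp => ?_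
      by_contra h
      exact hp (hR (subset_tsupport ψ h))
  · exact tendsto_const_nhds

end CompactSystem

/-! ### Kernels with product structure. -/

section ProductStructure

variable {d : ℕ} {Ω : Type*} [MeasurableSpace Ω]
  {P : Measure Ω} [IsProbabilityMeasure P] {T : RSpace d → Ω → Ω}

/-- Homogenization of kernels with product structure. -/
theorem IsErgodicSystem.ae_homogenizes_of_product (hT : IsErgodicSystem P T)
    {α m γ : ℝ} (hα : 0 < α) (hm : 0 < m) (hγ : 0 < γ) {lam mu : Ω → ℝ}
    (hlam : Measurable lam) (hmu : Measurable mu)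
    (hb : ∀ᵐ ω ∂P, γ⁻¹ ≤ lam ω ∧ lam ω ≤ γ ∧ γ⁻¹ ≤ mu ω ∧ mu ω ≤ γ) :
    ∀ᵐ ω ∂P, Homogenizes α m
      (fun ε x y => lam (T (ε⁻¹ • x) ω) * mu (T (ε⁻¹ • y) ω))
      (fun ε x => mu (T (ε⁻¹ • x) ω) / lam (T (ε⁻¹ • x) ω))
      (fun _ _ => (∫ ω', mu ω' / lam ω' ∂P)⁻¹ * (∫ ω', mu ω' ∂P) ^ 2) := by
  have hγi : 0 < γ⁻¹ := inv_pos.2 hγ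
  have hrm : Measurable fun ω => mu ω / lam ω := hmu.div hlam
  have hbmu : ∀ᵐ ω ∂P, mu ω ∈ Set.Icc γ⁻¹ γ := hb.mono fun ω h => ⟨h.2.2.1, h.2.2.2⟩
  have hbr : ∀ᵐ ω ∂P, mu ω / lam ω ∈ Set.Icc (γ⁻¹ * γ⁻¹) (γ * γ) := hb.mono fun ω h => by
    have hl : 0 < lam ω := hγi.trans_le h.1
    have hmu0 : 0 < mu ω := hγi.trans_le h.2.2.1
    rw [div_eq_mul_inv]
    constructor
    · have : γ⁻¹ ≤ (lam ω)⁻¹ := inv_anti₀ hl h.2.1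
      exact mul_le_mul h.2.2.1 this hγi.le hmu0.le
    · have : (lam ω)⁻¹ ≤ γ := inv_le_of_inv_le₀ hγ h.1
      exact mul_le_mul h.2.2.2 this (inv_pos.2 hl).le hγ.le
  have hmean : ∀ {g : Ω → ℝ} {a b : ℝ}, Measurable g → 0 < a → (∀ᵐ ω ∂P, g ω ∈ Set.Icc a b) →
      (∫ ω, g ω ∂P) ∈ Set.Icc a b := by
    intro g a b hg ha h
    have hi : Integrable g P := Integrable.of_bound hg.aestronglyMeasurable b
      (h.mono fun ω hω => abs_le_of_mem_Icc_of_pos ha hω)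
    constructor
    · simpa using integral_mono_ae (integrable_const a) hi (h.mono fun ω hω => hω.1)
    · simpa using integral_mono_ae hi (integrable_const b) (h.mono fun ω hω => hω.2)
  have hMmu := hmean hmu hγi hbmu
  have hMr := hmean hrm (mul_pos hγi hγi) hbr
  set M := ∫ ω', mu ω' ∂P
  set c := ∫ ω', mu ω' / lam ω' ∂P
  have hc : c ≠ 0 := ((mul_pos hγi hγi).trans_le hMr.1).ne'
  -- The factor `c⁻¹` in the effective kernel compensates the limit weight `c`, so the symmetrized
  -- limit kernel is the square of the mean of `mu`.
  have hKc : c⁻¹ * M ^ 2 * c = M * M := by field_simp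
  have hprod : ∀ {s t : ℝ}, s ∈ Set.Icc γ⁻¹ γ → t ∈ Set.Icc γ⁻¹ γ →
      s * t ∈ Set.Icc (γ⁻¹ * γ⁻¹) (γ * γ) := fun {s t} hs ht =>
    ⟨mul_le_mul hs.1 ht.1 hγi.le (hγi.le.trans hs.1),
      mul_le_mul hs.2 ht.2 (hγi.le.trans ht.1) hγ.le⟩
  have hamu : ∀ᵐ ω ∂P, |mu ω| ≤ γ := hbmu.mono fun ω h => abs_le_of_mem_Icc_of_pos hγi h
  have har : ∀ᵐ ω ∂P, |mu ω / lam ω| ≤ γ * γ :=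
    hbr.mono fun ω h => abs_le_of_mem_Icc_of_pos (mul_pos hγi hγi) h
  have hlam0 : ∀ᵐ ω ∂P, lam ω ≠ 0 := hb.mono fun ω h => (hγi.trans_le h.1).ne'
  filter_upwards [hT.ae_hasOrbitMean hmu hamu, hT.ae_hasOrbitMean hrm har, hT.ae_orbit hbmu,
    hT.ae_orbit hbr, hT.ae_orbit hamu, hT.ae_orbit har, hT.ae_orbit hlam0]
    with ω omu orr bmu br amu ar l0
  have horb : ∀ ε : ℝ, Measurable fun x : RSpace d => T (ε⁻¹ • x) ω := fun ε =>
    (hT.measurable_orbit ω).comp (measurable_const_smul ε⁻¹)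
  have hmum : ∀ ε : ℝ, Measurable fun x : RSpace d => mu (T (ε⁻¹ • x) ω) := fun ε =>
    hmu.comp (horb ε)
  -- The weight cancels `lam`, so the symmetrized kernel is a tensor product of one observable with
  -- itself, to which the tensor-product limit applies.
  have hker : ∀ ε : ℝ, 0 < ε → ∀ᵐ p : RSpace d × RSpace d,
      lam (T (ε⁻¹ • p.1) ω) * mu (T (ε⁻¹ • p.2) ω) *
        (mu (T (ε⁻¹ • p.1) ω) / lam (T (ε⁻¹ • p.1) ω)) =
      mu (T (ε⁻¹ • p.1) ω) * mu (T (ε⁻¹ • p.2) ω) := fun ε hε => by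
    have h1 := ae_orbit_smul (p := fun ω => lam ω ≠ 0) l0 hε
    filter_upwards [Measure.quasiMeasurePreserving_fst.ae h1] with p hp
    rw [mul_comm (mu _) (mu _), mul_comm (lam _) (mu _), mul_assoc, mul_div_cancel₀ _ hp]
  have hmm : ∀ ε : ℝ, Measurable fun p : RSpace d × RSpace d =>
      mu (T (ε⁻¹ • p.1) ω) * mu (T (ε⁻¹ • p.2) ω) := fun ε =>
    ((hmum ε).comp measurable_fst).mul ((hmum ε).comp measurable_snd)
  refine homogenizes_of_weakStar (a := γ⁻¹ * γ⁻¹) (b := γ * γ) (c := c) hα hm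
    (mul_pos hγi hγi) hc (fun ε hε => ?_) ?_ (fun φ hφ => ?_) fun φ hφ => ?_
  · refine ⟨(hmm ε).aestronglyMeasurable.congr ?_, ?_,
      (hrm.comp (horb ε)).aestronglyMeasurable,
      ae_orbit_smul (p := fun ω => mu ω / lam ω ∈ Set.Icc (γ⁻¹ * γ⁻¹) (γ * γ)) br hε⟩
    · filter_upwards [hker ε hε] with p hp using hp.symm
    · have h1 := ae_orbit_smul (p := fun ω => mu ω ∈ Set.Icc γ⁻¹ γ) bmu hε
      filter_upwards [hker ε hε, Measure.quasiMeasurePreserving_fst.ae h1,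
        Measure.quasiMeasurePreserving_snd.ae h1] with p hp h2 h3
      rw [hp]
      exact hprod h2 h3
  · refine ⟨aestronglyMeasurable_const, ae_of_all _ fun p => ?_, aestronglyMeasurable_const,
      ae_of_all _ fun _ => hMr⟩
    rw [hKc]
    exact hprod hMmu hMmu
  · have hbd : ∀ᶠ ε : ℝ in 𝓝[>] 0, ∀ᵐ x : RSpace d, |mu (T (ε⁻¹ • x) ω)| ≤ γ := by
      filter_upwards [self_mem_nhdsWithin] with ε hε
      exact ae_orbit_smul (p := fun ω => |mu ω| ≤ γ) amu hε
    have hw := fun ψ hψ => omu.tendsto_integral hT hmu amu (φ := ψ) hψ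
    have hme : ∀ᶠ ε : ℝ in 𝓝[>] 0, AEStronglyMeasurable fun x : RSpace d =>
        mu (T (ε⁻¹ • x) ω) := Eventually.of_forall fun ε => (hmum ε).aestronglyMeasurable
    simp only [hKc]
    refine (tendsto_integral_mul_mul hme hme hbd hbd hw hw hφ).congr' ?_
    filter_upwards [self_mem_nhdsWithin] with ε hε
    refine integral_congr_ae ?_
    filter_upwards [hker ε hε] with p hp
    rw [hp]
  · exact orr.tendsto_integral hT hrm ar hφ

end ProductStructure

theorem theorem1p3 {d : ℕ} (hd : 0 < d) (α : ℝ) (hα₀ : 0 < α) (hα₂ : α < 2)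
    (m : ℝ) (hm : 0 < m) {Ω : Type*} [MeasurableSpace Ω]
    (P : Measure Ω) [IsProbabilityMeasure P]
    (T : RSpace d → Ω → Ω) (hT : IsErgodicSystem P T)
    (γ : ℝ) (hγ : 0 < γ) :
    -- Product structure
    (∀ lam mu : Ω → ℝ, Measurable lam → Measurable mu →
      (∀ᵐ ω ∂P, γ⁻¹ ≤ lam ω ∧ lam ω ≤ γ ∧ γ⁻¹ ≤ mu ω ∧ mu ω ≤ γ) →
      ∀ᵐ ω ∂P, Homogenizes α m
        (fun ε x y => lam (T (ε⁻¹ • x) ω) * mu (T (ε⁻¹ • y) ω))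
        (fun ε x => mu (T (ε⁻¹ • x) ω) / lam (T (ε⁻¹ • x) ω))
        (fun _ _ => (∫ ω', mu ω' / lam ω' ∂P)⁻¹ * (∫ ω', mu ω' ∂P) ^ 2)) ∧
    -- Symmetric random structure on a compact metric space
    (∀ [MetricSpace Ω] [CompactSpace Ω] [BorelSpace Ω],
      (∀ x, Continuous (T x)) →
      ∀ Λ : RSpace d → RSpace d → Ω → Ω → ℝ,
        Continuous (fun q : RSpace d × RSpace d × Ω × Ω => Λ q.1 q.2.1 q.2.2.1 q.2.2.2) →
        (∀ x y ω₁ ω₂, Λ x y ω₁ ω₂ = Λ y x ω₂ ω₁) →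
        (∀ᵐ ω ∂P, ∀ ε : ℝ, 0 < ε → ∀ x y : RSpace d,
          γ⁻¹ ≤ Λ x y (T (ε⁻¹ • x) ω) (T (ε⁻¹ • y) ω) ∧
          Λ x y (T (ε⁻¹ • x) ω) (T (ε⁻¹ • y) ω) ≤ γ) →
        ∀ᵐ ω ∂P, Homogenizes α m
          (fun ε x y => Λ x y (T (ε⁻¹ • x) ω) (T (ε⁻¹ • y) ω))
          (fun _ _ => 1)
          (fun x y => ∫ ω₁, ∫ ω₂, Λ x y ω₁ ω₂ ∂P ∂P)) := by
  exact ⟨fun lam mu hlam hmu hb => hT.ae_homogenizes_of_product hα₀ hm hγ hlam hmu hb,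
    fun _ Λ hΛ _ hb => hT.ae_homogenizes_of_continuous hα₀ hm hγ hΛ hb⟩
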